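/- Let $B$ be a definite quaternion algebra over $\mathbb Q$, and write $B_p = B\otimes\mathbb Q_p$. For an order $\mathcal O\subset B$ put $\mathcal O_p = \mathcal O\otimes\mathbb Z_p$. *Local special orders.* If $B_p\simeq M_2(\mathbb Q_p)$, a special order of level $p^r$ ($r\ge 0$) in $B_p$ is an order conjugate to $\begin{pmatrix}\mathbb Z_p&\mathbb Z_p\\ p^r\mathbb Z_p&\mathbb Z_p\end{pmatrix}$. If $B_p$ is a division algebra with maximal order $\mathcal O_{B,p}$ and maximal two-sided ideal $\mathfrak P\subset\mathcal O_{B,p}$, put $\mathcal O_r(E)=\mathfrak o_E+\mathfrak P^{r-1}$ for $r\ge1$ and $E/\mathbb Q_p$ a quadratic field extension (embedded in $B_p$); an order in $B_p$ is special of level $p^r$ if $r$ is minimal such that the order is isomorphic to $\mathcal O_r(E)$ for some such $E$. *Level type.* Let $N_1,N_2,M$ be pairwise coprime positive integers and $N=N_1N_2M$. An order $\mathcal O\subset B$ is a special order of level type $(N_1,N_2,M)$ if: $\mathcal O_p$ is special of level $p^{\mathrm{ord}_p(N)}$ for every prime $p$; the primes dividing $N_1N_2$ are exactly those at which $B_p$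 is a division algebra; $\mathrm{ord}_p(N)$ is odd for $p\mid N_1$ and even for $p\mid N_2$; and for $p\mid N_1$ one has $\mathcal O_p\simeq\mathcal O_r(E)$ with $r=\mathrm{ord}_p(N)$ and $E/\mathbb Q_p$ the unramified quadratic extension. *Balanced orders.* Let $\mathcal I_1,\dots,\mathcal I_n$ represent the classes of invertible (i.e. locally principal) right $\mathcal O$-ideals of $B$, let $\mathcal O_\ell(\mathcal I_i)=\{\alpha\in B:\alpha\mathcal I_i\subset\mathcal I_i\}$, and let $w_i=[\mathcal O_\ell(\mathcal I_i)^\times:\mathbb Z^\times]$. The order $\mathcal O$ is called balanced if $w_i=1$ for all $1\le i\le n$. **Statement.** Let $\mathcal O\subset B$ be a special order of level type $(N_1,N_2,M)$, and assume that $\mathrm{ord}_p(N_2)=2$ for every prime $p\mid N_2$ and that $M$ is squarefree. Then $\mathcal O$ is balanced if and only if both (1) and (2) hold. 1. One of the following holds: (a) there is a prime $p\equiv1\bmod 4$ with $p\mid N_1$; or (b) there is a prime $p\equiv3\bmod4$ with $p\mid M$; or (c) $N_2\notin\{1,4\}$; or (d) $8\mid N_1$. 2. One of the following holds: (a) there is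 a prime $p\equiv1\bmod 3$ with $p\mid N_1$; or (b) there is a prime $p\equiv2\bmod3$ with $p\mid M$; or (c) $N_2\notin\{1,9\}$; or (d) $27\mid N_1$. -/

import Mathlib

open scoped TensorProduct Quaternion

noncomputable section

namespace SpecialOrder

/-! ### Quaternion algebras over `ℚ` and their completions -/

/-- `B` is a quaternion algebra `(a, b / ℚ)`: it has a `ℚ`-basis `1, i, j, ij` with
`i² = a`, `j² = b`, `ji = -ij`, for some nonzero rationals `a, b`. -/
def IsQuaternionAlgebra (B : Type*) [Ring B] [Algebra ℚ B] : Prop :=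
  ∃ a b : ℚ, a ≠ 0 ∧ b ≠ 0 ∧ Nonempty (B ≃ₐ[ℚ] ℍ[ℚ, a, b])

/-- `B` is definite: `B ⊗ ℝ` is a division algebra. -/
def IsDefinite (B : Type*) [Ring B] [Algebra ℚ B] : Prop :=
  ∀ x : ℝ ⊗[ℚ] B, x ≠ 0 → IsUnit x

/-- The completion `B_p = ℚ_p ⊗ B`. -/
abbrev Completion (p : ℕ) [Fact p.Prime] (B : Type*) [Ring B] [Algebra ℚ B] : Type _ :=
  ℚ_[p] ⊗[ℚ] B

/-- `B` ramifies at `p`: the completion `B_p` is a division algebra. -/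
def IsRamifiedAt (p : ℕ) [Fact p.Prime] (B : Type*) [Ring B] [Algebra ℚ B] : Prop :=
  ∀ x : Completion p B, x ≠ 0 → IsUnit x

/-- The completion `I_p ⊆ B_p` of a `ℤ`-submodule `I ⊆ B`, that is, the `ℤ_p`-span of `I`. -/
def completionAt (p : ℕ) [Fact p.Prime] {B : Type*} [Ring B] [Algebra ℚ B]
    (I : Submodule ℤ B) : Submodule ℤ_[p] (Completion p B) :=
  Submodule.span ℤ_[p]
    ((Algebra.TensorProduct.includeRight : B →ₐ[ℚ] ℚ_[p] ⊗[ℚ] B) '' (I : Set B))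

/-! ### Local special orders -/

/-- `Λ ⊆ A` is a local Eichler order of level `p ^ r`: for some identification of `A` with
`M₂(ℚ_p)` it is the order of the matrices in `M₂(ℤ_p)` with lower left entry in `p ^ r ℤ_p`. -/
def IsLocalEichlerOrder (p : ℕ) [Fact p.Prime] {A : Type*} [Ring A] [Algebra ℚ_[p] A]
    [Algebra ℤ_[p] A] (r : ℕ) (Λ : Submodule ℤ_[p] A) : Prop :=
  ∃ φ : A ≃ₐ[ℚ_[p]] Matrix (Fin 2) (Fin 2) ℚ_[p],
    ∀ x : A, x ∈ Λ ↔ ∃ m : Matrix (Fin 2) (Fin 2) ℤ_[p],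
      (p : ℤ_[p]) ^ r ∣ m 1 0 ∧ φ x = m.map (fun z : ℤ_[p] => (z : ℚ_[p]))

/-- `R` is a maximal `ℤ_p`-order of the `ℚ_p`-algebra `A`. -/
def IsMaximalOrder (p : ℕ) [Fact p.Prime] {A : Type*} [Ring A] [Algebra ℚ_[p] A]
    [Algebra ℤ_[p] A] [IsScalarTower ℤ_[p] ℚ_[p] A] (R : Subalgebra ℤ_[p] A) : Prop :=
  Maximal (fun S : Subalgebra ℤ_[p] A =>
    Submodule.IsLattice ℚ_[p] (Subalgebra.toSubmodule S)) R

/-- `Λ ≃ O_r(E) = 𝔬_E + 𝔓 ^ (r - 1)`, where `A` is a division quaternion algebra over `ℚ_p`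
with maximal order `R`, `𝔓` is the maximal two-sided ideal of `R`, and `E` is a field extension
of `ℚ_p` that embeds in `A`.  The choice of the embedding `ι` accounts for the isomorphism
(isomorphic orders in `A` are conjugate, and so are any two embeddings of `E`). -/
def IsBasicOrder (p : ℕ) [Fact p.Prime] {A : Type*} [Ring A] [Algebra ℚ_[p] A]
    [Algebra ℤ_[p] A] [IsScalarTower ℤ_[p] ℚ_[p] A]
    (E : IntermediateField ℚ_[p] (AlgebraicClosure ℚ_[p])) (r : ℕ)
    (Λ : Submodule ℤ_[p] A) : Prop :=
  1 ≤ r ∧ ∃ (ι : E →ₐ[ℚ_[p]] A) (R : Subalgebra ℤ_[p] A) (P : Ideal R),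
    IsMaximalOrder p R ∧
    Maximal (fun J : Ideal R => J.IsTwoSided ∧ J ≠ ⊤) P ∧
    Λ = (Subalgebra.toSubmodule (integralClosure ℤ_[p] E)).map
          (ι.restrictScalars ℤ_[p]).toLinearMap ⊔
        ((P ^ (r - 1)).restrictScalars ℤ_[p]).map R.val.toLinearMap

/-- The field `E` is an unramified extension of `ℚ_p`. -/
def IsUnramifiedExt (p : ℕ) [Fact p.Prime]
    (E : IntermediateField ℚ_[p] (AlgebraicClosure ℚ_[p])) : Prop :=
  Algebra.FormallyUnramified ℤ_[p] (integralClosure ℤ_[p] E)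

/-- `Λ` is a local special order of level `p ^ r` in `B_p`: either `B_p` is split and `Λ` is an
Eichler order of level `p ^ r`, or `B_p` is division and `r` is minimal such that `Λ ≃ O_r(E)`
for some quadratic extension `E / ℚ_p`. -/
def IsLocalSpecialOrder (p : ℕ) [Fact p.Prime] {B : Type*} [Ring B] [Algebra ℚ B] (r : ℕ)
    (Λ : Submodule ℤ_[p] (Completion p B)) : Prop :=
  IsLocalEichlerOrder p r Λ ∨
  (IsRamifiedAt p B ∧
    IsLeast {s : ℕ | ∃ E : IntermediateField ℚ_[p] (AlgebraicClosure ℚ_[p]),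
      Module.finrank ℚ_[p] E = 2 ∧ IsBasicOrder p E s Λ} r)

/-! ### Global special orders -/

/-- `O` is a special order of `B` of level type `(N₁, N₂, M)`. -/
structure IsSpecialOfLevelType {B : Type*} [Ring B] [Algebra ℚ B] (O : Subalgebra ℤ B)
    (N₁ N₂ M : ℕ) : Prop where
  /-- `O` is a `ℤ`-order of `B`. -/
  isOrder : Submodule.IsLattice ℚ (Subalgebra.toSubmodule O)
  pos₁ : 0 < N₁
  pos₂ : 0 < N₂
  pos₃ : 0 < M
  coprime₁₂ : N₁.Coprime N₂
  coprime₁₃ : N₁.Coprime M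
  coprime₂₃ : N₂.Coprime M
  /-- The primes dividing `N₁ N₂` are exactly those at which `B` ramifies. -/
  ramified_iff : ∀ (p : ℕ) [Fact p.Prime], p ∣ N₁ * N₂ ↔ IsRamifiedAt p B
  /-- Among these, `N₁` has the primes with odd exponent and `N₂` those with even exponent. -/
  odd₁ : ∀ p : ℕ, p.Prime → p ∣ N₁ → Odd (padicValNat p N₁)
  even₂ : ∀ p : ℕ, p.Prime → p ∣ N₂ → Even (padicValNat p N₂)
  /-- `O` is special of level `N₁ N₂ M`. -/
  special : ∀ (p : ℕ) [Fact p.Prime],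
    IsLocalSpecialOrder p (padicValNat p (N₁ * N₂ * M))
      (completionAt p (Subalgebra.toSubmodule O))
  /-- At ramified primes with odd exponent `r`, `O_p ≃ O_r(E)` with `E` the unramified quadratic
  extension of `ℚ_p`. -/
  unramified_type : ∀ (p : ℕ) [Fact p.Prime], IsRamifiedAt p B →
    Odd (padicValNat p (N₁ * N₂ * M)) →
      ∃ E : IntermediateField ℚ_[p] (AlgebraicClosure ℚ_[p]),
        Module.finrank ℚ_[p] E = 2 ∧ IsUnramifiedExt p E ∧
        IsBasicOrder p E (padicValNat p (N₁ * N₂ * M))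
          (completionAt p (Subalgebra.toSubmodule O))

/-! ### Ideal classes, left orders and balanced orders -/

/-- `I` is an invertible (locally principal) right `O`-ideal: a lattice of `B`, stable under right
multiplication by `O`, with `I_p = x_p O_p` for some `x_p ∈ B_p^×`, for every prime `p`. Thus
`I` corresponds to the class of `(x_p)` in `B̂^× / Ô^×`. -/
structure IsInvertibleRightIdeal {B : Type*} [Ring B] [Algebra ℚ B] (O : Subalgebra ℤ B)
    (I : Submodule ℤ B) : Prop where
  isLattice : Submodule.IsLattice ℚ I
  mul_mem : ∀ x ∈ I, ∀ y ∈ O, x * y ∈ I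
  locally_principal : ∀ (p : ℕ) [Fact p.Prime], ∃ x : (Completion p B)ˣ,
    completionAt p I = (completionAt p (Subalgebra.toSubmodule O)).map
      (LinearMap.mulLeft ℤ_[p] (x : Completion p B))

/-- The left order `{α ∈ B : α I ⊆ I}` of `I`. -/
def leftOrder {B : Type*} [Ring B] (I : Submodule ℤ B) : Subalgebra ℤ B where
  carrier := {α | ∀ x ∈ I, α * x ∈ I}
  mul_mem' := by
    intro a b ha hb x hx
    rw [mul_assoc]
    exact ha _ (hb _ hx)
  add_mem' := by
    intro a b ha hb x hx
    rw [add_mul]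
    exact I.add_mem (ha _ hx) (hb _ hx)
  algebraMap_mem' := by
    intro n x hx
    rw [← Algebra.smul_def]
    exact I.smul_mem n hx

/-- The index `[O_ℓ(I)^× : ℤ^×]`. -/
def unitIndex {B : Type*} [Ring B] (I : Submodule ℤ B) : ℕ :=
  (MonoidHom.range
    (Units.map (algebraMap ℤ (leftOrder I) : ℤ →* leftOrder I))).index

/-- `O` is balanced: `w_i = [O_ℓ(I_i)^× : ℤ^×] = 1` for representatives `I_1, …, I_n` of the
invertible right `O`-ideal classes. The left orders of `I` and `b I`, `b ∈ B^×`, are conjugate,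
so this is the same as asking it of all invertible right `O`-ideals. -/
def IsBalanced {B : Type*} [Ring B] [Algebra ℚ B] (O : Subalgebra ℤ B) : Prop :=
  ∀ I : Submodule ℤ B, IsInvertibleRightIdeal O I → unitIndex I = 1

end SpecialOrder

end

/-! The algebra is definite, so a unit of a left order has reduced norm 1 and a trace `T` with `T² ≤
4`. Up to sign, a unit other than `±1` is then a root of `X² - tX + 1` with `t = 0` or `t = 1`
(`unitIndex_eq_one_iff_forall_root`). Balancedness thus means that neither polynomial has a root in
any left order, and the two conditions of the theorem are the cases `t = 0` and `t = 1` of one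
statement (`IsSpecialOfLevelType.forall_not_root_iff`). There `q = 2 + t` is the only prime dividing
the discriminant `t² - 4`. It is also the reduced norm of `β + 1` for every root `β`.

Each of the four alternatives is an obstruction at a single prime (`IsSpecialOfLevelType.not_root`).
A root in a left order is locally conjugate to a root `β` in `O_p`. If the polynomial splits over
`ℚ_p`, then `β` would be a scalar of a division algebra. An Eichler order of positive level yields a
root modulo `p`. At level `p²` with `p ≠ q`, the root generates the residue field and would make the
order maximal. At level `q^r` with `r ≥ 3` and `E` unramified, the norm of `β + 1` would be
divisible by `q²`.

If all four alternatives fail, a root exists (`IsSpecialOfLevelType.exists_ideal_root`). The field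
`ℚ[X]/(X² - tX + 1)` embeds in `B` as soon as the conic `z² = a x² + b y²` has a point over it. This
is proved by a Legendre descent in the Gaussian or Eisenstein integers, governed by tame symbols
(`QInt.hasPoint_of_isTameTrivial`). Every residue is a square at a prime above 2, so no condition is
needed there. The tame symbols can only be nontrivial above odd primes that split in the field
(`QInt.isTameTrivial_intCast`), and at those `B` is split.

At every prime dividing the level a conjugate of the root lies in `O_p`
(`IsSpecialOfLevelType.exists_local_conj`). Weak approximation replaces these local conjugations by
a global one (`exists_conj_forall_mem`). For the resulting `α` the right ideal `O + αO` is stable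
under `α`, equals `O_p` at the primes of the level, and is locally principal elsewhere because `O_p`
is a matrix ring over `ℤ_p` there. -/

open scoped TensorProduct Quaternion

noncomputable section

namespace SpecialOrder

set_option linter.unusedSectionVars false

/-! ### The tame symbol -/

section Tame

variable {D : Type*} [CommRing D] [IsDomain D] [IsPrincipalIdealRing D] {π : D}

/-- `x` is a square modulo `π`. -/
def IsSquareMod (π x : D) : Prop := ∃ s, π ∣ s ^ 2 - x

/-- The tame symbol of `a` and `b` at `π` is a square in the residue field. -/
def IsTameTrivial (π a b : D) : Prop :=
  ∀ (m n : ℕ) (a' b' : D), a = π ^ m * a' → b = π ^ n * b' → ¬ π ∣ a' → ¬ π ∣ b' →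
    IsSquareMod π ((-1) ^ (m * n) * a' ^ n * b' ^ m)


theorem isSquareMod_sq (π x : D) : IsSquareMod π (x ^ 2) := ⟨x, by simp⟩

theorem isSquareMod_pow_even (π x : D) {n : ℕ} (hn : Even n) : IsSquareMod π (x ^ n) := by
  obtain ⟨k, rfl⟩ := hn
  exact ⟨x ^ k, by ring_nf; simp⟩

theorem IsSquareMod.mul {x y : D} (hx : IsSquareMod π x) (hy : IsSquareMod π y) :
    IsSquareMod π (x * y) := by
  obtain ⟨s, u, hu⟩ := hx
  obtain ⟨t, v, hv⟩ := hy
  exact ⟨s * t, u * t ^ 2 + x * v, by linear_combination t ^ 2 * hu + x * hv⟩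

theorem IsSquareMod.pow {x : D} (hx : IsSquareMod π x) (n : ℕ) : IsSquareMod π (x ^ n) := by
  induction n with
  | zero => exact ⟨1, by simp⟩
  | succ n ih => rw [pow_succ]; exact ih.mul hx

theorem IsSquareMod.congr {x y : D} (hx : IsSquareMod π x) (h : π ∣ x - y) :
    IsSquareMod π y := by
  obtain ⟨s, hs⟩ := hx
  exact ⟨s, by simpa using dvd_add hs h⟩

theorem exists_mul_sub_one_dvd (hπ : Prime π) {x : D} (hx : ¬ π ∣ x) : ∃ y, π ∣ x * y - 1 := by
  obtain ⟨u, v, h⟩ := (hπ.irreducible.coprime_iff_not_dvd).2 hx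
  exact ⟨v, -u, by linear_combination h⟩

theorem IsSquareMod.of_mul_left (hπ : Prime π) {x y : D} (h : IsSquareMod π (x * y))
    (hx : IsSquareMod π x) (hx' : ¬ π ∣ x) : IsSquareMod π y := by
  obtain ⟨s, u, hu⟩ := h
  obtain ⟨t, v, hv⟩ := hx
  have ht : ¬ π ∣ t := by
    rintro ⟨c, rfl⟩
    exact hx' ⟨π * c ^ 2 - v, by linear_combination -hv⟩
  obtain ⟨r, w, hw⟩ := exists_mul_sub_one_dvd hπ ht
  refine ⟨s * r, r ^ 2 * u - y * r ^ 2 * v + y * w * (t * r + 1), ?_⟩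
  linear_combination r ^ 2 * hu - y * r ^ 2 * hv + y * (t * r + 1) * hw

theorem exists_eq_pow_mul (hπ : Prime π) {a : D} (ha : a ≠ 0) :
    ∃ (m : ℕ) (a' : D), a = π ^ m * a' ∧ ¬ π ∣ a' := by
  obtain ⟨c, h1, h2⟩ :=
    (FiniteMultiplicity.of_prime_left hπ ha).exists_eq_pow_mul_and_not_dvd
  exact ⟨_, c, h1, h2⟩

theorem pow_mul_inj (hπ : Prime π) {m n : ℕ} {a b : D} (h : π ^ m * a = π ^ n * b)
    (ha : ¬ π ∣ a) (hb : ¬ π ∣ b) : m = n ∧ a = b := by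
  rcases lt_trichotomy m n with hlt | rfl | hlt
  · obtain ⟨k, rfl⟩ := Nat.exists_eq_add_of_lt hlt
    refine absurd ⟨π ^ k * b, mul_left_cancel₀ (pow_ne_zero m hπ.ne_zero) ?_⟩ ha
    rw [h]; ring
  · exact ⟨rfl, mul_left_cancel₀ (pow_ne_zero m hπ.ne_zero) h⟩
  · obtain ⟨k, rfl⟩ := Nat.exists_eq_add_of_lt hlt
    refine absurd ⟨π ^ k * a, mul_left_cancel₀ (pow_ne_zero n hπ.ne_zero) ?_⟩ hb
    rw [← h]; ring

theorem isTameTrivial_iff (hπ : Prime π) {a b : D} {m n : ℕ} {a' b' : D} (ha : a = π ^ m * a')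
    (hb : b = π ^ n * b') (ha' : ¬ π ∣ a') (hb' : ¬ π ∣ b') :
    IsTameTrivial π a b ↔ IsSquareMod π ((-1) ^ (m * n) * a' ^ n * b' ^ m) := by
  refine ⟨fun h => h m n a' b' ha hb ha' hb', fun h k l c d hc hd hc' hd' => ?_⟩
  obtain ⟨rfl, rfl⟩ := pow_mul_inj hπ (ha.symm.trans hc) ha' hc'
  obtain ⟨rfl, rfl⟩ := pow_mul_inj hπ (hb.symm.trans hd) hb' hd'
  exact h

theorem IsTameTrivial.symm {a b : D} (h : IsTameTrivial π a b) : IsTameTrivial π b a := by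
  intro m n a' b' ha hb ha' hb'
  have := h n m b' a' hb ha hb' ha'
  rwa [show (-1 : D) ^ (m * n) * a' ^ n * b' ^ m = (-1) ^ (n * m) * b' ^ m * a' ^ n by ring]

theorem not_dvd_symbol (hπ : Prime π) {a b : D} (ha : ¬ π ∣ a) (hb : ¬ π ∣ b) (k m n : ℕ) :
    ¬ π ∣ (-1) ^ k * a ^ n * b ^ m := by
  intro h
  rcases hπ.dvd_or_dvd h with h | h
  · rcases hπ.dvd_or_dvd h with h | h
    · have := hπ.dvd_of_dvd_pow h
      exact hπ.not_isUnit (isUnit_of_dvd_unit this (by simp))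
    · exact ha (hπ.dvd_of_dvd_pow h)
  · exact hb (hπ.dvd_of_dvd_pow h)

theorem not_dvd_mul (hπ : Prime π) {a b : D} (ha : ¬ π ∣ a) (hb : ¬ π ∣ b) : ¬ π ∣ a * b :=
  fun h => (hπ.dvd_or_dvd h).elim ha hb

theorem not_dvd_pow (hπ : Prime π) {a : D} (ha : ¬ π ∣ a) (n : ℕ) : ¬ π ∣ a ^ n :=
  fun h => ha (hπ.dvd_of_dvd_pow h)

/-- If the symbol `(a, b)` is trivial, then `(a, bc)` is trivial iff `(a, c)` is. -/
theorem IsTameTrivial.mul_right_iff (hπ : Prime π) {a b c : D} (ha : a ≠ 0) (hb : b ≠ 0)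
    (hc : c ≠ 0) (h : IsTameTrivial π a b) :
    IsTameTrivial π a (b * c) ↔ IsTameTrivial π a c := by
  obtain ⟨m, a', ea, ha'⟩ := exists_eq_pow_mul hπ ha
  obtain ⟨n, b', eb, hb'⟩ := exists_eq_pow_mul hπ hb
  obtain ⟨k, c', ec, hc'⟩ := exists_eq_pow_mul hπ hc
  have ebc : b * c = π ^ (n + k) * (b' * c') := by rw [eb, ec]; ring
  rw [isTameTrivial_iff hπ ea eb ha' hb'] at h
  rw [isTameTrivial_iff hπ ea ebc ha' (not_dvd_mul hπ hb' hc'),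
    isTameTrivial_iff hπ ea ec ha' hc']
  have e : (-1 : D) ^ (m * (n + k)) * a' ^ (n + k) * (b' * c') ^ m
    = ((-1) ^ (m * n) * a' ^ n * b' ^ m) * ((-1) ^ (m * k) * a' ^ k * c' ^ m) := by ring
  rw [e]
  exact ⟨fun h' => h'.of_mul_left hπ h (not_dvd_symbol hπ ha' hb' _ _ _), fun h' => h.mul h'⟩

theorem isTameTrivial_sq_right (hπ : Prime π) {a c : D} (ha : a ≠ 0) (hc : c ≠ 0) :
    IsTameTrivial π a (c ^ 2) := by
  obtain ⟨m, a', ea, ha'⟩ := exists_eq_pow_mul hπ ha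
  obtain ⟨n, c', ec, hc'⟩ := exists_eq_pow_mul hπ hc
  rw [isTameTrivial_iff hπ ea (b := c ^ 2) (n := 2 * n) (b' := c' ^ 2) (by rw [ec]; ring) ha'
    (not_dvd_pow hπ hc' 2)]
  exact ⟨a' ^ n * c' ^ m, by rw [show m * (2 * n) = 2 * (m * n) by ring, pow_mul]; simp; ring_nf; simp⟩

/-- The sign `(-1)^(m²)` of the symbol and the sign `(-1)^m` from `(-a')^m` combine to
`(-1)^(m(m+1)) = 1`. -/
theorem isTameTrivial_neg_self (hπ : Prime π) {a : D} (ha : a ≠ 0) : IsTameTrivial π a (-a) := by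
  obtain ⟨m, a', ea, ha'⟩ := exists_eq_pow_mul hπ ha
  rw [isTameTrivial_iff hπ ea (b := -a) (n := m) (b' := -a') (by rw [ea]; ring) ha'
    (by rwa [dvd_neg])]
  refine ⟨a' ^ m, ?_⟩
  have : (-1 : D) ^ (m * m) * a' ^ m * (-a') ^ m = a' ^ m * a' ^ m * ((-1) ^ (m * (m + 1))) := by
    rw [neg_pow a']; ring
  rw [this, (Nat.even_mul_succ_self m).neg_one_pow]; ring_nf; simp

/-- The Steinberg relation for the tame symbol. -/
theorem isTameTrivial_sq_sub (hπ : Prime π) {a t : D} (ha : a ≠ 0) (hc : t ^ 2 - a ≠ 0) :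
    IsTameTrivial π a (t ^ 2 - a) := by
  by_cases ht : t = 0
  · subst ht; simpa using isTameTrivial_neg_self hπ ha
  obtain ⟨m, a', ea, ha'⟩ := exists_eq_pow_mul hπ ha
  obtain ⟨k, t', et, ht'⟩ := exists_eq_pow_mul hπ ht
  -- Compare the valuations of `a` and `t²`. If `a` dominates, `t² - a` behaves like `-a`. If they
  -- agree, all exponents but one are even, and `a'^n` is a square because either `a' ≡ t'²` or `n =
  -- 2k`. If `t²` dominates, the unit part of `t² - a` is a square modulo `π`.
  rcases lt_trichotomy m (2 * k) with hlt | rfl | hlt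
  · obtain ⟨j, hj⟩ := Nat.exists_eq_add_of_lt hlt
    have ec : t ^ 2 - a = π ^ m * (-a' + π * (π ^ j * t' ^ 2)) := by
      rw [et, mul_pow, ← pow_mul, mul_comm k 2, hj, ea]; ring
    have hd : ¬ π ∣ (-a' + π * (π ^ j * t' ^ 2)) := by
      rwa [dvd_add_left (Dvd.intro (π ^ j * t' ^ 2) rfl : π ∣ π * (π ^ j * t' ^ 2)), dvd_neg]
    rw [isTameTrivial_iff hπ ea ec ha' hd]
    have h0 := (isTameTrivial_iff hπ ea (b := -a) (n := m) (b' := -a') (by rw [ea]; ring) ha'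
      (by rwa [dvd_neg])).1 (isTameTrivial_neg_self hπ ha)
    refine h0.congr ?_
    rw [← mul_sub]
    refine Dvd.dvd.mul_left ?_ _
    refine dvd_trans ?_ (sub_dvd_pow_sub_pow _ _ m)
    exact ⟨-(π ^ j * t' ^ 2), by ring⟩
  · obtain ⟨n, c', ec, hc'⟩ := exists_eq_pow_mul hπ hc
    rw [isTameTrivial_iff hπ ea ec ha' hc']
    have e0 : t ^ 2 - a = π ^ (2 * k) * (t' ^ 2 - a') := by rw [et, ea]; ring
    have h1 : IsSquareMod π ((-1 : D) ^ (2 * k * n) * c' ^ (2 * k)) :=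
      (isSquareMod_pow_even _ _ ⟨k * n, by ring⟩).mul (isSquareMod_pow_even _ _ ⟨k, by ring⟩)
    have h2 : IsSquareMod π (a' ^ n) := by
      by_cases hd : π ∣ t' ^ 2 - a'
      · exact IsSquareMod.pow ⟨t', hd⟩ n
      · obtain ⟨rfl, -⟩ := pow_mul_inj hπ (ec.symm.trans e0) hc' hd
        exact isSquareMod_pow_even _ _ ⟨k, by ring⟩
    have := h1.mul h2
    rwa [mul_right_comm] at this
  · obtain ⟨j, hj⟩ := Nat.exists_eq_add_of_lt hlt
    have ec : t ^ 2 - a = π ^ (2 * k) * (t' ^ 2 - π * (π ^ j * a')) := by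
      rw [ea, hj, et]; ring
    have hd : ¬ π ∣ (t' ^ 2 - π * (π ^ j * a')) := by
      intro h
      refine not_dvd_pow hπ ht' 2 ?_
      simpa using dvd_add h (Dvd.intro (π ^ j * a') rfl : π ∣ π * (π ^ j * a'))
    rw [isTameTrivial_iff hπ ea ec ha' hd]
    have h1 : IsSquareMod π ((-1 : D) ^ (m * (2 * k)) * a' ^ (2 * k)) :=
      (isSquareMod_pow_even _ _ ⟨m * k, by ring⟩).mul (isSquareMod_pow_even _ _ ⟨k, by ring⟩)
    refine h1.mul (IsSquareMod.pow ⟨t', ?_⟩ m)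
    exact ⟨π ^ j * a', by ring⟩

/-- If the conic `z² = a x² + b y²` has a point, then the tame symbol of `a, b` is trivial. -/
theorem isTameTrivial_of_conic (hπ : Prime π) {a b x y z : D} (ha : a ≠ 0) (hb : b ≠ 0)
    (h : z ^ 2 = a * x ^ 2 + b * y ^ 2) (h0 : ¬ (x = 0 ∧ y = 0 ∧ z = 0)) :
    IsTameTrivial π a b := by
  by_cases hx : x = 0
  · subst hx
    have hy : y ≠ 0 := by
      rintro rfl; simp at h; exact h0 ⟨rfl, rfl, h⟩
    have hz : z ≠ 0 := by
      rintro rfl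
      have : b * y ^ 2 ≠ 0 := mul_ne_zero hb (pow_ne_zero 2 hy)
      apply this; simpa using h.symm
    rw [← IsTameTrivial.mul_right_iff hπ ha (pow_ne_zero 2 hy) hb
      (isTameTrivial_sq_right hπ ha hy), show y ^ 2 * b = z ^ 2 by rw [h]; ring]
    exact isTameTrivial_sq_right hπ ha hz
  by_cases hy : y = 0
  · subst hy
    have hz : z ≠ 0 := by
      rintro rfl
      have : a * x ^ 2 ≠ 0 := mul_ne_zero ha (pow_ne_zero 2 hx)
      apply this; simpa using h.symm
    apply IsTameTrivial.symm
    rw [← IsTameTrivial.mul_right_iff hπ hb (pow_ne_zero 2 hx) ha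
      (isTameTrivial_sq_right hπ hb hx), show x ^ 2 * a = z ^ 2 by rw [h]; ring]
    exact isTameTrivial_sq_right hπ hb hz
  have hax : x ^ 2 * a ≠ 0 := mul_ne_zero (pow_ne_zero 2 hx) ha
  have hby : y ^ 2 * b ≠ 0 := mul_ne_zero (pow_ne_zero 2 hy) hb
  -- The conic equation becomes a Steinberg relation for `x² a` and `y² b`; the square factors are
  -- then stripped from both slots.
  have e : z ^ 2 - x ^ 2 * a = y ^ 2 * b := by rw [h]; ring
  have h1 := isTameTrivial_sq_sub hπ (t := z) hax (by rwa [e])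
  rw [e, IsTameTrivial.mul_right_iff hπ hax (pow_ne_zero 2 hy) hb
    (isTameTrivial_sq_right hπ hax hy)] at h1
  have h2 := h1.symm
  rw [IsTameTrivial.mul_right_iff hπ hb (pow_ne_zero 2 hx) ha
    (isTameTrivial_sq_right hπ hb hx)] at h2
  exact h2.symm

end Tame

/-! ### The ring `ℤ[X] / (X² - tX + 1)` for `t = 0, 1` -/

/-- The ring `ℤ[X] / (X² - tX + 1)`: the Gaussian integers for `t = 0`, the Eisenstein integers
for `t = 1`. -/
abbrev QInt (t : ℤ) : Type := QuadraticAlgebra ℤ (-1) t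

namespace QInt

variable {t : ℤ}

theorem norm_eq (z : QInt t) : z.norm = z.re ^ 2 + t * z.re * z.im + z.im ^ 2 := by
  rw [QuadraticAlgebra.norm_def]; ring

theorem exists_quot_zero {n : ℤ} (hn : 0 < n) (u v : ℤ) :
    ∃ q r : ℤ, 2 * ((u - n * q) ^ 2 + (v - n * r) ^ 2) ≤ n ^ 2 := by
  have key : ∀ u : ℤ, ∃ q : ℤ, 4 * (u - n * q) ^ 2 ≤ n ^ 2 := by
    intro u
    have h0 := Int.emod_nonneg u hn.ne'
    have h1 := Int.emod_lt_of_pos u hn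
    have h2 := Int.emod_add_mul_ediv u n
    rcases le_total (2 * (u % n)) n with h | h
    · exact ⟨u / n, by rw [show u - n * (u / n) = u % n by linarith]; nlinarith⟩
    · exact ⟨u / n + 1, by
        rw [show u - n * (u / n + 1) = u % n - n by linarith]; nlinarith⟩
  obtain ⟨q, hq⟩ := key u
  obtain ⟨r, hr⟩ := key v
  exact ⟨q, r, by linarith⟩

/-- For the form `x² + xy + y²` the points `0`, `(n, 0)`, `(0, n)` form an equilateral triangle of
side `n`. Its circumradius is `n/√3`, so every point of it is within that distance of a vertex. -/
theorem exists_quot_one {n : ℤ} (hn : 0 < n) (u v : ℤ) :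
    ∃ q r : ℤ, 3 * ((u - n * q) ^ 2 + (u - n * q) * (v - n * r) + (v - n * r) ^ 2) ≤ n ^ 2 := by
  have hx0 := Int.emod_nonneg u hn.ne'
  have hx1 := Int.emod_lt_of_pos u hn
  have hx2 := Int.emod_add_mul_ediv u n
  have hy0 := Int.emod_nonneg v hn.ne'
  have hy1 := Int.emod_lt_of_pos v hn
  have hy2 := Int.emod_add_mul_ediv v n
  have eu : ∀ i, u - n * (u / n + i) = u % n - n * i := fun i => by linarith
  have ev : ∀ i, v - n * (v / n + i) = v % n - n * i := fun i => by linarith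
  -- The average of the three squared distances with barycentric weights `n - x - y`, `x`, `y` is
  -- `nx + ny - (x² + xy + y²)`, which is at most `n²/3`. Hence not all three can exceed `n²/3`.
  have main : ∀ x y : ℤ, 0 ≤ x → 0 ≤ y → x + y ≤ n →
      3 * (x ^ 2 + x * y + y ^ 2) ≤ n ^ 2 ∨
      3 * ((x - n) ^ 2 + (x - n) * y + y ^ 2) ≤ n ^ 2 ∨
      3 * (x ^ 2 + x * (y - n) + (y - n) ^ 2) ≤ n ^ 2 := by
    intro x y hx hy hxy
    by_contra! h
    obtain ⟨h1, h2, h3⟩ := h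
    have e1 := mul_nonneg (sub_nonneg.2 hxy) (sub_nonneg.2 h1.le)
    have e2 := mul_nonneg hx (sub_nonneg.2 h2.le)
    have e3 := mul_nonneg hy (sub_nonneg.2 h3.le)
    have e4 : 3 * n * (n * x + n * y - (x ^ 2 + x * y + y ^ 2)) ≤ n * n ^ 2 := by
      have : 0 ≤ n * (3 * (x + y) - 2 * n) ^ 2 + 3 * n * (x - y) ^ 2 := by positivity
      linarith
    have e5 : 0 < (n - (x + y)) * (3 * (x ^ 2 + x * y + y ^ 2) - n ^ 2)
        + x * (3 * ((x - n) ^ 2 + (x - n) * y + y ^ 2) - n ^ 2)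
        + y * (3 * (x ^ 2 + x * (y - n) + (y - n) ^ 2) - n ^ 2) := by
      rcases hx.lt_or_eq with hx' | hx'
      · have := mul_pos hx' (sub_pos.2 h2); linarith
      rcases hy.lt_or_eq with hy' | hy'
      · have := mul_pos hy' (sub_pos.2 h3); linarith
      · subst hx'; subst hy'; nlinarith
    nlinarith
  rcases le_total (u % n + v % n) n with h | h
  · rcases main _ _ hx0 hy0 h with h | h | h
    · exact ⟨u / n + 0, v / n + 0, by rw [eu, ev]; simpa using h⟩
    · exact ⟨u / n + 1, v / n + 0, by rw [eu, ev]; simpa using h⟩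
    · exact ⟨u / n + 0, v / n + 1, by rw [eu, ev]; simpa using h⟩
  -- The other half of the parallelogram is the reflection of the first triangle through the centre.
  · rcases main (n - u % n) (n - v % n) (by linarith) (by linarith) (by linarith)
      with h | h | h
    · exact ⟨u / n + 1, v / n + 1, by rw [eu, ev]; linarith⟩
    · exact ⟨u / n + 0, v / n + 1, by rw [eu, ev]; linarith⟩
    · exact ⟨u / n + 1, v / n + 0, by rw [eu, ev]; linarith⟩

variable [ht : Fact (t = 0 ∨ t = 1)]

theorem norm_nonneg (z : QInt t) : 0 ≤ z.norm := by
  rw [norm_eq]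
  rcases ht.out with rfl | rfl <;> nlinarith [sq_nonneg (z.re + z.im), sq_nonneg z.re, sq_nonneg z.im]

theorem norm_eq_zero {z : QInt t} : z.norm = 0 ↔ z = 0 := by
  refine ⟨fun h => ?_, fun h => by rw [h, QuadraticAlgebra.norm_zero]⟩
  rw [norm_eq] at h
  have h1 : z.re ^ 2 + z.im ^ 2 ≤ 0 := by
    rcases ht.out with rfl | rfl <;> nlinarith [sq_nonneg (z.re + z.im)]
  have h2 : z.re = 0 := by
    have := pow_eq_zero_iff (n := 2) (a := z.re) two_ne_zero
    rw [← this]; nlinarith [sq_nonneg z.re, sq_nonneg z.im]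
  have h3 : z.im = 0 := by
    have := pow_eq_zero_iff (n := 2) (a := z.im) two_ne_zero
    rw [← this]; nlinarith [sq_nonneg z.re, sq_nonneg z.im]
  ext <;> simpa

theorem norm_pos {z : QInt t} (h : z ≠ 0) : 0 < z.norm :=
  lt_of_le_of_ne (norm_nonneg z) fun h' => h (norm_eq_zero.1 h'.symm)

/-- Multiplying by `star b` turns the divisor into the rational integer `b.norm`, to which the
lattice estimates apply. The factor `2 + t` records the bounds `1/2` and `1/3`; the descent needs
these and not just a remainder of smaller norm. -/
theorem exists_norm_sub_le (s : QInt t) {b : QInt t} (hb : b ≠ 0) :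
    ∃ q, (2 + t) * (s - b * q).norm ≤ b.norm := by
  have hn := norm_pos hb
  have key : ∀ u : QInt t, ∃ q : QInt t,
      (2 + t) * (u - algebraMap ℤ _ b.norm * q).norm ≤ b.norm ^ 2 := by
    intro u
    generalize b.norm = n at hn
    rcases ht.out with rfl | rfl
    · obtain ⟨q, r, h⟩ := exists_quot_zero hn u.re u.im
      exact ⟨⟨q, r⟩, by rw [norm_eq]; simpa [QuadraticAlgebra.algebraMap_eq] using h⟩
    · obtain ⟨q, r, h⟩ := exists_quot_one hn u.re u.im
      exact ⟨⟨q, r⟩, by rw [norm_eq]; simpa [QuadraticAlgebra.algebraMap_eq] using h⟩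
  obtain ⟨q, hq⟩ := key (s * star b)
  refine ⟨q, ?_⟩
  rw [QuadraticAlgebra.algebraMap_norm_eq_mul_star,
    show s * star b - b * star b * q = (s - b * q) * star b by ring, map_mul,
    QuadraticAlgebra.norm_star, sq, ← mul_assoc] at hq
  exact le_of_mul_le_mul_right hq hn

theorem exists_quot (s b : QInt t) : ∃ q : QInt t, (b = 0 → q = 0) ∧
    (b ≠ 0 → (s - b * q).norm.natAbs < b.norm.natAbs) := by
  by_cases hb : b = 0
  · exact ⟨0, fun _ => rfl, fun h => absurd hb h⟩
  obtain ⟨q, hq⟩ := exists_norm_sub_le s hb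
  refine ⟨q, fun h => absurd h hb, fun _ => ?_⟩
  have h1 := norm_pos hb
  have h2 := norm_nonneg (s - b * q)
  have : (s - b * q).norm < b.norm := by
    rcases ht.out with rfl | rfl <;> linarith
  omega

/-- Division with remainder in `ℤ[X] / (X² - tX + 1)`. -/
@[reducible] def euclideanDomain : EuclideanDomain (QInt t) where
  quotient s b := (exists_quot s b).choose
  quotient_zero s := (exists_quot s 0).choose_spec.1 rfl
  remainder s b := s - b * (exists_quot s b).choose
  quotient_mul_add_remainder_eq s b := by ring
  r x y := x.norm.natAbs < y.norm.natAbs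
  r_wellFounded := (measure fun x : QInt t => x.norm.natAbs).wf
  remainder_lt s b hb := (exists_quot s b).choose_spec.2 hb
  mul_left_not_lt a b hb := by
    rw [map_mul, Int.natAbs_mul, not_lt]
    exact Nat.le_mul_of_pos_right _ (Int.natAbs_pos.2 (norm_pos hb).ne')

instance : IsDomain (QInt t) := by
  let := euclideanDomain (t := t)
  infer_instance

instance : IsPrincipalIdealRing (QInt t) := by
  let := euclideanDomain (t := t)
  exact EuclideanDomain.to_principal_ideal_domain

end QInt

namespace QInt

/-! ### A local-global principle for conics over the Gaussian and Eisenstein integers -/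

variable {t : ℤ}

/-- The conic `z² = a x² + b y²` has a nontrivial point. -/
def HasPoint (a b : QInt t) : Prop :=
  ∃ x y z : QInt t, ¬ (x = 0 ∧ y = 0 ∧ z = 0) ∧ z ^ 2 = a * x ^ 2 + b * y ^ 2

theorem HasPoint.symm {a b : QInt t} (h : HasPoint a b) : HasPoint b a := by
  obtain ⟨x, y, z, h0, h⟩ := h
  exact ⟨y, x, z, fun ⟨h1, h2, h3⟩ => h0 ⟨h2, h1, h3⟩, by rw [h]; ring⟩

@[simp] theorem re_two : (2 : QInt t).re = 2 := rfl

@[simp] theorem im_two : (2 : QInt t).im = 0 := rfl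

theorem two_dvd_ext {z : QInt t} (h1 : (2 : ℤ) ∣ z.re) (h2 : (2 : ℤ) ∣ z.im) : (2 : QInt t) ∣ z := by
  obtain ⟨c, hc⟩ := h1
  obtain ⟨d, hd⟩ := h2
  exact ⟨⟨c, d⟩, by ext <;> simp [hc, hd]⟩

/-- The residue field is `𝔽₂` or `𝔽₄`, where squaring is bijective. For `t = 0` one has `i ≡ 1`, so
the root is `a.re + a.im`; for `t = 1` the root is `a²` reduced modulo 2. -/
theorem isSquareMod_of_dvd_two [ht : Fact (t = 0 ∨ t = 1)] {π : QInt t} (hπ : Prime π)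
    (h2 : π ∣ 2) (a : QInt t) : IsSquareMod π a := by
  rcases ht.out with rfl | rfl
  · have h1 : π ∣ ⟨1, 1⟩ := by
      refine hπ.dvd_of_dvd_pow (n := 2) (h2.trans ⟨⟨0, 1⟩, ?_⟩)
      ext <;> simp [sq]
    refine ⟨⟨a.re + a.im, 0⟩, ?_⟩
    have e : (⟨a.re + a.im, 0⟩ : QInt 0) ^ 2 - a
        = ⟨(a.re + a.im) ^ 2 - (a.re + a.im), 0⟩ + ⟨1, 1⟩ * ⟨0, -a.im⟩ := by
      ext <;> simp [sq]; ring
    rw [e]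
    refine dvd_add (h2.trans (two_dvd_ext ?_ (by simp))) (h1.mul_right _)
    have := (Int.even_mul_pred_self (a.re + a.im)).two_dvd
    simpa [sq, mul_sub] using this
  · refine ⟨⟨a.re - a.im, a.im⟩, h2.trans (two_dvd_ext ?_ ?_)⟩
    · obtain ⟨k, hk⟩ := (Int.even_mul_pred_self a.re).two_dvd
      obtain ⟨l, hl⟩ := (Int.even_mul_pred_self a.im).two_dvd
      refine ⟨k - a.re * a.im, ?_⟩
      simp [sq]; linear_combination hk
    · obtain ⟨l, hl⟩ := (Int.even_mul_pred_self a.im).two_dvd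
      refine ⟨l - a.im ^ 2 + a.re * a.im, ?_⟩
      simp [sq]; linear_combination hl

/-- A finite search for the end of the descent, in coordinates. Taking `x` and `y` among `0`, `1`
and the generator suffices, and since one of their coordinates vanishes the cross terms can be left
out. -/
theorem hasPoint_of_small_aux_zero : ∀ a ∈ [-1, 0, 1], ∀ b ∈ [-1, 0, 1], ∀ c ∈ [-1, 0, 1],
    ∀ d ∈ [-1, 0, 1], (a, b) ≠ (0, 0) → (c, d) ≠ (0, 0) →
    ∃ x ∈ [((0 : ℤ), (0 : ℤ)), (1, 0), (0, 1)], ∃ y ∈ [((0 : ℤ), (0 : ℤ)), (1, 0), (0, 1)],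
    ∃ z ∈ [-1, 0, 1], ∃ w ∈ [-1, 0, 1], ¬ (x = (0, 0) ∧ y = (0, 0)) ∧
      z * z - w * w = a * (x.1 * x.1 - x.2 * x.2) + c * (y.1 * y.1 - y.2 * y.2) ∧
      2 * z * w = b * (x.1 * x.1 - x.2 * x.2) + d * (y.1 * y.1 - y.2 * y.2) := by
  decide +kernel

theorem hasPoint_of_small_aux_one : ∀ a ∈ [-1, 0, 1], ∀ b ∈ [-1, 0, 1], ∀ c ∈ [-1, 0, 1],
    ∀ d ∈ [-1, 0, 1], a * a + a * b + b * b = 1 → c * c + c * d + d * d = 1 →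
    ∃ x ∈ [((0 : ℤ), (0 : ℤ)), (1, 0), (0, 1)], ∃ y ∈ [((0 : ℤ), (0 : ℤ)), (1, 0), (0, 1)],
    ∃ z ∈ [-1, 0, 1], ∃ w ∈ [-1, 0, 1], ¬ (x = (0, 0) ∧ y = (0, 0)) ∧
      z * z - w * w = a * (x.1 * x.1 - x.2 * x.2) - b * (x.2 * x.2)
        + (c * (y.1 * y.1 - y.2 * y.2) - d * (y.2 * y.2)) ∧
      2 * z * w + w * w = b * (x.1 * x.1 - x.2 * x.2) + a * (x.2 * x.2) + b * (x.2 * x.2)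
        + (d * (y.1 * y.1 - y.2 * y.2) + c * (y.2 * y.2) + d * (y.2 * y.2)) := by
  decide +kernel

theorem mem_of_sq_le {x : ℤ} (h : x ^ 2 ≤ 2) : x ∈ [-1, 0, 1] := by
  have h1 : -1 ≤ x := by nlinarith
  have h2 : x ≤ 1 := by nlinarith
  interval_cases x <;> simp

theorem re_mem_of_norm_le [ht : Fact (t = 0 ∨ t = 1)] {a : QInt t} (h : a.norm ≤ 2) :
    a.re ∈ [-1, 0, 1] ∧ a.im ∈ [-1, 0, 1] := by
  rw [norm_eq] at h
  rcases ht.out with rfl | rfl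
  · exact ⟨mem_of_sq_le (by nlinarith [sq_nonneg a.im]),
      mem_of_sq_le (by nlinarith [sq_nonneg a.re])⟩
  · have h1 : 3 * a.re ^ 2 ≤ 8 := by nlinarith [sq_nonneg (a.re + 2 * a.im)]
    have h2 : 3 * a.im ^ 2 ≤ 8 := by nlinarith [sq_nonneg (2 * a.re + a.im)]
    exact ⟨mem_of_sq_le (by omega), mem_of_sq_le (by omega)⟩

theorem hasPoint_of_small [ht : Fact (t = 0 ∨ t = 1)] {a b : QInt t} (ha : a ≠ 0) (hb : b ≠ 0)
    (ha' : a.norm ≤ 2) (hb' : b.norm ≤ 2) : HasPoint a b := by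
  obtain ⟨h1, h2⟩ := re_mem_of_norm_le ha'
  obtain ⟨h3, h4⟩ := re_mem_of_norm_le hb'
  rcases ht.out with rfl | rfl
  · obtain ⟨⟨x, x'⟩, hx, ⟨y, y'⟩, hy, z, hz, w, hw, h0, e1, e2⟩ :=
      hasPoint_of_small_aux_zero _ h1 _ h2 _ h3 _ h4
        (fun h => ha (by ext; exacts [congrArg Prod.fst h, congrArg Prod.snd h]))
        (fun h => hb (by ext; exacts [congrArg Prod.fst h, congrArg Prod.snd h]))
    have hx0 : x * x' = 0 := by fin_cases hx <;> rfl
    have hy0 : y * y' = 0 := by fin_cases hy <;> rfl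
    refine ⟨⟨x, x'⟩, ⟨y, y'⟩, ⟨z, w⟩, fun ⟨h1, h2, _⟩ => h0 ?_, ?_⟩
    · simp only [QuadraticAlgebra.ext_iff] at h1 h2
      exact ⟨Prod.ext h1.1 h1.2, Prod.ext h2.1 h2.2⟩
    · ext
      · simp [sq]; linear_combination e1 + 2 * a.im * hx0 + 2 * b.im * hy0
      · simp [sq]; linear_combination e2 - 2 * a.re * hx0 - 2 * b.re * hy0
  -- No Eisenstein integer has norm 2, so only units remain.
  · have unit_norm : ∀ c : QInt 1, c ≠ 0 → c.norm ≤ 2 → c.re * c.re + c.re * c.im + c.im * c.im = 1 := by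
      intro c hc hc'
      obtain ⟨h5, h6⟩ := re_mem_of_norm_le hc'
      have h7 := norm_pos hc
      rw [norm_eq] at hc' h7
      generalize c.re = u at *
      generalize c.im = v at *
      fin_cases h5 <;> fin_cases h6 <;> simp_all
    obtain ⟨⟨x, x'⟩, hx, ⟨y, y'⟩, hy, z, hz, w, hw, h0, e1, e2⟩ :=
      hasPoint_of_small_aux_one _ h1 _ h2 _ h3 _ h4 (unit_norm a ha ha') (unit_norm b hb hb')
    have hx0 : x * x' = 0 := by fin_cases hx <;> rfl
    have hy0 : y * y' = 0 := by fin_cases hy <;> rfl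
    refine ⟨⟨x, x'⟩, ⟨y, y'⟩, ⟨z, w⟩, fun ⟨h1, h2, _⟩ => h0 ?_, ?_⟩
    · simp only [QuadraticAlgebra.ext_iff] at h1 h2
      exact ⟨Prod.ext h1.1 h1.2, Prod.ext h2.1 h2.2⟩
    · ext
      · simp [sq]; linear_combination e1 + 2 * a.im * hx0 + 2 * b.im * hy0
      · simp [sq]
        linear_combination e2 - 2 * (a.re + a.im) * hx0 - 2 * (b.re + b.im) * hy0

variable [ht : Fact (t = 0 ∨ t = 1)]

/-- The Chinese remainder theorem, one prime factor at a time; the Bézout coefficients `k`, `l` glue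
the two square roots. -/
theorem isSquareMod_of_squarefree (a : QInt t) {b : QInt t} (hb : Squarefree b)
    (h : ∀ π, Prime π → π ∣ b → IsSquareMod π a) : IsSquareMod b a := by
  induction b using UniqueFactorizationMonoid.induction_on_prime with
  | h₁ => exact absurd hb not_squarefree_zero
  | h₂ b hu => exact ⟨0, hu.dvd⟩
  | h₃ b π hb0 hπ ih =>
    obtain ⟨s, u, hs⟩ := h π hπ (dvd_mul_right _ _)
    obtain ⟨r, v, hr⟩ := ih (hb.squarefree_of_dvd (dvd_mul_left _ _))
      (fun ρ hρ hd => h ρ hρ (hd.mul_left _))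
    have hc : ¬ π ∣ b := by
      rintro ⟨c, rfl⟩
      exact hπ.not_isUnit (hb π ⟨c, by ring⟩)
    obtain ⟨k, l, hkl⟩ := hπ.irreducible.coprime_iff_not_dvd.2 hc
    refine ⟨k * π * r + l * b * s, ?_⟩
    have hcop : IsCoprime π b := ⟨k, l, hkl⟩
    apply hcop.mul_dvd
    · refine ⟨u + (k * r - k * s) * (k * π * r + l * b * s + s), ?_⟩
      linear_combination hs + s * (k * π * r + l * b * s + s) * hkl
    · refine ⟨v + (l * s - l * r) * (k * π * r + l * b * s + r), ?_⟩
      linear_combination hr + r * (k * π * r + l * b * s + r) * hkl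

theorem norm_sub_le (u v : QInt t) : (u - v).norm ≤ 2 * u.norm + 2 * v.norm := by
  have h := norm_nonneg (u + v)
  simp only [norm_eq, QuadraticAlgebra.re_add, QuadraticAlgebra.im_add, QuadraticAlgebra.re_sub,
    QuadraticAlgebra.im_sub] at h ⊢
  linarith

/-- One step of the descent. -/
theorem exists_descent {a b : QInt t} (hb : b ≠ 0) (hab : a.norm ≤ b.norm) (hb2 : 2 < b.norm)
    (hsq : Squarefree b) (h : IsSquareMod b a) :
    ∃ s c : QInt t, s ^ 2 - a = b * c ∧ c.norm < b.norm := by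
  obtain ⟨s, c, hs⟩ := h
  obtain ⟨q, hq⟩ := exists_norm_sub_le s hb
  refine ⟨s - b * q, c - 2 * s * q + b * q ^ 2, by linear_combination hs, ?_⟩
  set r := s - b * q
  set d := c - 2 * s * q + b * q ^ 2
  have e : r ^ 2 - a = b * d := by simp only [r, d]; linear_combination hs
  have hn := norm_pos hb
  have h1 := norm_sub_le (r ^ 2) a
  rw [e, map_mul, map_pow] at h1
  have hr := norm_nonneg r
  have hd := norm_nonneg d
  have ha := norm_nonneg a
  -- With remainder `r`, the bound is `|b||d| ≤ 2|r|² + 2|a|` in norms. For `t = 0` this gives `|d|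
  -- ≤ |b|/2 + 2`, which is not a descent when `|b| = 4`. The Gaussian integers of norm 4 are
  -- associates of `2 = -i(1+i)²`, so squarefreeness excludes them.
  have h4 : t = 0 → b.norm ≠ 4 := by
    rintro rfl h4
    have h5 : IsUnit (⟨1, 1⟩ : QInt 0) := by
      apply hsq
      obtain ⟨c, hc⟩ : (2 : ℤ) ∣ b.re ∧ (2 : ℤ) ∣ b.im := by
        rw [norm_eq] at h4
        have h6 : b.re ^ 2 ≤ 4 := by nlinarith [sq_nonneg b.im]
        have h7 : b.im ^ 2 ≤ 4 := by nlinarith [sq_nonneg b.re]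
        have : -2 ≤ b.re := by nlinarith
        have : b.re ≤ 2 := by nlinarith
        have : -2 ≤ b.im := by nlinarith
        have : b.im ≤ 2 := by nlinarith
        generalize b.re = u at *
        generalize b.im = v at *
        interval_cases u <;> interval_cases v <;> simp_all
      refine dvd_trans ⟨⟨0, -1⟩, ?_⟩ (two_dvd_ext c hc)
      ext <;> simp
    rw [QuadraticAlgebra.isUnit_iff_norm_isUnit, norm_eq] at h5
    norm_num [Int.isUnit_iff] at h5
  by_contra! hlt
  rcases ht.out with rfl | rfl
  · have h4 := h4 rfl
    have h5 : b.norm * b.norm ≤ b.norm * d.norm := mul_le_mul_of_nonneg_left hlt hn.le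
    generalize b.norm = B at *
    rcases (show B = 3 ∨ 5 ≤ B by omega) with rfl | h6
    -- For `|b| = 3` the real bound is too weak, but `2|r| ≤ 3` rounds down to `|r| ≤ 1`.
    · have : r.norm ≤ 1 := by omega
      nlinarith
    · nlinarith
  · nlinarith

/-- Norms from adjoining `√a` are multiplicative. The product `(s + √a)(z + x√a)` has norm `bc · cy²
= b(cy)²`, and its coordinates are the new `z` and `x`. -/
theorem hasPoint_of_descent {a b c s : QInt t} (hc : c ≠ 0) (e : s ^ 2 - a = b * c)
    (h : HasPoint a c) : HasPoint a b := by
  obtain ⟨x, y, z, h0, h⟩ := h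
  by_cases hy : y = 0
  · subst hy
    exact ⟨x, 0, z, h0, by rw [h]; ring⟩
  · refine ⟨s * x + z, c * y, s * z + a * x, fun h' => mul_ne_zero hc hy h'.2.1, ?_⟩
    linear_combination (s ^ 2 - a) * h + c * y ^ 2 * e

theorem HasPoint.mul_sq_right {a b : QInt t} (h : HasPoint a b) {c : QInt t} (hc : c ≠ 0) :
    HasPoint a (c * c * b) := by
  obtain ⟨x, y, z, h0, h⟩ := h
  refine ⟨c * x, y, c * z, fun ⟨h1, h2, h3⟩ => h0 ⟨?_, h2, ?_⟩, by linear_combination c ^ 2 * h⟩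
  · exact (mul_eq_zero.1 h1).resolve_left hc
  · exact (mul_eq_zero.1 h3).resolve_left hc

/-- Legendre's descent on `|a| + |b|`: square factors of the larger coefficient `b` are removed;
then `a` is a square modulo `b`, and `b` is exchanged for the smaller `c` with `s² - a = bc`. -/
theorem hasPoint_of_isTameTrivial {a b : QInt t} (ha : a ≠ 0) (hb : b ≠ 0)
    (h : ∀ π : QInt t, Prime π → ¬ π ∣ 2 → IsTameTrivial π a b) : HasPoint a b := by
  obtain ⟨n, hn⟩ : ∃ n : ℕ, a.norm + b.norm < n :=
    ⟨(a.norm + b.norm).toNat + 1, by have := Int.self_le_toNat (a.norm + b.norm); push_cast; omega⟩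
  induction n generalizing a b with
  | zero =>
    have := norm_pos ha
    have := norm_pos hb
    push_cast at hn
    omega
  | succ n ih =>
    push_cast at hn
    wlog hab : a.norm ≤ b.norm generalizing a b
    · exact (this hb ha (fun π hπ h2 => (h π hπ h2).symm) (by linarith) (by linarith)).symm
    by_cases hsq : Squarefree b
    swap
    · simp only [Squarefree, not_forall] at hsq
      obtain ⟨x, ⟨c, rfl⟩, hx⟩ := hsq
      have hx0 : x ≠ 0 := by rintro rfl; simp at hb
      have hc0 : c ≠ 0 := by rintro rfl; simp at hb
      refine HasPoint.mul_sq_right (ih ha hc0 (fun π hπ h2 => ?_) ?_) hx0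
      · rw [← IsTameTrivial.mul_right_iff hπ ha (pow_ne_zero 2 hx0) hc0
          (isTameTrivial_sq_right hπ ha hx0), sq]
        exact h π hπ h2
      · have h1 := norm_pos hx0
        have h2 := norm_pos hc0
        have h3 : x.norm ≠ 1 := fun h => hx (by
          rw [QuadraticAlgebra.isUnit_iff_norm_isUnit, h]; exact isUnit_one)
        rw [map_mul, map_mul] at hn
        have h4 : 2 ≤ x.norm := by omega
        have h5 : 4 ≤ x.norm * x.norm := by nlinarith
        have := mul_le_mul_of_nonneg_right h5 h2.le
        linarith
    by_cases hb2 : b.norm ≤ 2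
    · exact hasPoint_of_small ha hb (hab.trans hb2) hb2
    have hmod : IsSquareMod b a := by
      refine isSquareMod_of_squarefree a hsq fun π hπ hd => ?_
      by_cases h2 : π ∣ 2
      · exact isSquareMod_of_dvd_two hπ h2 a
      by_cases hda : π ∣ a
      · exact ⟨0, by simpa using hda⟩
      obtain ⟨c, hc⟩ := hd
      have hdc : ¬ π ∣ c := by
        rintro ⟨d, rfl⟩
        exact hπ.not_isUnit (hsq π ⟨d, by rw [hc]; ring⟩)
      simpa using h π hπ h2 0 1 a c (by simp) (by simpa using hc) hda hdc
    obtain ⟨s, c, e, hlt⟩ := exists_descent hb hab (by linarith) hsq hmod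
    by_cases hc : c = 0
    · refine ⟨1, 0, s, by simp, ?_⟩
      rw [hc] at e
      linear_combination e
    refine hasPoint_of_descent hc e (ih ha hc (fun π hπ h2 => ?_) (by linarith))
    -- The Steinberg relation trivialises the symbol of `a` and `bc`, so triviality passes from `b`
    -- to `c`.
    have h1 := isTameTrivial_sq_sub hπ (t := s) ha (by rw [e]; exact mul_ne_zero hb hc)
    rwa [e, IsTameTrivial.mul_right_iff hπ ha hb hc (h π hπ h2)] at h1

end QInt

/-! ### Tame symbols of rational integers -/

theorem isSquareMod_iff_isSquare_zmod {p : ℕ} {c : ℤ} :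
    IsSquareMod (p : ℤ) c ↔ IsSquare (c : ZMod p) := by
  constructor
  · rintro ⟨s, hs⟩
    refine ⟨s, ?_⟩
    have := (ZMod.intCast_zmod_eq_zero_iff_dvd _ p).2 hs
    push_cast at this
    linear_combination -this
  · rintro ⟨s, hs⟩
    obtain ⟨r, rfl⟩ := ZMod.intCast_surjective s
    refine ⟨r, (ZMod.intCast_zmod_eq_zero_iff_dvd _ p).1 ?_⟩
    push_cast
    rw [hs]; ring

/-- Among the classes of `c`, `d` and `cd` modulo `p` one is a square. -/
theorem isSquareMod_or_mul {p : ℕ} [Fact p.Prime] {c d : ℤ} (hc : ¬ (p : ℤ) ∣ c)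
    (hd : ¬ (p : ℤ) ∣ d) (h : ¬ IsSquareMod (p : ℤ) d) :
    IsSquareMod (p : ℤ) c ∨ IsSquareMod (p : ℤ) (d * c) := by
  have hc' : (c : ZMod p) ≠ 0 := by rwa [Ne, ZMod.intCast_zmod_eq_zero_iff_dvd]
  have hd' : (d : ZMod p) ≠ 0 := by rwa [Ne, ZMod.intCast_zmod_eq_zero_iff_dvd]
  have hcd : ((d * c : ℤ) : ZMod p) ≠ 0 := by push_cast; exact mul_ne_zero hd' hc'
  rw [isSquareMod_iff_isSquare_zmod, ← legendreSym.eq_one_iff p hc']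
  rw [isSquareMod_iff_isSquare_zmod, ← legendreSym.eq_one_iff p hcd, legendreSym.mul]
  rw [isSquareMod_iff_isSquare_zmod, ← legendreSym.eq_one_iff p hd'] at h
  rw [(legendreSym.eq_one_or_neg_one p hd').resolve_left h]
  rcases legendreSym.eq_one_or_neg_one p hc' with h1 | h1 <;> simp [h1]

theorem IsSquareMod.map {R S : Type*} [CommRing R] [CommRing S] (f : R →+* S) {π c : R}
    (h : IsSquareMod π c) : IsSquareMod (f π) (f c) := by
  obtain ⟨s, hs⟩ := h
  exact ⟨f s, by simpa using map_dvd f hs⟩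

theorem IsSquareMod.of_dvd {R : Type*} [CommRing R] {π ρ c : R} (h : IsSquareMod ρ c)
    (hd : π ∣ ρ) : IsSquareMod π c := by
  obtain ⟨s, hs⟩ := h
  exact ⟨s, hd.trans hs⟩

theorem exists_prime_dvd_natCast {R : Type*} [CommRing R] [IsDomain R] {π : R} (hπ : Prime π)
    {n : ℕ} (hn : n ≠ 0) (h : π ∣ (n : R)) : ∃ p : ℕ, p.Prime ∧ π ∣ (p : R) := by
  rw [← Nat.prod_primeFactorsList hn, Nat.cast_list_prod, hπ.dvd_prod_iff] at h
  obtain ⟨a, ha, hd⟩ := h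
  obtain ⟨p, hp, rfl⟩ := List.mem_map.1 ha
  exact ⟨p, Nat.prime_of_mem_primeFactorsList hp, hd⟩

theorem not_dvd_intCast {R : Type*} [CommRing R] {π : R} (hπ : Prime π) {p : ℕ}
    (hp : p.Prime) (hd : π ∣ (p : R)) {c : ℤ} (hc : ¬ (p : ℤ) ∣ c) : ¬ π ∣ (c : R) := by
  intro h
  obtain ⟨u, v, huv⟩ := (Nat.prime_iff_prime_int.1 hp).irreducible.coprime_iff_not_dvd.2 hc
  have : (u : R) * p + v * c = 1 := by exact_mod_cast congrArg (Int.cast : ℤ → R) huv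
  exact hπ.not_isUnit (isUnit_of_dvd_one (this ▸ dvd_add (hd.mul_left _) (h.mul_left _)))

namespace QInt

variable {t : ℤ} [ht : Fact (t = 0 ∨ t = 1)]

/-- Up to squares the symbol at `π` is the `e`-th power of the symbol `c` at the prime `p` below,
`e` being the ramification index. It is a square if `p` is ramified, because `e` is even, and if `p`
is inert, because `c` or `(t² - 4)c` is a square modulo `p` and `t² - 4` is a square upstairs. Only
split odd primes impose a condition. -/
theorem isTameTrivial_intCast {a b : ℤ} (ha : a ≠ 0) (hb : b ≠ 0)
    (h : ∀ (p : ℕ) [Fact p.Prime], p ≠ 2 → ¬ (p : ℤ) ∣ t ^ 2 - 4 →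
      IsSquareMod (p : ℤ) (t ^ 2 - 4) → IsTameTrivial (p : ℤ) a b)
    {π : QInt t} (hπ : Prime π) (h2 : ¬ π ∣ 2) : IsTameTrivial π (a : QInt t) (b : QInt t) := by
  obtain ⟨p, hp, hd⟩ : ∃ p : ℕ, p.Prime ∧ π ∣ (p : QInt t) := by
    refine exists_prime_dvd_natCast hπ (Int.natAbs_pos.2 (norm_pos hπ.ne_zero).ne').ne' ?_
    refine (Dvd.intro (star π) ?_ : π ∣ _)
    rw [← QuadraticAlgebra.algebraMap_norm_eq_mul_star, ← Int.cast_natCast,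
      Int.natCast_natAbs, abs_of_nonneg (norm_nonneg π)]
    rfl
  have : Fact p.Prime := ⟨hp⟩
  have hpZ := Nat.prime_iff_prime_int.1 hp
  have hp2 : p ≠ 2 := by rintro rfl; exact h2 (by exact_mod_cast hd)
  have hp0 : (p : QInt t) ≠ 0 := by exact_mod_cast hp.ne_zero
  obtain ⟨m, a', ea, ha'⟩ := exists_eq_pow_mul hpZ ha
  obtain ⟨n, b', eb, hb'⟩ := exists_eq_pow_mul hpZ hb
  obtain ⟨e, ρ, ep, hρ⟩ := exists_eq_pow_mul hπ hp0
  have hA : (a : QInt t) = π ^ (e * m) * (ρ ^ m * a') := by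
    rw [ea]; push_cast; rw [ep]; ring
  have hB : (b : QInt t) = π ^ (e * n) * (ρ ^ n * b') := by
    rw [eb]; push_cast; rw [ep]; ring
  rw [isTameTrivial_iff hπ hA hB
    (not_dvd_mul hπ (not_dvd_pow hπ hρ _) (not_dvd_intCast hπ hp hd ha'))
    (not_dvd_mul hπ (not_dvd_pow hπ hρ _) (not_dvd_intCast hπ hp hd hb'))]
  set c : ℤ := (-1) ^ (m * n) * a' ^ n * b' ^ m with hc
  have hcp : ¬ (p : ℤ) ∣ c := not_dvd_symbol hpZ ha' hb' _ _ _
  have key : IsSquareMod π ((c : QInt t) ^ e) := by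
    rcases Nat.even_or_odd e with he | he
    · exact isSquareMod_pow_even _ _ he
    have hD : ((t ^ 2 - 4 : ℤ) : QInt t) = (2 * QuadraticAlgebra.omega - (t : QInt t)) ^ 2 := by
      have h4 : (4 : QInt t) = ⟨4, 0⟩ := rfl
      ext <;> simp [sq, h4] <;> ring
    refine IsSquareMod.pow ?_ e
    by_cases hpD : (p : ℤ) ∣ t ^ 2 - 4
    · exfalso
      rcases ht.out with rfl | rfl
      · have h3 : (p : ℤ) ∣ 2 := hpZ.dvd_of_dvd_pow (n := 2) (by simpa using hpD)
        exact hp2 ((Nat.prime_dvd_prime_iff_eq hp Nat.prime_two).1 (by exact_mod_cast h3))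
      · have h3 : p = 3 := by
          rw [← Nat.prime_dvd_prime_iff_eq hp Nat.prime_three]
          have : (p : ℤ) ∣ 3 := by simpa using hpD
          exact_mod_cast this
        subst h3
        norm_num at hD
        have hs0 : (2 * QuadraticAlgebra.omega - 1 : QInt 1) ≠ 0 := by
          intro h0; rw [h0] at hD; norm_num at hD
        obtain ⟨g, σ, es, hσ⟩ := exists_eq_pow_mul hπ hs0
        have e3 : π ^ e * ρ = π ^ (2 * g) * (-σ ^ 2) := by
          rw [← ep]; push_cast; rw [← neg_neg (3 : QInt 1), hD, es]; ring
        obtain ⟨rfl, -⟩ := pow_mul_inj hπ e3 hρ (by rw [dvd_neg]; exact not_dvd_pow hπ hσ 2)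
        exact (Nat.not_even_iff_odd.2 he) (even_two_mul g)
    by_cases hsq : IsSquareMod (p : ℤ) (t ^ 2 - 4)
    · have := (isTameTrivial_iff hpZ ea eb ha' hb').1 (h p hp2 hpD hsq)
      have := this.map (Int.castRingHom (QInt t))
      exact IsSquareMod.of_dvd (by simpa [c] using this) hd
    · rcases isSquareMod_or_mul hcp hpD hsq with h1 | h1
      · have := h1.map (Int.castRingHom (QInt t))
        exact IsSquareMod.of_dvd (by simpa using this) hd
      · have := (h1.map (Int.castRingHom (QInt t))).of_dvd (π := π) (by simpa using hd)
        rw [map_mul] at this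
        refine this.of_mul_left hπ ?_ (not_dvd_intCast hπ hp hd hpD)
        rw [eq_intCast, hD]
        exact isSquareMod_sq _ _
  have h3 : IsSquareMod π ((ρ ^ (m * n * e)) ^ 2 : QInt t) := isSquareMod_sq _ _
  have h4 := h3.mul key
  -- The sign upstairs has exponent `e²mn`, while `c^e` has `emn`; they agree modulo 2.
  obtain ⟨k, hk⟩ : ∃ k, e * e = e + 2 * k := by
    obtain ⟨k, hk⟩ := Nat.even_mul_pred_self e
    refine ⟨k, ?_⟩
    cases e with
    | zero => simp at hk ⊢; omega
    | succ e => simp at hk; rw [← two_mul] at hk; rw [← hk]; ring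
  convert h4 using 1
  have h5 : (-1 : QInt t) ^ (e * m * (e * n)) = (-1) ^ (m * n * e) := by
    rw [show e * m * (e * n) = m * n * e + 2 * (k * m * n) by
      rw [show e * m * (e * n) = e * e * (m * n) by ring, hk]; ring, pow_add, pow_mul _ 2]
    simp
  rw [h5, hc]
  push_cast
  ring

end QInt

/-! ### From `ℚ_p` to `ℤ` -/

theorem PadicInt.exists_int_dvd_sub {p : ℕ} [Fact p.Prime] (x : ℤ_[p]) :
    ∃ n : ℤ, (p : ℤ_[p]) ∣ x - n := by
  obtain ⟨n, -, hn⟩ := PadicInt.exists_mem_range x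
  refine ⟨n, ?_⟩
  rw [PadicInt.maximalIdeal_eq_span_p, Ideal.mem_span_singleton] at hn
  exact_mod_cast hn

theorem PadicInt.p_dvd_intCast_iff {p : ℕ} [Fact p.Prime] (a : ℤ) :
    (p : ℤ_[p]) ∣ a ↔ (p : ℤ) ∣ a := by
  simpa using PadicInt.pow_p_dvd_int_iff (p := p) 1 a

theorem isTameTrivial_of_padicInt {p : ℕ} [Fact p.Prime] {a b : ℤ}
    (h : IsTameTrivial (p : ℤ_[p]) a b) : IsTameTrivial (p : ℤ) a b := by
  intro m n a' b' ha hb ha' hb'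
  obtain ⟨s, hs⟩ := h m n a' b' (by rw [ha]; push_cast; rfl) (by rw [hb]; push_cast; rfl)
    (by rwa [PadicInt.p_dvd_intCast_iff]) (by rwa [PadicInt.p_dvd_intCast_iff])
  obtain ⟨r, hr⟩ := PadicInt.exists_int_dvd_sub s
  refine ⟨r, ?_⟩
  rw [← PadicInt.p_dvd_intCast_iff]
  push_cast
  have := dvd_sub hs (hr.mul_right (s + r))
  convert this using 1
  ring

theorem isTameTrivial_of_padic_conic {p : ℕ} [Fact p.Prime] {a b : ℤ} (ha : a ≠ 0) (hb : b ≠ 0)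
    {x y z : ℚ_[p]} (h0 : ¬ (x = 0 ∧ y = 0 ∧ z = 0))
    (h : z ^ 2 = a * x ^ 2 + b * y ^ 2) : IsTameTrivial (p : ℤ) a b := by
  apply isTameTrivial_of_padicInt
  obtain ⟨⟨d, hd⟩, hint⟩ := IsLocalization.exist_integer_multiples (nonZeroDivisors ℤ_[p])
    (Finset.univ : Finset (Fin 3)) ![x, y, z]
  obtain ⟨x', hx⟩ := hint 0 (by simp)
  obtain ⟨y', hy⟩ := hint 1 (by simp)
  obtain ⟨z', hz⟩ := hint 2 (by simp)
  have hd0 : (d : ℚ_[p]) ≠ 0 := by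
    have := nonZeroDivisors.ne_zero hd
    simpa using this
  simp only [Matrix.cons_val_zero, Matrix.cons_val_one, Matrix.cons_val, Algebra.smul_def] at hx hy hz
  change (x' : ℚ_[p]) = d * x at hx
  change (y' : ℚ_[p]) = d * y at hy
  change (z' : ℚ_[p]) = d * z at hz
  refine isTameTrivial_of_conic PadicInt.prime_p (x := x') (y := y') (z := z')
    (by exact_mod_cast ha) (by exact_mod_cast hb) ?_ ?_
  · have : (z' : ℚ_[p]) ^ 2 = a * (x' : ℚ_[p]) ^ 2 + b * (y' : ℚ_[p]) ^ 2 := by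
      rw [hx, hy, hz]; linear_combination (d : ℚ_[p]) ^ 2 * h
    refine Subtype.coe_injective ?_
    push_cast
    exact this
  · rintro ⟨rfl, rfl, rfl⟩
    simp [hd0] at hx hy hz
    exact h0 ⟨hx, hy, hz⟩

/-! ### Reduced trace and norm -/

/-- A reduced trace and a reduced norm on an algebra in which every element is quadratic. -/
structure ReducedForm (F A : Type*) [Field F] [Ring A] [Algebra F A] where
  /-- the reduced trace -/
  tr : A →ₗ[F] F
  /-- the reduced norm -/
  nm : A →* F
  mul_self : ∀ x, x * x = tr x • x - algebraMap F A (nm x)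
  nm_add : ∀ x y, nm (x + y) = nm x + nm y + (tr x * tr y - tr (x * y))
  nm_algebraMap : ∀ c, nm (algebraMap F A c) = c ^ 2
  tr_one : tr 1 = 2
  tr_mul_comm : ∀ x y, tr (x * y) = tr (y * x)
  nondegenerate : ∀ x, (∀ y, tr (x * y) = 0) → x = 0

namespace ReducedForm

section

variable {F A : Type*} [Field F] [Ring A] [Algebra F A] (Q : ReducedForm F A)

theorem tr_algebraMap (c : F) : Q.tr (algebraMap F A c) = 2 * c := by
  rw [Algebra.algebraMap_eq_smul_one, map_smul, Q.tr_one, smul_eq_mul, mul_comm]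

theorem nm_smul (c : F) (x : A) : Q.nm (c • x) = c ^ 2 * Q.nm x := by
  rw [Algebra.smul_def, map_mul, nm_algebraMap]

theorem nm_zero : Q.nm 0 = 0 := by simpa using Q.nm_smul 0 0

theorem nm_neg (x : A) : Q.nm (-x) = Q.nm x := by simpa using Q.nm_smul (-1) x

theorem nm_sub (x y : A) : Q.nm (x - y) = Q.nm x + Q.nm y - (Q.tr x * Q.tr y - Q.tr (x * y)) := by
  rw [sub_eq_add_neg, nm_add, nm_neg, map_neg, mul_neg, mul_neg, map_neg]; ring

/-- The canonical involution. -/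
def conj (x : A) : A := algebraMap F A (Q.tr x) - x

theorem mul_conj (x : A) : x * Q.conj x = algebraMap F A (Q.nm x) := by
  rw [conj, mul_sub, Q.mul_self, ← Algebra.commutes, ← Algebra.smul_def]; abel

theorem conj_mul (x : A) : Q.conj x * x = algebraMap F A (Q.nm x) := by
  rw [conj, sub_mul, Q.mul_self, ← Algebra.smul_def]; abel

theorem tr_mul_self (x : A) : Q.tr (x * x) = Q.tr x ^ 2 - 2 * Q.nm x := by
  rw [Q.mul_self, map_sub, map_smul, tr_algebraMap, smul_eq_mul]; ring

theorem nm_conj (x : A) : Q.nm (Q.conj x) = Q.nm x := by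
  rw [conj, nm_sub, nm_algebraMap, tr_algebraMap, ← Algebra.smul_def, map_smul, smul_eq_mul]; ring

theorem nm_add_algebraMap (x : A) (c : F) :
    Q.nm (x + algebraMap F A c) = Q.nm x + c * Q.tr x + c ^ 2 := by
  rw [nm_add, nm_algebraMap, tr_algebraMap, ← Algebra.commutes, ← Algebra.smul_def, map_smul,
    smul_eq_mul]; ring

theorem tr_mul_conj (x y : A) : Q.tr (x * Q.conj y) = Q.tr x * Q.tr y - Q.tr (x * y) := by
  rw [conj, mul_sub, map_sub, ← Algebra.commutes, ← Algebra.smul_def, map_smul, smul_eq_mul,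
    mul_comm]

theorem nm_ne_zero_of_isUnit {x : A} (h : IsUnit x) : Q.nm x ≠ 0 := (h.map Q.nm).ne_zero

theorem isUnit_of_nm_ne_zero {x : A} (h : Q.nm x ≠ 0) : IsUnit x := by
  refine ⟨⟨x, (Q.nm x)⁻¹ • Q.conj x, ?_, ?_⟩, rfl⟩
  · rw [mul_smul_comm, mul_conj, Algebra.algebraMap_eq_smul_one, smul_smul, inv_mul_cancel₀ h,
      one_smul]
  · rw [smul_mul_assoc, conj_mul, Algebra.algebraMap_eq_smul_one, smul_smul, inv_mul_cancel₀ h,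
      one_smul]

/-- Transport of a reduced form along an isomorphism. -/
def comp {A' : Type*} [Ring A'] [Algebra F A'] (Q : ReducedForm F A) (e : A' ≃ₐ[F] A) :
    ReducedForm F A' where
  tr := Q.tr ∘ₗ e.toLinearMap
  nm := Q.nm.comp (e : A' →* A)
  mul_self x := e.injective (by simp [Q.mul_self])
  nm_add x y := by simp [Q.nm_add]
  nm_algebraMap c := by simp [Q.nm_algebraMap]
  tr_one := by simp [Q.tr_one]
  tr_mul_comm x y := by simp [Q.tr_mul_comm (e x) (e y)]
  nondegenerate x h := by
    have := Q.nondegenerate (e x) fun y => by simpa using h (e.symm y)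
    simpa using this

/-- `x` is a root of `X² - tX + 1` iff it has reduced trace `t` and reduced norm `1`, unless it is
a scalar. -/
theorem root_of_tr_nm {x : A} {t : F} (h1 : Q.tr x = t) (h2 : Q.nm x = 1) :
    x * x = t • x - 1 := by rw [Q.mul_self, h1, h2, map_one]

theorem tr_nm_of_root {x : A} {t n : F} (h : x * x = t • x - algebraMap F A n)
    (hx : ∀ c : F, x ≠ algebraMap F A c) : Q.tr x = t ∧ Q.nm x = n := by
  -- Subtracting the two quadratic relations leaves a linear one, which a nonscalar `x` satisfies
  -- only trivially.
  have h1 : (Q.tr x - t) • x = algebraMap F A (Q.nm x - n) := by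
    have := (Q.mul_self x).symm.trans h
    rw [sub_smul, map_sub, sub_eq_sub_iff_add_eq_add, add_comm]
    rw [sub_eq_sub_iff_add_eq_add] at this
    rw [add_comm, this]; abel
  have h2 : Q.tr x = t := by
    by_contra hne
    have hne := sub_ne_zero.2 hne
    refine hx ((Q.tr x - t)⁻¹ * (Q.nm x - n)) ?_
    rw [map_mul, ← h1, ← Algebra.smul_def, smul_smul, inv_mul_cancel₀ hne, one_smul]
  refine ⟨h2, ?_⟩
  rw [h2, sub_self, zero_smul] at h1
  have h3 := congrArg Q.nm h1
  rw [nm_zero, nm_algebraMap] at h3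
  exact sub_eq_zero.1 (pow_eq_zero_iff (two_ne_zero)|>.1 h3.symm)

end

end ReducedForm

/-- The reduced form of the quaternion algebra `(a, b / F)`. -/
def quaternionForm {F : Type*} [Field F] [CharZero F] {a b : F} (ha : a ≠ 0) (hb : b ≠ 0) :
    ReducedForm F ℍ[F, a, b] where
  tr := (2 : F) • QuaternionAlgebra.reₗ a 0 b
  nm :=
    { toFun := fun q => q.re ^ 2 - a * q.imI ^ 2 - b * q.imJ ^ 2 + a * b * q.imK ^ 2
      map_one' := by simp
      map_mul' := fun x y => by simp; ring }
  mul_self x := by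
    rw [QuaternionAlgebra.algebraMap_eq]
    ext <;> simp <;> ring
  nm_add x y := by simp; ring
  nm_algebraMap c := by simp
  tr_one := by simp
  tr_mul_comm x y := by simp; ring
  nondegenerate x h := by
    ext
    · simpa using h 1
    · simpa [ha] using h ⟨0, 1, 0, 0⟩
    · simpa [hb] using h ⟨0, 0, 1, 0⟩
    · simpa [ha, hb] using h ⟨0, 0, 0, 1⟩

/-! ### Base change of a quaternion algebra and of its reduced form -/

section BaseChange

variable (F : Type*) [Field F] [CharZero F] [Algebra ℚ F] {B : Type*} [Ring B] [Algebra ℚ B] {a b : ℚ}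

/-- The map `(a, b / ℚ) → (a, b / F)`. -/
def quaternionMap (a b : ℚ) : ℍ[ℚ, a, b] →ₐ[ℚ] ℍ[F, algebraMap ℚ F a, algebraMap ℚ F b] where
  toFun q := ⟨algebraMap ℚ F q.re, algebraMap ℚ F q.imI, algebraMap ℚ F q.imJ,
    algebraMap ℚ F q.imK⟩
  map_one' := by ext <;> simp
  map_mul' x y := by ext <;> simp
  map_zero' := by ext <;> simp
  map_add' x y := by ext <;> simp
  commutes' c := by
    rw [IsScalarTower.algebraMap_apply ℚ F ℍ[F, _, _] c, QuaternionAlgebra.algebraMap_eq,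
      QuaternionAlgebra.algebraMap_eq]
    ext <;> simp

/-- Base change of a quaternion algebra over `ℚ`, as a homomorphism. -/
def baseChangeHom (e : B ≃ₐ[ℚ] ℍ[ℚ, a, b]) :
    F ⊗[ℚ] B →ₐ[F] ℍ[F, algebraMap ℚ F a, algebraMap ℚ F b] :=
  Algebra.TensorProduct.lift (Algebra.ofId F _) ((quaternionMap F a b).comp e.toAlgHom)
    fun x _ => Algebra.commutes x _

theorem baseChangeHom_tmul (e : B ≃ₐ[ℚ] ℍ[ℚ, a, b]) (c : F) (x : B) :
    baseChangeHom F e (c ⊗ₜ x) = c • quaternionMap F a b (e x) := by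
  simp [baseChangeHom, Algebra.smul_def]
  rfl

theorem baseChangeHom_bijective (e : B ≃ₐ[ℚ] ℍ[ℚ, a, b]) :
    Function.Bijective (baseChangeHom F e) := by
  have hs : Function.Surjective (baseChangeHom F e) := by
    intro q
    refine ⟨q.re ⊗ₜ e.symm 1 + q.imI ⊗ₜ e.symm ⟨0, 1, 0, 0⟩ + q.imJ ⊗ₜ e.symm ⟨0, 0, 1, 0⟩
      + q.imK ⊗ₜ e.symm ⟨0, 0, 0, 1⟩, ?_⟩
    simp only [map_add, baseChangeHom_tmul, AlgEquiv.apply_symm_apply]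
    ext <;> simp [quaternionMap]
  have : Module.Finite ℚ B := Module.Finite.equiv e.symm.toLinearEquiv
  have hf : Module.finrank F (F ⊗[ℚ] B)
      = Module.finrank F ℍ[F, algebraMap ℚ F a, algebraMap ℚ F b] := by
    rw [Module.finrank_baseChange, e.toLinearEquiv.finrank_eq, QuaternionAlgebra.finrank_eq_four,
      QuaternionAlgebra.finrank_eq_four]
  exact ⟨(LinearMap.injective_iff_surjective_of_finrank_eq_finrank
    (f := (baseChangeHom F e).toLinearMap) hf).2 hs, hs⟩

/-- Base change of a quaternion algebra over `ℚ`. -/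
def baseChangeEquiv (e : B ≃ₐ[ℚ] ℍ[ℚ, a, b]) :
    F ⊗[ℚ] B ≃ₐ[F] ℍ[F, algebraMap ℚ F a, algebraMap ℚ F b] :=
  AlgEquiv.ofBijective (baseChangeHom F e) (baseChangeHom_bijective F e)

theorem baseChangeEquiv_one_tmul (e : B ≃ₐ[ℚ] ℍ[ℚ, a, b]) (x : B) :
    baseChangeEquiv F e (1 ⊗ₜ x) = quaternionMap F a b (e x) := by
  simp [baseChangeEquiv, baseChangeHom_tmul]

/-- The reduced form on the base change of a quaternion algebra over `ℚ`. -/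
def baseForm (ha : a ≠ 0) (hb : b ≠ 0) (e : B ≃ₐ[ℚ] ℍ[ℚ, a, b]) : ReducedForm F (F ⊗[ℚ] B) :=
  (quaternionForm (by simpa using ha) (by simpa using hb)).comp (baseChangeEquiv F e)

theorem baseForm_nm (ha : a ≠ 0) (hb : b ≠ 0) (e : B ≃ₐ[ℚ] ℍ[ℚ, a, b]) (x : B) :
    (baseForm F ha hb e).nm (1 ⊗ₜ x)
      = algebraMap ℚ F (((quaternionForm ha hb).comp e).nm x) := by
  simp [baseForm, ReducedForm.comp, baseChangeEquiv_one_tmul, quaternionForm, quaternionMap]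

theorem baseForm_tr (ha : a ≠ 0) (hb : b ≠ 0) (e : B ≃ₐ[ℚ] ℍ[ℚ, a, b]) (x : B) :
    (baseForm F ha hb e).tr (1 ⊗ₜ x)
      = algebraMap ℚ F (((quaternionForm ha hb).comp e).tr x) := by
  simp [baseForm, ReducedForm.comp, baseChangeEquiv_one_tmul, quaternionForm, quaternionMap]

end BaseChange

/-! ### Positivity of the reduced norm of a definite algebra -/

section Definite

variable {B : Type*} [Ring B] [Algebra ℚ B] {a b : ℚ}

/-- If `a ≥ 0`, the real quaternion `√a + i` is nonzero of norm 0; likewise `√b + j`. -/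
theorem IsDefinite.neg (hdef : IsDefinite B) (ha : a ≠ 0) (hb : b ≠ 0)
    (e : B ≃ₐ[ℚ] ℍ[ℚ, a, b]) : a < 0 ∧ b < 0 := by
  have key : ∀ q : ℍ[ℝ, algebraMap ℚ ℝ a, algebraMap ℚ ℝ b], q ≠ 0 →
      (quaternionForm (F := ℝ) (a := algebraMap ℚ ℝ a) (b := algebraMap ℚ ℝ b)
        (by simpa using ha) (by simpa using hb)).nm q ≠ 0 := by
    intro q hq
    apply ReducedForm.nm_ne_zero_of_isUnit
    have := (hdef ((baseChangeEquiv ℝ e).symm q) (by simpa using hq)).map (baseChangeEquiv ℝ e)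
    simpa using this
  constructor
  · by_contra! h
    refine key ⟨√a, 1, 0, 0⟩ (fun h => by simpa using congrArg QuaternionAlgebra.imI h) ?_
    have : √(a : ℝ) ^ 2 = a := Real.sq_sqrt (by exact_mod_cast h)
    simp [quaternionForm, this]
  · by_contra! h
    refine key ⟨√b, 0, 1, 0⟩ (fun h => by simpa using congrArg QuaternionAlgebra.imJ h) ?_
    have : √(b : ℝ) ^ 2 = b := Real.sq_sqrt (by exact_mod_cast h)
    simp [quaternionForm, this]

theorem IsDefinite.nm_pos (hdef : IsDefinite B) (ha : a ≠ 0) (hb : b ≠ 0)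
    (e : B ≃ₐ[ℚ] ℍ[ℚ, a, b]) {x : B} (hx : x ≠ 0) :
    0 < ((quaternionForm ha hb).comp e).nm x := by
  obtain ⟨h1, h2⟩ := hdef.neg ha hb e
  have h3 : 0 < a * b := mul_pos_of_neg_of_neg h1 h2
  have hq : e x ≠ 0 := by simpa using hx
  change 0 < (e x).re ^ 2 - a * (e x).imI ^ 2 - b * (e x).imJ ^ 2 + a * b * (e x).imK ^ 2
  generalize e x = q at hq
  have e1 := mul_nonneg (neg_nonneg.2 h1.le) (sq_nonneg q.imI)
  have e2 := mul_nonneg (neg_nonneg.2 h2.le) (sq_nonneg q.imJ)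
  have e3 := mul_nonneg h3.le (sq_nonneg q.imK)
  have e0 := sq_nonneg q.re
  by_contra! h
  apply hq
  ext
  · simpa using (show q.re ^ 2 = 0 by linarith)
  · simpa [ha] using (show -a * q.imI ^ 2 = 0 by linarith)
  · simpa [hb] using (show -b * q.imJ ^ 2 = 0 by linarith)
  · simpa [ha, hb] using (show a * b * q.imK ^ 2 = 0 by linarith)

end Definite

/-! ### Embedding `ℚ[X] / (X² - tX + 1)` into a quaternion algebra -/

/-- A nonzero nilpotent matrix corresponds to a pure quaternion of norm 0. Multiplying the norm
equation by `ab` gives the conic. -/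
theorem exists_conic_of_split {F : Type*} [Field F] [CharZero F] {a b : F} (ha : a ≠ 0)
    (hb : b ≠ 0) (φ : ℍ[F, a, b] ≃ₐ[F] Matrix (Fin 2) (Fin 2) F) :
    ∃ x y z : F, ¬ (x = 0 ∧ y = 0 ∧ z = 0) ∧ z ^ 2 = a * x ^ 2 + b * y ^ 2 := by
  let Q := quaternionForm ha hb
  obtain ⟨q, hq0, hq⟩ : ∃ q : ℍ[F, a, b], q ≠ 0 ∧ q * q = 0 := by
    refine ⟨φ.symm !![0, 1; 0, 0], ?_, ?_⟩
    · rw [Ne, map_eq_zero_iff _ φ.symm.injective]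
      intro h
      simpa using congrFun (congrFun h 0) 1
    · rw [← map_mul, map_eq_zero_iff _ φ.symm.injective]
      ext i j
      fin_cases i <;> fin_cases j <;> simp
  have h1 : Q.nm q = 0 := by
    have : Q.nm q * Q.nm q = 0 := by rw [← map_mul, hq, Q.nm_zero]
    simpa using this
  have h2 : Q.tr q = 0 := by
    have := Q.mul_self q
    rw [hq, h1, map_zero, sub_zero] at this
    exact (smul_eq_zero.1 this.symm).resolve_right hq0
  have h3 : q.re = 0 := by simpa [Q, quaternionForm] using h2
  have h4 : q.re ^ 2 - a * q.imI ^ 2 - b * q.imJ ^ 2 + a * b * q.imK ^ 2 = 0 := h1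
  refine ⟨b * q.imJ, a * q.imI, a * b * q.imK, ?_, ?_⟩
  · rintro ⟨e1, e2, e3⟩
    apply hq0
    ext
    · exact h3
    · simpa [ha] using e2
    · simpa [hb] using e1
    · simpa [ha, hb] using e3
  · rw [h3] at h4
    linear_combination a * b * h4

/-- Over the quadratic field with generator `ω`, the point gives an element `β + ωγ` of norm 0, with
`β` and `γ` in `B`. Separating the coefficients of `1` and `ω` in its norm yields `nm β = nm γ` and
`tr(β γ̄) = -t nm γ`. Hence `-βγ⁻¹` has trace `t` and norm 1. -/
theorem QInt.HasPoint.exists_root {t : ℤ} [Fact (t = 0 ∨ t = 1)] {B : Type*} [Ring B] [Algebra ℚ B]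
    {a b : ℚ} (ha : a ≠ 0) (hb : b ≠ 0) (e : B ≃ₐ[ℚ] ℍ[ℚ, a, b])
    (hdiv : ∀ x : B, x ≠ 0 → ((quaternionForm ha hb).comp e).nm x ≠ 0) {m n : ℤ} {c d : ℚ}
    (hm : (m : ℚ) = a * c ^ 2) (hn : (n : ℚ) = b * d ^ 2) (hc : c ≠ 0) (hd : d ≠ 0)
    (h : QInt.HasPoint (t := t) m n) :
    ∃ α : B, ((quaternionForm ha hb).comp e).tr α = t ∧
      ((quaternionForm ha hb).comp e).nm α = 1 := by
  set Q := (quaternionForm ha hb).comp e with hQ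
  obtain ⟨x, y, z, h0, h⟩ := h
  let β : B := e.symm ⟨z.re, c * x.re, d * y.re, 0⟩
  let γ : B := e.symm ⟨z.im, c * x.im, d * y.im, 0⟩
  have nmβ : Q.nm β = z.re ^ 2 - m * x.re ^ 2 - n * y.re ^ 2 := by
    rw [hm, hn]; simp [Q, β, ReducedForm.comp, quaternionForm]; ring
  have nmγ : Q.nm γ = z.im ^ 2 - m * x.im ^ 2 - n * y.im ^ 2 := by
    rw [hm, hn]; simp [Q, γ, ReducedForm.comp, quaternionForm]; ring
  have trβγ : Q.tr (β * Q.conj γ) = 2 * (z.re * z.im - m * x.re * x.im - n * y.re * y.im) := by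
    rw [Q.tr_mul_conj, hm, hn]; simp [Q, β, γ, ReducedForm.comp, quaternionForm]; ring
  have hre : z.re ^ 2 - z.im ^ 2 = m * (x.re ^ 2 - x.im ^ 2) + n * (y.re ^ 2 - y.im ^ 2) := by
    have := congrArg QuadraticAlgebra.re h
    simp [sq] at this
    linear_combination this
  have him : 2 * z.re * z.im + t * z.im ^ 2 = m * (2 * x.re * x.im + t * x.im ^ 2)
      + n * (2 * y.re * y.im + t * y.im ^ 2) := by
    have := congrArg QuadraticAlgebra.im h
    simp [sq] at this
    linear_combination this
  have hre' : Q.nm β = Q.nm γ := by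
    rw [nmβ, nmγ]
    have : ((z.re ^ 2 - z.im ^ 2 : ℤ) : ℚ)
      = ((m * (x.re ^ 2 - x.im ^ 2) + n * (y.re ^ 2 - y.im ^ 2) : ℤ) : ℚ) := by rw [hre]
    push_cast at this
    linear_combination this
  have him' : Q.tr (β * Q.conj γ) = - t * Q.nm γ := by
    rw [trβγ, nmγ]
    have : ((2 * z.re * z.im + t * z.im ^ 2 : ℤ) : ℚ) = ((m * (2 * x.re * x.im + t * x.im ^ 2)
      + n * (2 * y.re * y.im + t * y.im ^ 2) : ℤ) : ℚ) := by rw [him]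
    push_cast at this
    linear_combination this
  have hγ : Q.nm γ ≠ 0 := by
    intro hγ0
    have h1 : γ = 0 := by
      by_contra h1; exact hdiv _ h1 hγ0
    have h2 : β = 0 := by
      by_contra h2; exact hdiv _ h2 (hre'.trans hγ0)
    have h1 : (⟨z.im, c * x.im, d * y.im, 0⟩ : ℍ[ℚ, a, b]) = 0 := by simpa [γ] using h1
    have h2 : (⟨z.re, c * x.re, d * y.re, 0⟩ : ℍ[ℚ, a, b]) = 0 := by simpa [β] using h2
    rw [QuaternionAlgebra.ext_iff] at h1 h2
    simp [hc, hd] at h1 h2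
    exact h0 ⟨by ext <;> simp [h1, h2], by ext <;> simp [h1, h2], by ext <;> simp [h1, h2]⟩
  refine ⟨-(Q.nm γ)⁻¹ • (β * Q.conj γ), ?_, ?_⟩
  · rw [map_smul, him', smul_eq_mul]; field_simp
  · rw [Q.nm_smul, map_mul, Q.nm_conj, hre']; field_simp

/-- If the quaternion algebra splits at all odd primes that split in the field
`ℚ[X] / (X² - tX + 1)`, then this field embeds into the algebra. -/
theorem exists_root {t : ℤ} [Fact (t = 0 ∨ t = 1)] {B : Type*} [Ring B] [Algebra ℚ B]
    {a b : ℚ} (ha : a ≠ 0) (hb : b ≠ 0) (e : B ≃ₐ[ℚ] ℍ[ℚ, a, b])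
    (hdiv : ∀ x : B, x ≠ 0 → ((quaternionForm ha hb).comp e).nm x ≠ 0)
    (hloc : ∀ (p : ℕ) [Fact p.Prime], p ≠ 2 → ¬ (p : ℤ) ∣ t ^ 2 - 4 →
      IsSquareMod (p : ℤ) (t ^ 2 - 4) →
      Nonempty (Completion p B ≃ₐ[ℚ_[p]] Matrix (Fin 2) (Fin 2) ℚ_[p])) :
    ∃ α : B, ((quaternionForm ha hb).comp e).tr α = t ∧
      ((quaternionForm ha hb).comp e).nm α = 1 := by
  -- Numerator times denominator is an integer in the same square class, so the conic may be taken
  -- integral.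
  have key : ∀ q : ℚ, q ≠ 0 → ((q.num * q.den : ℤ) : ℚ) = q * (q.den : ℚ) ^ 2 := by
    intro q hq
    push_cast
    conv_rhs => rw [← Rat.num_div_den q]
    simp only [Rat.num_div_den]
    have : (q.den : ℚ) ≠ 0 := by exact_mod_cast q.den_ne_zero
    nth_rewrite 3 [← Rat.num_div_den q]
    field_simp
  have hda : (a.den : ℚ) ≠ 0 := by exact_mod_cast a.den_ne_zero
  have hdb : (b.den : ℚ) ≠ 0 := by exact_mod_cast b.den_ne_zero
  have hm : a.num * a.den ≠ 0 := mul_ne_zero (by simpa using ha) (by simp)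
  have hn : b.num * b.den ≠ 0 := mul_ne_zero (by simpa using hb) (by simp)
  refine QInt.HasPoint.exists_root (t := t) ha hb e hdiv (key a ha) (key b hb) hda hdb ?_
  refine QInt.hasPoint_of_isTameTrivial (by exact_mod_cast hm) (by exact_mod_cast hn)
    fun π hπ h2 => QInt.isTameTrivial_intCast hm hn (fun p hp hp2 hpD hsq => ?_) hπ h2
  obtain ⟨φ⟩ := hloc p hp2 hpD hsq
  obtain ⟨x, y, z, h0, h⟩ := exists_conic_of_split (F := ℚ_[p]) (by simpa using ha)
    (by simpa using hb) ((baseChangeEquiv ℚ_[p] e).symm.trans φ)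
  have hda' : (a.den : ℚ_[p]) ≠ 0 := by exact_mod_cast a.den_ne_zero
  have hdb' : (b.den : ℚ_[p]) ≠ 0 := by exact_mod_cast b.den_ne_zero
  refine isTameTrivial_of_padic_conic hm hn (x := x / a.den) (y := y / b.den) (z := z) ?_ ?_
  · simpa [hda', hdb'] using h0
  · have e1 := congrArg (algebraMap ℚ ℚ_[p]) (key a ha)
    have e2 := congrArg (algebraMap ℚ ℚ_[p]) (key b hb)
    rw [map_mul, map_pow, map_natCast, map_intCast] at e1 e2
    rw [e1, e2, h]
    field_simp

/-! ### Division quaternion algebras over `ℚ_p` -/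

/-! ### Applications of Hensel's lemma over `ℤ_p` -/

section Hensel

variable {p : ℕ} [Fact p.Prime]

open Polynomial in
theorem exists_root_of_norm_lt_one {u : ℚ_[p]} (hu : ‖u‖ < 1) : ∃ y : ℚ_[p], y ^ 2 - y + u = 0 := by
  obtain ⟨u, rfl⟩ : ∃ v : ℤ_[p], (v : ℚ_[p]) = u := ⟨⟨u, hu.le⟩, rfl⟩
  have h1 : aeval (1 : ℤ_[p]) (X ^ 2 - X + C u : ℤ_[p][X]) = u := by simp
  have h2 : aeval (1 : ℤ_[p]) (derivative (X ^ 2 - X + C u : ℤ_[p][X])) = 1 := by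
    simp
  obtain ⟨z, hz, -⟩ := hensels_lemma (F := (X ^ 2 - X + C u : ℤ_[p][X])) (a := (1 : ℤ_[p]))
    (by rw [h1, h2]; simpa using hu)
  refine ⟨z, ?_⟩
  have : z ^ 2 - z + u = 0 := by simpa using hz
  exact_mod_cast congrArg ((↑) : ℤ_[p] → ℚ_[p]) this

open Polynomial in
theorem PadicInt.isSquare_of_norm_lt {u a : ℤ_[p]} (h : ‖a ^ 2 - u‖ < ‖2 * a‖ ^ 2) : IsSquare u := by
  have h1 : aeval a (X ^ 2 - C u : ℤ_[p][X]) = a ^ 2 - u := by simp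
  have h2 : aeval a (derivative (X ^ 2 - C u : ℤ_[p][X])) = 2 * a := by
    simp [one_add_one_eq_two]
  obtain ⟨z, hz, -⟩ := hensels_lemma (F := (X ^ 2 - C u : ℤ_[p][X])) (a := a)
    (by rw [h1, h2]; exact h)
  exact ⟨z, by have : z ^ 2 - u = 0 := by simpa using hz
               linear_combination -this⟩

end Hensel

section Division

variable {p : ℕ} [Fact p.Prime] {A : Type*} [Ring A] [Algebra ℚ_[p] A]

namespace ReducedForm

variable (Q : ReducedForm ℚ_[p] A)

theorem eq_algebraMap_of_root (hdiv : ∀ x : A, x ≠ 0 → IsUnit x) {x : A} {r : ℚ_[p]}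
    (h : r ^ 2 - Q.tr x * r + Q.nm x = 0) : x = algebraMap _ A r := by
  by_contra hne
  refine Q.nm_ne_zero_of_isUnit (hdiv _ (sub_ne_zero.2 hne)) ?_
  rw [sub_eq_add_neg, ← map_neg, nm_add_algebraMap]
  linear_combination h

/-- In a division algebra, the trace is bounded in terms of the norm. -/
theorem norm_tr_sq_le (hdiv : ∀ x : A, x ≠ 0 → IsUnit x) (x : A) : ‖Q.tr x‖ ^ 2 ≤ ‖Q.nm x‖ := by
  by_contra! h
  have ht : Q.tr x ≠ 0 := by
    intro h0; rw [h0, norm_zero] at h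
    exact absurd h (not_lt.2 (by simp))
  -- Scaling by the trace turns the characteristic polynomial into `y² - y + u` with `|u| < 1`,
  -- which has a root by Hensel. Then `x` is a scalar `r`, and `|2r|² ≤ |r|²` contradicts the
  -- assumption.
  obtain ⟨y, hy⟩ := exists_root_of_norm_lt_one (u := Q.nm x / Q.tr x ^ 2) (by
    rw [norm_div, norm_pow, div_lt_one (by positivity)]; exact h)
  have hx := Q.eq_algebraMap_of_root hdiv (x := x) (r := Q.tr x * y) (by
    have : Q.nm x = Q.tr x ^ 2 * (Q.nm x / Q.tr x ^ 2) := by field_simp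
    rw [this]; linear_combination Q.tr x ^ 2 * hy)
  generalize Q.tr x * y = r at hx
  rw [hx, tr_algebraMap, nm_algebraMap, norm_mul, mul_pow, norm_pow] at h
  have h2 : ‖(2 : ℚ_[p])‖ ≤ 1 := by exact_mod_cast Padic.norm_int_le_one 2
  have : ‖(2 : ℚ_[p])‖ ^ 2 ≤ 1 := pow_le_one₀ (norm_nonneg _) h2
  nlinarith [sq_nonneg ‖r‖]

/-- The trace bound applied to `x ȳ` controls the cross term by `|nm x||nm y|`, as a Cauchy–Schwarz
inequality would. This makes the reduced norm a valuation. -/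
theorem norm_nm_add_le (hdiv : ∀ x : A, x ≠ 0 → IsUnit x) (x y : A) :
    ‖Q.nm (x + y)‖ ≤ max ‖Q.nm x‖ ‖Q.nm y‖ := by
  rw [nm_add, ← Q.tr_mul_conj]
  refine (IsUltrametricDist.norm_add_le_max _ _).trans (max_le
    (IsUltrametricDist.norm_add_le_max _ _) ?_)
  have h := Q.norm_tr_sq_le hdiv (x * Q.conj y)
  rw [map_mul Q.nm, nm_conj, norm_mul] at h
  have h0 : 0 ≤ max ‖Q.nm x‖ ‖Q.nm y‖ := le_max_of_le_left (norm_nonneg _)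
  refine le_of_sq_le_sq ?_ h0
  calc _ ≤ _ := h
    _ ≤ max ‖Q.nm x‖ ‖Q.nm y‖ * max ‖Q.nm x‖ ‖Q.nm y‖ :=
      mul_le_mul (le_max_left _ _) (le_max_right _ _) (norm_nonneg _) h0
    _ = _ := by ring

theorem norm_nm_add_lt (hdiv : ∀ x : A, x ≠ 0 → IsUnit x) {x y : A} {c : ℝ} (hx : ‖Q.nm x‖ < c)
    (hy : ‖Q.nm y‖ < c) : ‖Q.nm (x + y)‖ < c :=
  (Q.norm_nm_add_le hdiv x y).trans_lt (max_lt hx hy)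

theorem norm_nm_smul (c : ℚ_[p]) (x : A) : ‖Q.nm (c • x)‖ = ‖c‖ ^ 2 * ‖Q.nm x‖ := by
  rw [nm_smul, norm_mul, norm_pow]

variable [Algebra ℤ_[p] A] [IsScalarTower ℤ_[p] ℚ_[p] A]

theorem norm_nm_smul_le (c : ℤ_[p]) (x : A) : ‖Q.nm (c • x)‖ ≤ ‖Q.nm x‖ := by
  rw [← IsScalarTower.algebraMap_smul ℚ_[p] c x, norm_nm_smul]
  have : ‖algebraMap ℤ_[p] ℚ_[p] c‖ ^ 2 ≤ 1 := pow_le_one₀ (norm_nonneg _) c.2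
  nlinarith [norm_nonneg (Q.nm x)]

theorem exists_norm_nm_le_of_fg (hdiv : ∀ x : A, x ≠ 0 → IsUnit x) {N : Submodule ℤ_[p] A}
    (hN : N.FG) : ∃ C, ∀ x ∈ N, ‖Q.nm x‖ ≤ C := by
  obtain ⟨S, rfl⟩ := hN
  refine ⟨∑ s ∈ S, ‖Q.nm s‖, fun x hx => ?_⟩
  induction hx using Submodule.span_induction with
  | mem x h => exact Finset.single_le_sum (f := fun s => ‖Q.nm s‖) (fun _ _ => norm_nonneg _) h
  | zero => rw [nm_zero, norm_zero]; exact Finset.sum_nonneg fun _ _ => norm_nonneg _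
  | add x y _ _ hx hy => exact (Q.norm_nm_add_le hdiv x y).trans (max_le hx hy)
  | smul c x _ hx => exact (Q.norm_nm_smul_le c x).trans hx

theorem norm_nm_le_one_of_pow_mem (hdiv : ∀ x : A, x ≠ 0 → IsUnit x) {N : Submodule ℤ_[p] A}
    (hN : N.FG) {x : A} (hx : ∀ n : ℕ, x ^ n ∈ N) : ‖Q.nm x‖ ≤ 1 := by
  by_contra! h
  obtain ⟨C, hC⟩ := Q.exists_norm_nm_le_of_fg hdiv hN
  obtain ⟨n, hn⟩ := pow_unbounded_of_one_lt C h
  have := hC _ (hx n)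
  rw [map_pow, norm_pow] at this
  linarith

/-- The valuation ring of a division quaternion algebra. -/
def integers (hdiv : ∀ x : A, x ≠ 0 → IsUnit x) : Subalgebra ℤ_[p] A where
  carrier := {x | ‖Q.nm x‖ ≤ 1}
  mul_mem' {x y} hx hy := by
    change ‖_‖ ≤ 1
    rw [map_mul, norm_mul]
    exact mul_le_one₀ hx (norm_nonneg _) hy
  add_mem' {x y} hx hy := (Q.norm_nm_add_le hdiv x y).trans (max_le hx hy)
  algebraMap_mem' c := by
    change ‖_‖ ≤ 1
    rw [Algebra.algebraMap_eq_smul_one]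
    refine (Q.norm_nm_smul_le c 1).trans ?_
    rw [map_one, norm_one]

theorem mem_integers {hdiv : ∀ x : A, x ≠ 0 → IsUnit x} {x : A} :
    x ∈ Q.integers hdiv ↔ ‖Q.nm x‖ ≤ 1 := Iff.rfl

theorem le_integers (hdiv : ∀ x : A, x ≠ 0 → IsUnit x) {S : Subalgebra ℤ_[p] A}
    (hS : (Subalgebra.toSubmodule S).FG) : S ≤ Q.integers hdiv :=
  fun _ hx => Q.norm_nm_le_one_of_pow_mem hdiv hS fun n => S.pow_mem hx n

/-- Pairing with generators of a given order through the trace embeds the valuation ring in a finite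
free `ℤ_p`-module, injectively because the trace form is nondegenerate. Finite generation follows
since `ℤ_p` is Noetherian. -/
theorem isLattice_integers (hdiv : ∀ x : A, x ≠ 0 → IsUnit x) {S : Subalgebra ℤ_[p] A}
    (hS : Submodule.IsLattice ℚ_[p] (Subalgebra.toSubmodule S)) :
    Submodule.IsLattice ℚ_[p] (Subalgebra.toSubmodule (Q.integers hdiv)) := by
  have hle := Q.le_integers hdiv hS.fg
  refine ⟨?_, ?_⟩
  · obtain ⟨T, hT⟩ := hS.fg
    have hTR : ∀ s ∈ T, s ∈ Q.integers hdiv := fun s hs => hle (by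
      rw [← Subalgebra.mem_toSubmodule, ← hT]; exact Submodule.subset_span hs)
    have hint : ∀ x ∈ Q.integers hdiv, ‖Q.tr x‖ ≤ 1 := fun x hx => by
      have := (Q.norm_tr_sq_le hdiv x).trans hx
      exact (sq_le_one_iff₀ (norm_nonneg _)).1 this
    let f : Subalgebra.toSubmodule (Q.integers hdiv) →ₗ[ℤ_[p]] (T → ℤ_[p]) :=
      { toFun := fun x s => ⟨Q.tr (x * s), hint _ (mul_mem x.2 (hTR s s.2))⟩
        map_add' := fun x y => by
          funext s; apply Subtype.ext
          change Q.tr (((x : A) + y) * s) = Q.tr (x * s) + Q.tr (y * s)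
          rw [add_mul, map_add]
        map_smul' := fun c x => by
          funext s; apply Subtype.ext
          change Q.tr ((c • (x : A)) * s) = c * Q.tr (x * s)
          rw [smul_mul_assoc, ← IsScalarTower.algebraMap_smul ℚ_[p] c, map_smul]
          rfl }
    have hf : Function.Injective f := by
      rw [← LinearMap.ker_eq_bot, LinearMap.ker_eq_bot']
      intro x hx
      apply Subtype.ext
      apply Q.nondegenerate
      have h1 : ∀ y ∈ (T : Set A), Q.tr (x * y) = 0 := fun y hy =>
        congrArg Subtype.val (congrFun hx ⟨y, hy⟩)
      intro y
      have hy : y ∈ Submodule.span ℚ_[p] (T : Set A) := by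
        rw [← Submodule.span_span_of_tower ℤ_[p], hT, hS.span_eq_top]
        exact Submodule.mem_top
      induction hy using Submodule.span_induction with
      | mem y h => exact h1 y h
      | zero => simp
      | add y z _ _ hy hz => rw [mul_add, map_add, hy, hz, add_zero]
      | smul c y _ hy => rw [mul_smul_comm, map_smul, hy, smul_zero]
    have := Module.Finite.of_injective f hf
    exact (Module.Finite.iff_fg).1 this
  · rw [eq_top_iff, ← hS.span_eq_top]
    exact Submodule.span_mono hle

/-- Powers of an element of an order stay bounded, so every order lies in the valuation ring; the
maximal order is therefore unique. -/
theorem eq_integers_of_isMaximalOrder (hdiv : ∀ x : A, x ≠ 0 → IsUnit x) {R : Subalgebra ℤ_[p] A}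
    (hR : IsMaximalOrder p R) : R = Q.integers hdiv :=
  hR.eq_of_le (Q.isLattice_integers hdiv hR.prop) (Q.le_integers hdiv hR.prop.fg)

/-- The maximal ideal of the valuation ring. -/
def maxIdeal (hdiv : ∀ x : A, x ≠ 0 → IsUnit x) : Ideal (Q.integers hdiv) where
  carrier := {x | ‖Q.nm (x : A)‖ < 1}
  zero_mem' := by
    change ‖Q.nm ((0 : Q.integers hdiv) : A)‖ < 1
    simp [nm_zero]
  add_mem' {x y} hx hy := Q.norm_nm_add_lt hdiv hx hy
  smul_mem' c x hx := by
    change ‖Q.nm ((c * x : Q.integers hdiv) : A)‖ < 1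
    have h1 := c.2
    rw [mem_integers] at h1
    change ‖Q.nm (x : A)‖ < 1 at hx
    push_cast
    rw [map_mul, norm_mul]
    exact mul_lt_one_of_nonneg_of_lt_one_right h1 (norm_nonneg _) hx

theorem mem_maxIdeal {hdiv : ∀ x : A, x ≠ 0 → IsUnit x} {x : Q.integers hdiv} :
    x ∈ Q.maxIdeal hdiv ↔ ‖Q.nm (x : A)‖ < 1 := Iff.rfl

theorem eq_maxIdeal (hdiv : ∀ x : A, x ≠ 0 → IsUnit x) {P : Ideal (Q.integers hdiv)}
    (hP : Maximal (fun J : Ideal (Q.integers hdiv) => J.IsTwoSided ∧ J ≠ ⊤) P) :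
    P = Q.maxIdeal hdiv := by
  refine hP.eq_of_le ⟨⟨?_⟩, ?_⟩ ?_
  · intro x c hx
    rw [mem_maxIdeal] at hx ⊢
    have h1 := c.2
    rw [mem_integers] at h1
    push_cast
    rw [map_mul, norm_mul]
    exact mul_lt_one_of_nonneg_of_lt_one_left (norm_nonneg _) hx h1
  · rw [Ne, Ideal.eq_top_iff_one, mem_maxIdeal]
    simp
  · intro x hx
    rw [mem_maxIdeal]
    by_contra! h
    have h1 : ‖Q.nm (x : A)‖ = 1 := le_antisymm x.2 h
    have h0 : Q.nm (x : A) ≠ 0 := by rw [← norm_ne_zero_iff, h1]; exact one_ne_zero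
    apply hP.prop.2
    rw [Ideal.eq_top_iff_one]
    have hy : (Q.nm (x : A))⁻¹ • Q.conj (x : A) ∈ Q.integers hdiv := by
      rw [mem_integers, norm_nm_smul, nm_conj, norm_inv, h1]; simp
    have := P.mul_mem_left ⟨_, hy⟩ hx
    convert this
    apply Subtype.ext
    simp only [Subalgebra.coe_mul, Subalgebra.coe_one, smul_mul_assoc, conj_mul,
      Algebra.algebraMap_eq_smul_one, smul_smul, inv_mul_cancel₀ h0, one_smul]

end ReducedForm

end Division

section Division

variable {p : ℕ} [Fact p.Prime] {A : Type*} [Ring A] [Algebra ℚ_[p] A] [Algebra ℤ_[p] A]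
  [IsScalarTower ℤ_[p] ℚ_[p] A]
  {E : IntermediateField ℚ_[p] (AlgebraicClosure ℚ_[p])} {r : ℕ} {Λ : Submodule ℤ_[p] A}

namespace ReducedForm

variable (Q : ReducedForm ℚ_[p] A) {hdiv : ∀ x : A, x ≠ 0 → IsUnit x}

theorem norm_nm_le_one_of_isIntegral (hdiv : ∀ x : A, x ≠ 0 → IsUnit x) (ι : E →ₐ[ℚ_[p]] A) {e : E}
    (he : IsIntegral ℤ_[p] e) : ‖Q.nm (ι e)‖ ≤ 1 := by
  refine Q.norm_nm_le_one_of_pow_mem hdiv (N := (Subalgebra.toSubmodule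
    (Algebra.adjoin ℤ_[p] {e})).map (ι.restrictScalars ℤ_[p]).toLinearMap)
    (he.fg_adjoin_singleton.map _) fun n => ?_
  exact ⟨e ^ n, pow_mem (Algebra.self_mem_adjoin_singleton _ _) n, by simp⟩

/-- The order `𝔬_E + 𝔓 ^ (r - 1)`. -/
def basicOrder (hdiv : ∀ x : A, x ≠ 0 → IsUnit x) (ι : E →ₐ[ℚ_[p]] A) (r : ℕ) :
    Submodule ℤ_[p] A :=
  (Subalgebra.toSubmodule (integralClosure ℤ_[p] E)).map
      (ι.restrictScalars ℤ_[p]).toLinearMap ⊔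
    ((Q.maxIdeal hdiv ^ (r - 1)).restrictScalars ℤ_[p]).map (Q.integers hdiv).val.toLinearMap

theorem exists_eq_basicOrder (hdiv : ∀ x : A, x ≠ 0 → IsUnit x) (h : IsBasicOrder p E r Λ) :
    1 ≤ r ∧ ∃ ι : E →ₐ[ℚ_[p]] A, Λ = Q.basicOrder hdiv ι r := by
  obtain ⟨hr, ι, R, P, hR, hP, rfl⟩ := h
  obtain rfl := Q.eq_integers_of_isMaximalOrder hdiv hR
  obtain rfl := Q.eq_maxIdeal hdiv hP
  exact ⟨hr, ι, rfl⟩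

theorem map_mem_basicOrder (ι : E →ₐ[ℚ_[p]] A) (r : ℕ) {e : E} (he : IsIntegral ℤ_[p] e) :
    ι e ∈ Q.basicOrder hdiv ι r :=
  Submodule.mem_sup_left ⟨e, he, rfl⟩

theorem one_mem_basicOrder (ι : E →ₐ[ℚ_[p]] A) (r : ℕ) : 1 ∈ Q.basicOrder hdiv ι r := by
  simpa using Q.map_mem_basicOrder (hdiv := hdiv) ι r (e := 1) isIntegral_one

theorem mem_basicOrder_one (ι : E →ₐ[ℚ_[p]] A) {x : A} (hx : ‖Q.nm x‖ ≤ 1) :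
    x ∈ Q.basicOrder hdiv ι 1 :=
  Submodule.mem_sup_right ⟨⟨x, hx⟩, by
    change (⟨x, hx⟩ : Q.integers hdiv) ∈ (1 : Ideal (Q.integers hdiv))
    rw [Submodule.one_eq_span]
    exact Submodule.mem_span_singleton.2 ⟨⟨x, hx⟩, by simp⟩, rfl⟩

theorem mem_basicOrder_two (ι : E →ₐ[ℚ_[p]] A) {x : A} (hx : ‖Q.nm x‖ < 1) :
    x ∈ Q.basicOrder hdiv ι 2 :=
  Submodule.mem_sup_right ⟨⟨x, hx.le⟩, by
    change (⟨x, hx.le⟩ : Q.integers hdiv) ∈ Q.maxIdeal hdiv ^ 1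
    rw [Submodule.pow_one]
    exact hx, rfl⟩

theorem norm_nm_le_one_of_mem_basicOrder {ι : E →ₐ[ℚ_[p]] A} {x : A}
    (hx : x ∈ Q.basicOrder hdiv ι r) : ‖Q.nm x‖ ≤ 1 := by
  obtain ⟨_, ⟨e, he, rfl⟩, _, ⟨y, -, rfl⟩, rfl⟩ := Submodule.mem_sup.1 hx
  exact (Q.norm_nm_add_le hdiv _ _).trans
    (max_le (Q.norm_nm_le_one_of_isIntegral hdiv ι he) y.2)

theorem norm_natCast_p : ‖(p : ℚ_[p])‖ < 1 := by exact_mod_cast Padic.norm_p_lt_one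

theorem norm_le_of_lt_one {c : ℚ_[p]} (hc : ‖c‖ < 1) : ‖c‖ ≤ ‖(p : ℚ_[p])‖ := by
  have h := (PadicInt.norm_lt_one_iff_dvd (⟨c, hc.le⟩ : ℤ_[p])).1 hc
  obtain ⟨d, hd⟩ := h
  have : c = p * d := by simpa using congrArg ((↑) : ℤ_[p] → ℚ_[p]) hd
  rw [this, norm_mul]
  exact mul_le_of_le_one_right (norm_nonneg _) d.2

theorem p_ne_zero : (p : ℚ_[p]) ≠ 0 := by exact_mod_cast (Fact.out : p.Prime).ne_zero

/-- Products of two elements of the maximal ideal are divisible by `p`. -/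
theorem maxIdeal_sq_le {x : Q.integers hdiv} (hx : x ∈ Q.maxIdeal hdiv ^ 2) :
    ∃ y : A, ‖Q.nm y‖ ≤ 1 ∧ (x : A) = (p : ℚ_[p]) • y := by
  let J : Ideal (Q.integers hdiv) :=
    { carrier := {x | ∃ y : A, ‖Q.nm y‖ ≤ 1 ∧ (x : A) = (p : ℚ_[p]) • y}
      zero_mem' := ⟨0, by simp [Q.nm_zero], by simp⟩
      add_mem' := by
        rintro a b ⟨y, hy, ha⟩ ⟨z, hz, hb⟩
        exact ⟨y + z, (Q.norm_nm_add_le hdiv _ _).trans (max_le hy hz), by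
          push_cast; rw [ha, hb, smul_add]⟩
      smul_mem' := by
        rintro c a ⟨y, hy, ha⟩
        refine ⟨c * y, ?_, ?_⟩
        · rw [map_mul, norm_mul]
          exact mul_le_one₀ c.2 (norm_nonneg _) hy
        · simp only [smul_eq_mul, Subalgebra.coe_mul, ha, mul_smul_comm] }
  have hJ : Q.maxIdeal hdiv ^ 2 ≤ J := by
    rw [show 2 = 1 + 1 from rfl, Submodule.pow_succ, Submodule.pow_one, Submodule.mul_le]
    intro a ha b hb
    refine ⟨(p : ℚ_[p])⁻¹ • (a * b : A), ?_, ?_⟩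
    · rw [Q.norm_nm_smul, map_mul, norm_mul, norm_inv]
      have h1 := norm_le_of_lt_one ha
      have h2 := norm_le_of_lt_one hb
      have h0 : 0 < ‖(p : ℚ_[p])‖ := norm_pos_iff.2 p_ne_zero
      rw [inv_pow, inv_mul_le_iff₀ (by positivity), mul_one, sq]
      exact mul_le_mul h1 h2 (norm_nonneg _) h0.le
    · rw [smul_smul, mul_inv_cancel₀ p_ne_zero, one_smul]; rfl
  exact hJ hx

/-- For `r ≥ 3` the exponent `r - 1` is at least 2, and `𝔓²` is contained in `p` times the maximal
order. -/
theorem exists_of_mem_basicOrder_of_three_le (hr : 3 ≤ r) {ι : E →ₐ[ℚ_[p]] A} {x : A}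
    (hx : x ∈ Q.basicOrder hdiv ι r) : ∃ (e : E) (y : A), IsIntegral ℤ_[p] e ∧ ‖Q.nm y‖ ≤ 1 ∧
      x = ι e + (p : ℚ_[p]) • y := by
  obtain ⟨_, ⟨e, he, rfl⟩, _, ⟨z, hz, rfl⟩, rfl⟩ := Submodule.mem_sup.1 hx
  obtain ⟨y, hy, hzy⟩ := Q.maxIdeal_sq_le (Ideal.pow_le_pow_right (show 2 ≤ r - 1 by omega) hz)
  exact ⟨e, y, he, hy, by rw [← hzy]; rfl⟩

/-- This serves to contradict minimality of the level: an order that turns out to be maximal also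
has level exponent 1, with the same `E`. -/
theorem isBasicOrder_one (hdiv : ∀ x : A, x ≠ 0 → IsUnit x) (h : IsBasicOrder p E r Λ)
    (hΛ : ∀ x : A, ‖Q.nm x‖ ≤ 1 → x ∈ Λ) : IsBasicOrder p E 1 Λ := by
  obtain ⟨-, ι', hι⟩ := Q.exists_eq_basicOrder hdiv h
  obtain ⟨hr, ι, R, P, hR, hP, h⟩ := h
  refine ⟨le_rfl, ι, R, P, hR, hP, ?_⟩
  obtain rfl := Q.eq_integers_of_isMaximalOrder hdiv hR
  obtain rfl := Q.eq_maxIdeal hdiv hP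
  apply le_antisymm
  · intro x hx
    rw [hι] at hx
    exact Q.mem_basicOrder_one ι (Q.norm_nm_le_one_of_mem_basicOrder hx)
  · intro x hx
    exact hΛ x (Q.norm_nm_le_one_of_mem_basicOrder (r := 1) hx)

end ReducedForm

/-! ### Unramified extensions of `ℚ_p` -/

/-- The quotient of the ring of integers by `p` is unramified over the residue field, hence reduced.
-/
theorem IsUnramifiedExt.dvd_of_dvd_sq [FiniteDimensional ℚ_[p] E] (h : IsUnramifiedExt p E)
    {x : integralClosure ℤ_[p] E} (hx : (p : integralClosure ℤ_[p] E) ∣ x ^ 2) :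
    (p : integralClosure ℤ_[p] E) ∣ x := by
  let S := integralClosure ℤ_[p] E
  have : Algebra.FormallyUnramified ℤ_[p] S := h
  have : Module.Finite ℤ_[p] S := IsIntegralClosure.finite ℤ_[p] ℚ_[p] E S
  let m := IsLocalRing.maximalIdeal ℤ_[p]
  let mS : Ideal S := m.map (algebraMap ℤ_[p] S)
  let : Field (ℤ_[p] ⧸ m) := Ideal.Quotient.field m
  have : Algebra.FormallyUnramified (ℤ_[p] ⧸ m) (S ⧸ mS) := .of_restrictScalars ℤ_[p] _ _
  have : Algebra.EssFiniteType (ℤ_[p] ⧸ m) (S ⧸ mS) := .of_comp ℤ_[p] _ _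
  have : IsReduced (S ⧸ mS) :=
    Algebra.FormallyUnramified.isReduced_of_field (ℤ_[p] ⧸ m) (S ⧸ mS)
  have hmS : mS = Ideal.span {(p : S)} := by
    simp only [mS, m, PadicInt.maximalIdeal_eq_span_p, Ideal.map_span, Set.image_singleton,
      map_natCast]
  have key : ∀ y : S, (p : S) ∣ y ↔ Ideal.Quotient.mk mS y = 0 := fun y => by
    rw [Ideal.Quotient.eq_zero_iff_mem, hmS, Ideal.mem_span_singleton]
  rw [key] at hx ⊢
  rw [map_pow] at hx
  exact pow_eq_zero_iff two_ne_zero |>.1 hx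

end Division

/-! ### Squares among the units of `ℤ_p` -/

section Padic

variable {p : ℕ} [Fact p.Prime]

theorem norm_two_eq_one (hp : p ≠ 2) : ‖(2 : ℚ_[p])‖ = 1 := by
  have : ¬ ‖((2 : ℤ) : ℚ_[p])‖ < 1 := by
    rw [Padic.norm_intCast_lt_one_iff]
    intro h
    have h : p ∣ 2 := by exact_mod_cast h
    exact hp ((Nat.prime_dvd_prime_iff_eq Fact.out Nat.prime_two).1 h)
  have h2 : ‖((2 : ℤ) : ℚ_[p])‖ ≤ 1 := Padic.norm_int_le_one 2
  simpa using le_antisymm h2 (not_lt.1 this)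

theorem PadicInt.not_isSquareMod {p : ℕ} [Fact p.Prime] (hp : p ≠ 2) {u : ℤ_[p]} (hu : ‖u‖ = 1)
    (h : ¬ IsSquare u) {m : ℤ} (hm : (p : ℤ_[p]) ∣ u - m) : ¬ IsSquareMod (p : ℤ) m := by
  rintro ⟨a, ha⟩
  apply h
  have h1 : (p : ℤ_[p]) ∣ (a : ℤ_[p]) ^ 2 - u := by
    rw [← PadicInt.p_dvd_intCast_iff] at ha
    push_cast at ha
    have := dvd_sub ha hm
    convert this using 1; ring
  have h2 : ‖(a : ℤ_[p])‖ = 1 := by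
    by_contra hne
    have : (p : ℤ_[p]) ∣ a := (PadicInt.norm_lt_one_iff_dvd _).1
      (lt_of_le_of_ne (PadicInt.norm_le_one _) hne)
    have : (p : ℤ_[p]) ∣ u := by
      have := dvd_sub (this.mul_left a) h1
      convert this using 1; ring
    rw [← PadicInt.norm_lt_one_iff_dvd] at this
    exact this.ne hu
  refine PadicInt.isSquare_of_norm_lt (a := a) ?_
  have h3 : ‖(2 : ℤ_[p])‖ = 1 := norm_two_eq_one hp
  rw [norm_mul, h2, h3]
  simpa using (PadicInt.norm_lt_one_iff_dvd _).2 h1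

/-- The product of two nonsquare units of `ℤ_p` is a square for odd `p`. -/
theorem PadicInt.isSquare_mul (hp : p ≠ 2) {u v : ℤ_[p]} (hu : ‖u‖ = 1) (hv : ‖v‖ = 1)
    (hu' : ¬ IsSquare u) (hv' : ¬ IsSquare v) : IsSquare (v * u) := by
  by_contra h
  obtain ⟨m, hm⟩ := PadicInt.exists_int_dvd_sub u
  obtain ⟨n, hn⟩ := PadicInt.exists_int_dvd_sub v
  have aux : ∀ {u : ℤ_[p]} {m : ℤ}, ‖u‖ = 1 → (p : ℤ_[p]) ∣ u - m → ¬ (p : ℤ) ∣ m := by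
    intro u m hu hm hd
    rw [← PadicInt.p_dvd_intCast_iff] at hd
    have : (p : ℤ_[p]) ∣ u := by simpa using dvd_add hm hd
    rw [← PadicInt.norm_lt_one_iff_dvd] at this
    exact this.ne hu
  rcases isSquareMod_or_mul (aux hu hm) (aux hv hn) (not_isSquareMod hp hv hv' hn) with h1 | h1
  · exact not_isSquareMod hp hu hu' hm h1
  · refine not_isSquareMod hp (by rw [norm_mul, hu, hv, one_mul]) h (m := n * m) ?_ h1
    push_cast
    have := dvd_add (hn.mul_right u) (hm.mul_left (n : ℤ_[p]))
    convert this using 1; ring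

theorem PadicInt.two_dvd_mul_succ (s : ℤ_[2]) : (2 : ℤ_[2]) ∣ s * (s + 1) := by
  obtain ⟨m, r, hm⟩ := PadicInt.exists_int_dvd_sub s
  obtain ⟨k, hk⟩ := (Int.even_mul_succ_self m).two_dvd
  push_cast at hm
  have hk' : (m : ℤ_[2]) * (m + 1) = 2 * k := by exact_mod_cast congrArg (Int.cast : ℤ → ℤ_[2]) hk
  exact ⟨k + r * (s + m + 1), by linear_combination (s + m + 1) * hm + hk'⟩

theorem PadicInt.isSquare_of_eight_dvd {u : ℤ_[2]} (h : (8 : ℤ_[2]) ∣ 1 - u) : IsSquare u := by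
  refine PadicInt.isSquare_of_norm_lt (a := 1) ?_
  obtain ⟨c, hc⟩ := h
  have h2 : ‖(2 : ℤ_[2])‖ < 1 := by
    have := (PadicInt.norm_lt_one_iff_dvd (p := 2) 2).2 (by simp); simpa using this
  have h0 : 0 < ‖(2 : ℤ_[2])‖ := norm_pos_iff.2 two_ne_zero
  rw [one_pow, hc, mul_one, norm_mul, show (8 : ℤ_[2]) = 2 ^ 3 by norm_num, norm_pow]
  have := PadicInt.norm_le_one c
  calc ‖(2 : ℤ_[2])‖ ^ 3 * ‖c‖ ≤ ‖(2 : ℤ_[2])‖ ^ 3 := mul_le_of_le_one_right (by positivity) this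
    _ < ‖(2 : ℤ_[2])‖ ^ 2 := pow_lt_pow_right_of_lt_one₀ h0 h2 (by norm_num)

/-- The product of `-3` and a nonsquare unit discriminant is a square in `ℤ_2`. -/
theorem PadicInt.isSquare_neg_three_mul {T n : ℤ_[2]} (h1 : ‖T ^ 2 - 4 * n‖ = 1)
    (h2 : ¬ IsSquare (T ^ 2 - 4 * n)) : IsSquare (-3 * (T ^ 2 - 4 * n)) := by
  have hT : (8 : ℤ_[2]) ∣ T ^ 2 - 1 := by
    obtain ⟨m, r, hm⟩ := PadicInt.exists_int_dvd_sub T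
    push_cast at hm
    rcases Int.even_or_odd m with ⟨k, rfl⟩ | ⟨k, rfl⟩
    · exfalso
      have : ((2 : ℕ) : ℤ_[2]) ∣ T ^ 2 - 4 * n := by
        push_cast at hm ⊢
        have hT : T = 2 * (k + r) := by linear_combination hm
        exact ⟨2 * (k + r) ^ 2 - 2 * n, by rw [hT]; ring⟩
      rw [← PadicInt.norm_lt_one_iff_dvd] at this
      exact this.ne h1
    · push_cast at hm
      have hT : T = 2 * (k + r) + 1 := by linear_combination hm
      obtain ⟨c, hc⟩ := PadicInt.two_dvd_mul_succ (k + r : ℤ_[2])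
      exact ⟨c, by rw [hT]; linear_combination 4 * hc⟩
  obtain ⟨c, hc⟩ := hT
  obtain ⟨m, r, hm⟩ := PadicInt.exists_int_dvd_sub n
  push_cast at hm
  -- Since `T² ≡ 1` modulo 8, the discriminant is `1` or `5` modulo 8 according to the parity of
  -- `n`. The first is a square; in the second case `-3 · 5 ≡ 1`.
  rcases Int.even_or_odd m with ⟨k, rfl⟩ | ⟨k, rfl⟩
  · refine absurd (PadicInt.isSquare_of_eight_dvd ⟨k + r - c, ?_⟩) h2
    push_cast at hm
    linear_combination -hc + 4 * hm
  · refine PadicInt.isSquare_of_eight_dvd ⟨3 * c - 1 - 3 * (k + r) , ?_⟩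
    push_cast at hm
    linear_combination 3 * hc - 12 * hm

end Padic

/-! ### Unramified quadratic subfields of a division quaternion algebra -/

section Unramified

variable {p : ℕ} [Fact p.Prime] {A : Type*} [Ring A] [Algebra ℚ_[p] A] [Algebra ℤ_[p] A]
  [IsScalarTower ℤ_[p] ℚ_[p] A] (Q : ReducedForm ℚ_[p] A)
  {E : IntermediateField ℚ_[p] (AlgebraicClosure ℚ_[p])}

open Polynomial in
theorem isIntegral_of_quadratic {p : ℕ} [Fact p.Prime] {S : Type*} [CommRing S] [Algebra ℚ_[p] S]
    [Algebra ℤ_[p] S] [IsScalarTower ℤ_[p] ℚ_[p] S] {v : S} {t n : ℚ_[p]} (ht : ‖t‖ ≤ 1)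
    (hn : ‖n‖ ≤ 1) (h : v ^ 2 = algebraMap ℚ_[p] S t * v - algebraMap ℚ_[p] S n) :
    IsIntegral ℤ_[p] v := by
  obtain ⟨t, rfl⟩ : ∃ t' : ℤ_[p], (t' : ℚ_[p]) = t := ⟨⟨t, ht⟩, rfl⟩
  obtain ⟨n, rfl⟩ : ∃ n' : ℤ_[p], (n' : ℚ_[p]) = n := ⟨⟨n, hn⟩, rfl⟩
  refine ⟨X ^ 2 - (C t * X - C n), ?_, ?_⟩
  · refine Polynomial.monic_X_pow_sub (n := 2) ?_
    refine lt_of_le_of_lt ?_ (by decide : (1 : WithBot ℕ) < 2)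
    compute_degree
  · have e : ∀ c : ℤ_[p], algebraMap ℤ_[p] S c = algebraMap ℚ_[p] S c := fun c =>
      IsScalarTower.algebraMap_apply ℤ_[p] ℚ_[p] S c
    simp [e, h]

namespace ReducedForm

include Q in
theorem injective (ι : E →ₐ[ℚ_[p]] A) : Function.Injective ι := by
  have : Nontrivial A := ⟨0, 1, fun h => by
    have := congrArg Q.nm h; rw [Q.nm_zero, map_one] at this; exact zero_ne_one this⟩
  exact (ι : E →+* A).injective

variable (hdiv : ∀ x : A, x ≠ 0 → IsUnit x) (ι : E →ₐ[ℚ_[p]] A)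

include hdiv in
theorem isIntegral_of_norm_nm_le_one {e : E} (h : ‖Q.nm (ι e)‖ ≤ 1) : IsIntegral ℤ_[p] e := by
  refine isIntegral_of_quadratic (t := Q.tr (ι e)) ?_ h (Q.injective ι ?_)
  · exact (sq_le_one_iff₀ (norm_nonneg _)).1 ((Q.norm_tr_sq_le hdiv _).trans h)
  · simp only [map_pow, map_sub, map_mul, AlgHom.commutes]
    rw [sq, Q.mul_self, Algebra.smul_def]

include hdiv in
/-- An integral element of an unramified extension whose reduced norm is divisible by `p` is
divisible by `p`. -/
theorem exists_eq_smul_of_unramified [FiniteDimensional ℚ_[p] E] (hE : IsUnramifiedExt p E) {e : E}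
    (h : ‖Q.nm (ι e)‖ < 1) : ∃ e' : E, IsIntegral ℤ_[p] e' ∧ e = (p : ℚ_[p]) • e' := by
  have he := Q.isIntegral_of_norm_nm_le_one hdiv ι h.le
  have hn := norm_le_of_lt_one h
  have ht : ‖Q.tr (ι e)‖ ≤ ‖(p : ℚ_[p])‖ := by
    refine norm_le_of_lt_one ((sq_lt_one_iff₀ (norm_nonneg _)).1 ?_)
    exact (Q.norm_tr_sq_le hdiv _).trans_lt h
  have key : ∀ {c : ℚ_[p]}, ‖c‖ ≤ ‖(p : ℚ_[p])‖ → ∃ d : ℤ_[p], c = p * d := by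
    intro c hc
    refine ⟨⟨c / p, ?_⟩, ?_⟩
    · rw [norm_div, div_le_one (norm_pos_iff.2 p_ne_zero)]; exact hc
    · field_simp [p_ne_zero (p := p)]
  obtain ⟨n, hn⟩ := key hn
  obtain ⟨t, ht⟩ := key ht
  let x : integralClosure ℤ_[p] E := ⟨e, he⟩
  have hx : (p : integralClosure ℤ_[p] E) ∣ x ^ 2 := by
    refine ⟨algebraMap _ _ t * x - algebraMap _ _ n, Subtype.ext (Q.injective ι ?_)⟩
    have e1 : ∀ c : ℤ_[p], ι (algebraMap ℤ_[p] E c) = algebraMap ℚ_[p] A c := fun c => by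
      rw [IsScalarTower.algebraMap_apply ℤ_[p] ℚ_[p] E c, ι.commutes]; rfl
    change ι (e ^ 2) = ι ((p : E) * (algebraMap ℤ_[p] E t * e - algebraMap ℤ_[p] E n))
    simp only [map_pow, map_mul, map_sub, e1, map_natCast]
    rw [sq, Q.mul_self, hn, ht, Algebra.smul_def, map_mul, map_mul, map_natCast]
    noncomm_ring
  obtain ⟨y, hy⟩ := hE.dvd_of_dvd_sq hx
  refine ⟨y, y.2, ?_⟩
  have := congrArg Subtype.val hy
  rw [Algebra.smul_def, map_natCast]
  exact this

-- A descent on the discriminant. If it is not a unit, some translate `x + c` has non-unit norm,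
-- hence equals `p` times an integral element because `E` is unramified. Passing to that element
-- divides the discriminant by `p²`, which can happen only finitely often since the discriminant is
-- nonzero.
include hdiv in
theorem exists_unit_disc [FiniteDimensional ℚ_[p] E] (hE : IsUnramifiedExt p E)
    (hE2 : Module.finrank ℚ_[p] E = 2) :
    ∃ x : E, (∀ c, x ≠ algebraMap ℚ_[p] E c) ∧ ‖Q.nm (ι x)‖ ≤ 1 ∧
      ‖Q.tr (ι x) ^ 2 - 4 * Q.nm (ι x)‖ = 1 := by
  have hp0 : 0 < ‖(p : ℚ_[p])‖ := norm_pos_iff.2 p_ne_zero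
  have hp1 : ‖(p : ℚ_[p])‖ < 1 := norm_natCast_p
  have hdisc_le : ∀ x : E, ‖Q.nm (ι x)‖ ≤ 1 → ‖Q.tr (ι x) ^ 2 - 4 * Q.nm (ι x)‖ ≤ 1 := by
    intro x hx
    rw [sub_eq_add_neg]
    refine (IsUltrametricDist.norm_add_le_max _ _).trans (max_le ?_ ?_)
    · rw [norm_pow]; exact (Q.norm_tr_sq_le hdiv _).trans hx
    · rw [norm_neg, norm_mul]
      exact mul_le_one₀ (by exact_mod_cast Padic.norm_int_le_one 4) (norm_nonneg _) hx
  -- The characteristic polynomial has a double root in the residue field. For odd `p` complete the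
  -- square; for `p = 2` the trace is even and an integer `c ≡ n` works because `c² ≡ c`.
  have shift : ∀ x : E, ‖Q.nm (ι x)‖ ≤ 1 → ‖Q.tr (ι x) ^ 2 - 4 * Q.nm (ι x)‖ < 1 →
      ∃ c : ℚ_[p], ‖Q.nm (ι x) + c * Q.tr (ι x) + c ^ 2‖ < 1 := by
    intro x hx hd
    generalize Q.tr (ι x) = T at *
    generalize Q.nm (ι x) = n at *
    by_cases hp : p = 2
    · subst hp
      have h2 : ‖(2 : ℚ_[2])‖ < 1 := by simpa using norm_natCast_p (p := 2)
      have hT : ‖T‖ < 1 := by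
        rw [← sq_lt_one_iff₀ (norm_nonneg _), ← norm_pow,
          show T ^ 2 = (T ^ 2 - 4 * n) + 4 * n by ring]
        refine (IsUltrametricDist.norm_add_le_max _ _).trans_lt (max_lt hd ?_)
        rw [show (4 : ℚ_[2]) * n = 2 * (2 * n) by ring, norm_mul, norm_mul]
        exact mul_lt_one_of_nonneg_of_lt_one_left (norm_nonneg _) h2
          (mul_le_one₀ h2.le (norm_nonneg _) hx)
      obtain ⟨m, hm⟩ := PadicInt.exists_int_dvd_sub (⟨n, hx⟩ : ℤ_[2])
      rw [← PadicInt.norm_lt_one_iff_dvd] at hm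
      replace hm : ‖n - m‖ < 1 := hm
      refine ⟨m, ?_⟩
      rw [show n + m * T + (m : ℚ_[2]) ^ 2 = (n - m) + (m * T + (((m * (m + 1) : ℤ)) : ℚ_[2])) by
        push_cast; ring]
      refine (IsUltrametricDist.norm_add_le_max _ _).trans_lt (max_lt hm ?_)
      refine (IsUltrametricDist.norm_add_le_max _ _).trans_lt (max_lt ?_ ?_)
      · rw [norm_mul]
        exact mul_lt_one_of_nonneg_of_lt_one_right (Padic.norm_int_le_one m) (norm_nonneg _) hT
      · rw [Padic.norm_intCast_lt_one_iff]
        exact_mod_cast (Int.even_mul_succ_self m).two_dvd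
    · refine ⟨-T / 2, ?_⟩
      have h4 : ‖(4 : ℚ_[p])‖ = 1 := by
        rw [show (4 : ℚ_[p]) = 2 * 2 by norm_num, norm_mul, norm_two_eq_one hp, one_mul]
      rw [show n + -T / 2 * T + (-T / 2) ^ 2 = -(T ^ 2 - 4 * n) / 4 by ring, norm_div, norm_neg, h4,
        div_one]
      exact hd
  have main : ∀ (k : ℕ) (x : E), (∀ c, x ≠ algebraMap ℚ_[p] E c) → ‖Q.nm (ι x)‖ ≤ 1 →
      ‖(p : ℚ_[p])‖ ^ k ≤ ‖Q.tr (ι x) ^ 2 - 4 * Q.nm (ι x)‖ →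
      ∃ x : E, (∀ c, x ≠ algebraMap ℚ_[p] E c) ∧ ‖Q.nm (ι x)‖ ≤ 1 ∧
        ‖Q.tr (ι x) ^ 2 - 4 * Q.nm (ι x)‖ = 1 := by
    intro k
    induction k with
    | zero =>
      intro x hx hn hd
      exact ⟨x, hx, hn, le_antisymm (hdisc_le x hn) (by simpa using hd)⟩
    | succ k ih =>
      intro x hx hn hd
      rcases (hdisc_le x hn).lt_or_eq with hlt | heq
      swap
      · exact ⟨x, hx, hn, heq⟩
      obtain ⟨c, hc⟩ := shift x hn hlt
      have hxc : ι (x + algebraMap _ _ c) = ι x + algebraMap _ _ c := by rw [map_add, ι.commutes]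
      obtain ⟨y, hy, hxy⟩ := Q.exists_eq_smul_of_unramified hdiv ι hE
        (e := x + algebraMap _ _ c) (by rw [hxc, Q.nm_add_algebraMap]; exact hc)
      have h1 : ι x + algebraMap _ _ c = (p : ℚ_[p]) • ι y := by rw [← hxc, hxy, map_smul]
      have h2 := congrArg Q.nm h1
      rw [Q.nm_add_algebraMap, Q.nm_smul] at h2
      have h3 := congrArg Q.tr h1
      rw [map_add, Q.tr_algebraMap, map_smul, smul_eq_mul] at h3
      refine ih y ?_ (Q.norm_nm_le_one_of_isIntegral hdiv ι hy) ?_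
      · rintro d rfl
        refine hx (p * d - c) ?_
        rw [eq_sub_of_add_eq hxy, map_sub, map_mul, Algebra.smul_def]
      · have h4 : Q.tr (ι x) ^ 2 - 4 * Q.nm (ι x)
            = p ^ 2 * (Q.tr (ι y) ^ 2 - 4 * Q.nm (ι y)) := by
          linear_combination (Q.tr (ι x) + 2 * c + p * Q.tr (ι y)) * h3 - 4 * h2
        rw [h4, norm_mul, norm_pow, pow_succ] at hd
        have h5 : ‖(p : ℚ_[p])‖ ^ k ≤ ‖(p : ℚ_[p])‖ * ‖Q.tr (ι y) ^ 2 - 4 * Q.nm (ι y)‖ := by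
          refine le_of_mul_le_mul_right ?_ hp0
          calc _ ≤ _ := hd
            _ = _ := by ring
        exact h5.trans (mul_le_of_le_one_left (norm_nonneg _) hp1.le)
  obtain ⟨x, hx⟩ : ∃ x : E, ∀ c, x ≠ algebraMap ℚ_[p] E c := by
    by_contra! h
    have : (⊥ : Subalgebra ℚ_[p] E) = ⊤ := by
      rw [eq_top_iff]; intro x _
      obtain ⟨c, rfl⟩ := h x
      exact Subalgebra.algebraMap_mem _ c
    rw [Subalgebra.bot_eq_top_iff_finrank_eq_one] at this
    omega
  -- A power of `p` makes an arbitrary nonscalar element integral, which starts the descent.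
  obtain ⟨k, hk⟩ : ∃ k : ℕ, ‖(p : ℚ_[p])‖ ^ k * ‖Q.nm (ι x)‖ < 1 := by
    obtain ⟨k, hk⟩ := exists_pow_lt_of_lt_one (show 0 < (1 + ‖Q.nm (ι x)‖)⁻¹ by positivity) hp1
    refine ⟨k, (mul_le_mul_of_nonneg_right hk.le (norm_nonneg _)).trans_lt ?_⟩
    rw [inv_mul_lt_iff₀ (by positivity)]
    linarith
  set y : E := (p : ℚ_[p]) ^ k • x with hy
  have hy1 : ∀ c, y ≠ algebraMap ℚ_[p] E c := by
    intro c hc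
    have hpk : (p : ℚ_[p]) ^ k ≠ 0 := pow_ne_zero k p_ne_zero
    refine hx (((p : ℚ_[p]) ^ k)⁻¹ * c) ?_
    rw [map_mul, ← hc, ← Algebra.smul_def, hy, smul_smul, inv_mul_cancel₀ hpk, one_smul]
  have hy2 : ‖Q.nm (ι y)‖ ≤ 1 := by
    rw [hy, map_smul, Q.norm_nm_smul, norm_pow, ← pow_mul, mul_comm, mul_comm k, pow_mul, sq]
    have : (‖(p : ℚ_[p])‖ * ‖(p : ℚ_[p])‖) ^ k ≤ ‖(p : ℚ_[p])‖ ^ k :=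
      pow_le_pow_left₀ (by positivity) (mul_le_of_le_one_left hp0.le hp1.le) k
    nlinarith [norm_nonneg (Q.nm (ι x))]
  have hy3 : Q.tr (ι y) ^ 2 - 4 * Q.nm (ι y) ≠ 0 := by
    intro h0
    refine hy1 (Q.tr (ι y) / 2) (Q.injective ι ?_)
    rw [ι.commutes]
    refine Q.eq_algebraMap_of_root hdiv ?_
    linear_combination -h0 / 4
  obtain ⟨j, hj⟩ := exists_pow_lt_of_lt_one (norm_pos_iff.2 hy3) hp1
  exact main j y hy1 hy2 hj.le

include Q hdiv ι in
/-- An unramified quadratic extension contains the roots of `X² - tX + 1` if this polynomial has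
unit discriminant and no root in `ℚ_p`. -/
theorem exists_root_of_unramified {t : ℤ} (ht : t = 0 ∨ t = 1) [FiniteDimensional ℚ_[p] E]
    (hE : IsUnramifiedExt p E) (hE2 : Module.finrank ℚ_[p] E = 2)
    (hD : ¬ (p : ℤ) ∣ t ^ 2 - 4) (hroot : ∀ r : ℚ_[p], r ^ 2 - t * r + 1 ≠ 0) :
    ∃ v : E, IsIntegral ℤ_[p] v ∧ v ^ 2 = algebraMap ℚ_[p] E t * v - 1 := by
  obtain ⟨x, hx, hn, hd⟩ := Q.exists_unit_disc hdiv ι hE hE2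
  have hT : ‖Q.tr (ι x)‖ ≤ 1 :=
    (sq_le_one_iff₀ (norm_nonneg _)).1 ((Q.norm_tr_sq_le hdiv _).trans hn)
  have hx2 : x ^ 2 = algebraMap _ _ (Q.tr (ι x)) * x - algebraMap _ _ (Q.nm (ι x)) := by
    apply Q.injective ι
    simp only [map_pow, map_sub, map_mul, AlgHom.commutes]
    rw [sq, Q.mul_self, Algebra.smul_def]
  have hns : ∀ s : ℚ_[p], s * s ≠ Q.tr (ι x) ^ 2 - 4 * Q.nm (ι x) := by
    intro s hs
    refine hx ((Q.tr (ι x) + s) / 2) (Q.injective ι ?_)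
    rw [ι.commutes]
    refine Q.eq_algebraMap_of_root hdiv ?_
    linear_combination hs / 4
  obtain ⟨T, hTeq⟩ : ∃ T : ℤ_[p], (T : ℚ_[p]) = Q.tr (ι x) := ⟨⟨_, hT⟩, rfl⟩
  obtain ⟨n, hneq⟩ : ∃ T : ℤ_[p], (T : ℚ_[p]) = Q.nm (ι x) := ⟨⟨_, hn⟩, rfl⟩
  rw [← hTeq, ← hneq] at hns hd hx2
  set d : ℤ_[p] := T ^ 2 - 4 * n with hdef
  have hcast : (d : ℚ_[p]) = (T : ℚ_[p]) ^ 2 - 4 * n := by rw [hdef]; push_cast; rfl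
  have hd1 : ‖d‖ = 1 := by rw [PadicInt.norm_def, hcast]; exact hd
  have hd2 : ¬ IsSquare d := by
    rintro ⟨s, hs⟩
    refine hns s ?_
    rw [← hcast, hs]; push_cast; rfl
  have hsq : IsSquare (((t ^ 2 - 4 : ℤ) : ℤ_[p]) * d) := by
    by_cases hp : p = 2
    · subst hp
      rcases ht with rfl | rfl
      · exact absurd (by norm_num) hD
      · have := PadicInt.isSquare_neg_three_mul hd1 hd2
        convert this using 2
        norm_num
    · refine PadicInt.isSquare_mul hp hd1 ?_ hd2 ?_
      · refine le_antisymm (PadicInt.norm_le_one _) (not_lt.1 fun h => hD ?_)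
        rwa [PadicInt.norm_int_lt_one_iff_dvd] at h
      · rintro ⟨s, hs⟩
        refine hroot ((t + s) / 2) ?_
        have : ((t : ℚ_[p]) ^ 2 - 4) = s * s := by
          have := congrArg ((↑) : ℤ_[p] → ℚ_[p]) hs
          push_cast at this
          exact this
        linear_combination -this / 4
  obtain ⟨s, hs⟩ := hsq
  have hd0 : (d : ℚ_[p]) ≠ 0 := by
    rw [← norm_ne_zero_iff, ← PadicInt.norm_def, hd1]; exact one_ne_zero
  have hs' : ((t : ℚ_[p]) ^ 2 - 4) * d = s * s := by
    have := congrArg ((↑) : ℤ_[p] → ℚ_[p]) hs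
    push_cast at this
    exact this
  -- As `2x - T` is a square root of `d` and `(t² - 4)d = s²`, this is a square root of `t² - 4`;
  -- the quadratic formula gives the root.
  let w : E := algebraMap _ _ ((s : ℚ_[p]) / d) * (2 * x - algebraMap _ _ (T : ℚ_[p]))
  have hw : w ^ 2 = algebraMap ℚ_[p] E ((t : ℚ_[p]) ^ 2 - 4) := by
    have e1 : (2 * x - algebraMap ℚ_[p] E (T : ℚ_[p])) ^ 2 = algebraMap _ _ (d : ℚ_[p]) := by
      rw [hcast]
      simp only [map_sub, map_pow, map_mul, map_ofNat]
      linear_combination 4 * hx2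
    simp only [w]
    rw [mul_pow, e1, ← map_pow, ← map_mul]
    congr 1
    field_simp
    linear_combination -hs'
  refine ⟨(algebraMap _ _ (t : ℚ_[p]) + w) / 2, ?_, ?_⟩
  · refine isIntegral_of_quadratic (t := t) (n := 1) (Padic.norm_int_le_one t) (by simp) ?_
    rw [map_one]
    rw [map_sub, map_pow, map_ofNat] at hw
    linear_combination hw / 4
  · rw [map_sub, map_pow, map_ofNat] at hw
    linear_combination hw / 4

end ReducedForm

end Unramified

section Division

variable {p : ℕ} [Fact p.Prime] {A : Type*} [Ring A] [Algebra ℚ_[p] A]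

namespace ReducedForm

/-! ### Roots of `X² - tX + 1` in division quaternion algebras -/

section Field

variable {F A : Type*} [Field F] [CharZero F] [Ring A] [Algebra F A] (Q : ReducedForm F A) {t : ℤ}
  {β : A}

theorem ne_algebraMap (ht : t = 0 ∨ t = 1) (h1 : Q.tr β = t) (h2 : Q.nm β = 1) (c : F) :
    β ≠ algebraMap F A c := by
  rintro rfl
  rw [tr_algebraMap] at h1
  rw [nm_algebraMap] at h2
  have h3 : (t : F) ^ 2 = 4 := by rw [← h1]; linear_combination 4 * h2
  rcases ht with rfl | rfl <;> norm_num at h3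

theorem mul_self_eq (h1 : Q.tr β = t) (h2 : Q.nm β = 1) : β * β = (t : F) • β - 1 := by
  rw [Q.mul_self, h1, h2, map_one]

/-- Two roots of `X² - tX + 1` in a division quaternion algebra are conjugate. -/
theorem exists_conj (hdiv : ∀ x : A, x ≠ 0 → IsUnit x)
    (hcent : ∀ x : A, (∀ y, x * y = y * x) → ∃ c, x = algebraMap F A c) (ht : t = 0 ∨ t = 1)
    {v : A} (h1 : Q.tr β = t) (h2 : Q.nm β = 1) (h3 : Q.tr v = t) (h4 : Q.nm v = 1) :
    ∃ x : A, IsUnit x ∧ β * x = x * v := by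
  -- Every element `βy - y v̄` intertwines `β` and `v`. If all of them vanished, then `β = v̄` would
  -- be central, hence scalar.
  obtain ⟨y, hy⟩ : ∃ y, β * y - y * Q.conj v ≠ 0 := by
    by_contra! h
    have e := h 1
    rw [mul_one, one_mul, sub_eq_zero] at e
    obtain ⟨c, hc⟩ := hcent β fun y => by
      have := h y
      rwa [← e, sub_eq_zero] at this
    exact Q.ne_algebraMap ht h1 h2 c hc
  refine ⟨_, hdiv _ hy, ?_⟩
  have e1 := Q.mul_self_eq h1 h2
  have e2 : Q.conj v * v = 1 := by rw [conj_mul, h4, map_one]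
  rw [mul_sub, ← mul_assoc, e1, sub_mul, sub_mul, mul_assoc y, e2]
  simp only [conj, h3, Algebra.algebraMap_eq_smul_one, mul_sub, smul_mul_assoc, mul_smul_comm,
    mul_one, one_mul, mul_assoc]
  abel

end Field

variable (Q : ReducedForm ℚ_[p] A) {t : ℤ} {β : A}

theorem root_ne_zero (hdiv : ∀ x : A, x ≠ 0 → IsUnit x) (ht : t = 0 ∨ t = 1) (h1 : Q.tr β = t)
    (h2 : Q.nm β = 1) (r : ℚ_[p]) : r ^ 2 - t * r + 1 ≠ 0 := fun h =>
  Q.ne_algebraMap ht h1 h2 r (Q.eq_algebraMap_of_root hdiv (by rw [h1, h2]; exact h))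

-- The form `x² + txz + z²` has unit discriminant, so it represents every residue class modulo `p`.
-- For odd `p` complete the square with `X' = 2x + tz`; for `p = 2` use `m² ≡ m`.
open Polynomial in
theorem exists_norm_form_eq {p : ℕ} [Fact p.Prime] (hD : ¬ (p : ℤ) ∣ t ^ 2 - 4) (ν : ℤ_[p]) :
    ∃ x z : ℤ, ‖((x ^ 2 + t * x * z + z ^ 2 : ℤ) : ℚ_[p]) + ν‖ < 1 := by
  obtain ⟨m, hm⟩ := PadicInt.exists_int_dvd_sub ν
  obtain ⟨x, z, hxz⟩ : ∃ x z : ℤ, (p : ℤ) ∣ x ^ 2 + t * x * z + z ^ 2 + m := by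
    by_cases hp : p = 2
    · subst hp
      refine ⟨m, 0, ?_⟩
      have := (Int.even_mul_succ_self m).two_dvd
      simpa [sq, mul_add] using this
    · have h2 : (2 : ZMod p) ≠ 0 := by
        intro h
        have : (p : ℤ) ∣ 2 := by
          rw [← ZMod.intCast_zmod_eq_zero_iff_dvd]; exact_mod_cast h
        exact hp ((Nat.prime_dvd_prime_iff_eq Fact.out Nat.prime_two).1 (by exact_mod_cast this))
      have hD' : ((t ^ 2 - 4 : ℤ) : ZMod p) ≠ 0 := by
        rwa [Ne, ZMod.intCast_zmod_eq_zero_iff_dvd]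
      obtain ⟨X', Z, h⟩ := FiniteField.exists_root_sum_quadratic (R := ZMod p)
        (f := X ^ 2) (g := C (-((t ^ 2 - 4 : ℤ) : ZMod p)) * X ^ 2 + C (0 : ZMod p) * X
          + C ((4 * m : ℤ) : ZMod p))
        (by simp) (degree_quadratic (neg_ne_zero.2 hD')) (by
          rw [ZMod.card]; exact (Fact.out : p.Prime).eq_two_or_odd.resolve_left hp)
      obtain ⟨z, rfl⟩ := ZMod.intCast_surjective Z
      obtain ⟨x, hx⟩ := ZMod.intCast_surjective ((X' - (t : ZMod p) * (z : ZMod p)) / 2)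
      refine ⟨x, z, ?_⟩
      rw [← ZMod.intCast_zmod_eq_zero_iff_dvd]
      push_cast
      rw [hx]
      simp at h
      field_simp
      linear_combination h
  refine ⟨x, z, ?_⟩
  rw [show ((x ^ 2 + t * x * z + z ^ 2 : ℤ) : ℚ_[p]) + ν
    = ((x ^ 2 + t * x * z + z ^ 2 + m : ℤ) : ℚ_[p]) + ((ν - m : ℤ_[p]) : ℚ_[p]) by push_cast; ring]
  refine (IsUltrametricDist.norm_add_le_max _ _).trans_lt (max_lt ?_ ?_)
  · rw [Padic.norm_intCast_lt_one_iff]; exact hxz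
  · rw [← PadicInt.norm_def, PadicInt.norm_lt_one_iff_dvd]; exact hm

theorem norm_disc {p : ℕ} [Fact p.Prime] (hD : ¬ (p : ℤ) ∣ t ^ 2 - 4) : ‖((t : ℚ_[p]) ^ 2 - 4)‖ = 1 := by
  have h1 : ‖((t ^ 2 - 4 : ℤ) : ℚ_[p])‖ ≤ 1 := Padic.norm_int_le_one _
  have h2 : ¬ ‖((t ^ 2 - 4 : ℤ) : ℚ_[p])‖ < 1 := by rwa [Padic.norm_intCast_lt_one_iff]
  have := le_antisymm h1 (not_lt.1 h2)
  push_cast at this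
  exact this

theorem nm_disc (h1 : Q.tr β = t) (h2 : Q.nm β = 1) :
    Q.nm ((2 : ℚ_[p]) • β - algebraMap _ A (t : ℚ_[p])) = -((t : ℚ_[p]) ^ 2 - 4) := by
  rw [nm_sub, nm_smul, nm_algebraMap, tr_algebraMap, map_smul, h1, h2, ← Algebra.commutes,
    ← Algebra.smul_def, map_smul, map_smul, h1]
  simp only [smul_eq_mul]
  ring

theorem tr_mul_commutator (y : A) : Q.tr (β * (β * y - y * β)) = 0 := by
  rw [mul_sub, map_sub, ← mul_assoc β y β, Q.tr_mul_comm (β * y) β, sub_self]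

/-- A root commutes with everything modulo `𝔓`. The commutator `w` is trace-orthogonal to `1` and
`β`, so `nm(c + w) = nm c + nm w` for `c` in `ℤ[β]`, and `c` can be chosen with `c + w` in `𝔓`. The
commutator of `β` with `c + w` is `(2β - t)w`, and `2β - t` is a unit. -/
theorem norm_nm_commutator_lt (hdiv : ∀ x : A, x ≠ 0 → IsUnit x) (hD : ¬ (p : ℤ) ∣ t ^ 2 - 4)
    (h1 : Q.tr β = t) (h2 : Q.nm β = 1) {y : A} (hy : ‖Q.nm y‖ ≤ 1) :
    ‖Q.nm (β * y - y * β)‖ < 1 := by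
  set w := β * y - y * β with hw
  have hβ : ‖Q.nm β‖ = 1 := by rw [h2, norm_one]
  have hsub : ∀ x z : A, ‖Q.nm (x - z)‖ ≤ max ‖Q.nm x‖ ‖Q.nm z‖ := fun x z => by
    rw [sub_eq_add_neg, ← Q.nm_neg z]; exact Q.norm_nm_add_le hdiv _ _
  have hw1 : ‖Q.nm w‖ ≤ 1 := by
    refine (hsub _ _).trans (max_le ?_ ?_) <;> rw [map_mul, norm_mul, hβ] <;> simpa
  have htr : Q.tr w = 0 := by rw [hw, map_sub, Q.tr_mul_comm, sub_self]
  obtain ⟨x, z, hxz⟩ := exists_norm_form_eq hD (⟨Q.nm w, hw1⟩ : ℤ_[p])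
  replace hxz : ‖((x ^ 2 + t * x * z + z ^ 2 : ℤ) : ℚ_[p]) + Q.nm w‖ < 1 := hxz
  set c := (z : ℚ_[p]) • β + algebraMap ℚ_[p] A x with hc
  have hcw : ‖Q.nm (c + w)‖ < 1 := by
    convert hxz using 2
    have e : Q.tr (c * w) = 0 := by
      rw [hc, add_mul, map_add Q.tr, smul_mul_assoc, map_smul, Q.tr_mul_commutator,
        ← Algebra.smul_def, map_smul, htr, smul_zero, smul_zero, add_zero]
    rw [nm_add, htr, e, hc, nm_add_algebraMap, nm_smul, h2, map_smul, h1]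
    push_cast
    simp only [smul_eq_mul]
    ring
  have hcomm : β * (c + w) - (c + w) * β = ((2 : ℚ_[p]) • β - algebraMap _ A (t : ℚ_[p])) * w := by
    have e1 : β * c = c * β := by
      rw [hc, mul_add, add_mul, mul_smul_comm, smul_mul_assoc, Algebra.commutes]
    have e2 : β * w + w * β = algebraMap _ A (t : ℚ_[p]) * w := by
      have := Q.mul_self_eq h1 h2
      rw [hw]
      calc _ = (β * β) * y - y * (β * β) := by noncomm_ring
        _ = _ := by
          rw [this, Algebra.smul_def, sub_mul, mul_sub, mul_sub, ← mul_assoc y,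
            ← Algebra.commutes _ y]
          noncomm_ring
    clear_value w c
    rw [mul_add, add_mul, e1, sub_mul, ← e2, smul_mul_assoc, two_smul]
    abel
  have h3 := (hsub (β * (c + w)) ((c + w) * β)).trans_lt (max_lt
    (by rw [map_mul, norm_mul, hβ, one_mul]; exact hcw)
    (by rw [map_mul, norm_mul, hβ, mul_one]; exact hcw))
  rwa [hcomm, map_mul, norm_mul, Q.nm_disc h1 h2, norm_neg, norm_disc hD, one_mul] at h3

/-- If the discriminant of `X² - tX + 1` is a unit, a root of this polynomial generates the residue
field of a division quaternion algebra. -/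
theorem exists_approx (hdiv : ∀ x : A, x ≠ 0 → IsUnit x) (ht : t = 0 ∨ t = 1)
    (hD : ¬ (p : ℤ) ∣ t ^ 2 - 4)
    (h1 : Q.tr β = t) (h2 : Q.nm β = 1) {y : A} (hy : ‖Q.nm y‖ ≤ 1) :
    ∃ u v : ℚ_[p], ‖u‖ ≤ 1 ∧ ‖v‖ ≤ 1 ∧ ‖Q.nm (y - (u • 1 + v • β))‖ < 1 := by
  set w := β * y - y * β with hw
  set D : ℚ_[p] := (t : ℚ_[p]) ^ 2 - 4 with hDdef
  have hDn : ‖D‖ = 1 := norm_disc hD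
  have hD0 : D ≠ 0 := by rw [← norm_ne_zero_iff, hDn]; exact one_ne_zero
  set δ := (2 : ℚ_[p]) • β - algebraMap _ A (t : ℚ_[p]) with hδ
  have hβ2 := Q.mul_self_eq h1 h2
  have htr : Q.tr w = 0 := by rw [hw, map_sub, Q.tr_mul_comm, sub_self]
  have htrβ : Q.tr (β * w) = 0 := Q.tr_mul_commutator y
  have hint : ∀ x : A, ‖Q.nm x‖ ≤ 1 → ‖Q.tr x‖ ≤ 1 := fun x hx =>
    (sq_le_one_iff₀ (norm_nonneg _)).1 ((Q.norm_tr_sq_le hdiv _).trans hx)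
  have ht1 : ‖(t : ℚ_[p])‖ ≤ 1 := Padic.norm_int_le_one t
  have hty := hint y hy
  have htyβ := hint (y * β) (by rw [map_mul, norm_mul, h2, norm_one, mul_one]; exact hy)
  have hsub : ∀ x z : ℚ_[p], ‖x‖ ≤ 1 → ‖z‖ ≤ 1 → ‖x - z‖ ≤ 1 := fun x z hx hz => by
    rw [sub_eq_add_neg]
    exact (IsUltrametricDist.norm_add_le_max _ _).trans (max_le hx (by rwa [norm_neg]))
  have hmul : ∀ x z : ℚ_[p], ‖x‖ ≤ 1 → ‖z‖ ≤ 1 → ‖x * z‖ ≤ 1 := fun x z hx hz => by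
    rw [norm_mul]; exact mul_le_one₀ hx (norm_nonneg _) hz
  have hn2 : ‖(2 : ℚ_[p])‖ ≤ 1 := by exact_mod_cast Padic.norm_int_le_one 2
  -- Cramer's rule for making `y - u - vβ` trace-orthogonal to `1` and `β`; the determinant `t² - 4`
  -- is a unit, so `u` and `v` are integral.
  set u : ℚ_[p] := (((t : ℚ_[p]) * t - 2) * Q.tr y - t * Q.tr (y * β)) / D with hu
  set v : ℚ_[p] := (2 * Q.tr (y * β) - t * Q.tr y) / D with hv
  refine ⟨u, v, ?_, ?_, ?_⟩
  · rw [hu, norm_div, hDn, div_one]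
    exact hsub _ _ (hmul _ _ (hsub _ _ (hmul _ _ ht1 ht1) hn2) hty) (hmul _ _ ht1 htyβ)
  · rw [hv, norm_div, hDn, div_one]
    exact hsub _ _ (hmul _ _ hn2 htyβ) (hmul _ _ ht1 hty)
  set z := y - (u • 1 + v • β) - D⁻¹ • (δ * w) with hz
  have hδw : Q.tr (δ * w) = 0 := by
    rw [hδ, sub_mul, map_sub, smul_mul_assoc, map_smul, htrβ, ← Algebra.smul_def, map_smul, htr]
    simp
  have hδwβ : Q.tr (δ * w * β) = 0 := by
    rw [Q.tr_mul_comm, hδ, sub_mul, mul_sub, smul_mul_assoc, mul_smul_comm, ← mul_assoc, hβ2,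
      sub_mul, one_mul, ← Algebra.smul_def, mul_smul_comm, smul_mul_assoc]
    simp only [map_sub, map_smul, htr, htrβ, smul_zero, sub_zero]
  have hβw : β * w + w * β = (t : ℚ_[p]) • w := by
    rw [hw]
    calc _ = (β * β) * y - y * (β * β) := by noncomm_ring
      _ = _ := by
        rw [hβ2, sub_mul, mul_sub, smul_mul_assoc, mul_smul_comm, smul_sub]
        noncomm_ring
  have hδβ : δ * β = β * δ := by
    rw [hδ, sub_mul, mul_sub, smul_mul_assoc, mul_smul_comm, Algebra.commutes]
  have hδδ : δ * δ = D • 1 := by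
    rw [hδ, Algebra.algebraMap_eq_smul_one]
    simp only [sub_mul, mul_sub, smul_mul_assoc, mul_smul_comm, hβ2, one_mul, mul_one, smul_sub,
      smul_smul]
    rw [hDdef]
    module
  have hcomm : z * β = β * z := by
    have e1 : β * (δ * w) - (δ * w) * β = D • w := by
      have : β * w - w * β = δ * w := by
        rw [hδ, sub_mul ((2 : ℚ_[p]) • β) _ w, ← Algebra.smul_def, ← hβw, smul_mul_assoc, two_smul]
        abel
      rw [← mul_assoc, ← hδβ, mul_assoc, mul_assoc, ← mul_sub, this, ← mul_assoc, hδδ,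
        smul_mul_assoc, one_mul]
    have e2 : β * z - z * β = w - D⁻¹ • (β * (δ * w) - (δ * w) * β) := by
      rw [hz, hw]
      simp only [mul_sub, sub_mul, mul_add, add_mul, smul_mul_assoc, mul_smul_comm, one_mul,
        mul_one, smul_sub]
      abel
    rw [e1, smul_smul, inv_mul_cancel₀ hD0, one_smul, sub_self, sub_eq_zero] at e2
    exact e2.symm
  have htz : Q.tr z = 0 := by
    rw [hz]
    simp only [map_sub, map_add, map_smul, hδw, Q.tr_one, h1, smul_eq_mul]
    rw [hu, hv]
    field_simp
    rw [hDdef]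
    ring
  have htzβ : Q.tr (z * β) = 0 := by
    have e : Q.tr (β * β) = (t : ℚ_[p]) ^ 2 - 2 := by rw [tr_mul_self, h1, h2]; ring
    rw [hz]
    simp only [sub_mul, add_mul, smul_mul_assoc, one_mul, map_sub, map_add, map_smul, hδwβ, h1, e,
      smul_eq_mul]
    rw [hu, hv]
    field_simp
    rw [hDdef]
    ring
  -- Both `z` and `z(1 + β)` have trace 0, hence scalar squares. As `z` commutes with `β`, a nonzero
  -- `z` would make `(1 + β)² = (2 + t)β` scalar. So the error of the approximation is exactly
  -- `D⁻¹δw`, which lies in `𝔓`.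
  have hz0 : z = 0 := by
    by_contra hne
    have hnz := Q.nm_ne_zero_of_isUnit (hdiv z hne)
    have e1 : z * z = -algebraMap _ A (Q.nm z) := by rw [Q.mul_self, htz, zero_smul, zero_sub]
    have e2 : (z * (1 + β)) * (z * (1 + β)) = -algebraMap _ A (Q.nm (z * (1 + β))) := by
      rw [Q.mul_self, mul_add, mul_one, map_add, htz, htzβ, add_zero, zero_smul, zero_sub]
    have e3 : (1 + β) * (1 + β) = (2 + t : ℚ_[p]) • β := by
      rw [add_mul, one_mul, mul_add, mul_one, hβ2]; module
    have e4 : (z * (1 + β)) * (z * (1 + β)) = -(Q.nm z * (2 + t)) • β := by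
      have : (z * (1 + β)) * (z * (1 + β)) = (z * z) * ((1 + β) * (1 + β)) := by
        have : (1 + β) * z = z * (1 + β) := by rw [add_mul, mul_add, hcomm, one_mul, mul_one]
        rw [mul_assoc, ← mul_assoc (1 + β) z, this]; noncomm_ring
      rw [this, e1, e3, neg_mul, ← Algebra.smul_def, smul_smul, neg_smul]
    have h2t : (2 + t : ℚ_[p]) ≠ 0 := by
      rcases ht with rfl | rfl <;> norm_num
    have h5 : Q.nm z * (2 + t) ≠ 0 := mul_ne_zero hnz h2t
    refine Q.ne_algebraMap ht h1 h2 ((Q.nm z * (2 + t))⁻¹ * Q.nm (z * (1 + β))) ?_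
    rw [e2, neg_smul, neg_inj] at e4
    rw [map_mul, e4, ← Algebra.smul_def, smul_smul, inv_mul_cancel₀ h5, one_smul]
  rw [hz, sub_eq_zero] at hz0
  rw [hz0, norm_nm_smul, map_mul, norm_mul, Q.nm_disc h1 h2, norm_neg, norm_inv, ← hDdef, hDn]
  simpa using Q.norm_nm_commutator_lt hdiv hD h1 h2 hy

end ReducedForm

end Division

/-! ### Roots of `X² - tX + 1` in special orders of division quaternion algebras -/

theorem exists_eq_algebraMap_of_central {F : Type*} [Field F] [CharZero F] {a b : F} (ha : a ≠ 0)
    (hb : b ≠ 0) {x : ℍ[F, a, b]} (h : ∀ y, x * y = y * x) : ∃ c, x = algebraMap F _ c := by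
  have h1 := h ⟨0, 1, 0, 0⟩
  have h2 := h ⟨0, 0, 1, 0⟩
  rw [QuaternionAlgebra.ext_iff] at h1 h2
  simp [eq_neg_iff_add_eq_zero, neg_eq_iff_add_eq_zero, ← two_mul, ha, hb] at h1 h2
  refine ⟨x.re, ?_⟩
  rw [QuaternionAlgebra.algebraMap_eq]
  ext
  · rfl
  · exact h2.2
  · exact h1.2
  · exact h1.1

theorem baseChange_exists_eq_algebraMap_of_central (F : Type*) [Field F] [CharZero F] [Algebra ℚ F]
    {B : Type*} [Ring B] [Algebra ℚ B] {a b : ℚ} (ha : a ≠ 0) (hb : b ≠ 0)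
    (e : B ≃ₐ[ℚ] ℍ[ℚ, a, b]) {x : F ⊗[ℚ] B} (h : ∀ y, x * y = y * x) :
    ∃ c, x = algebraMap F _ c := by
  obtain ⟨c, hc⟩ := exists_eq_algebraMap_of_central (F := F) (a := algebraMap ℚ F a)
    (b := algebraMap ℚ F b) (by simpa using ha) (by simpa using hb) (x := baseChangeEquiv F e x)
    fun y => by
      have := congrArg (baseChangeEquiv F e) (h ((baseChangeEquiv F e).symm y))
      simpa using this
  exact ⟨c, (baseChangeEquiv F e).injective (by rw [hc, AlgEquiv.commutes])⟩

section Division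

variable {p : ℕ} [Fact p.Prime] {A : Type*} [Ring A] [Algebra ℚ_[p] A] [Algebra ℤ_[p] A]
  [IsScalarTower ℤ_[p] ℚ_[p] A]
  {E : IntermediateField ℚ_[p] (AlgebraicClosure ℚ_[p])} {r : ℕ} {Λ : Submodule ℤ_[p] A}

namespace ReducedForm

variable (Q : ReducedForm ℚ_[p] A) {t : ℤ} {β : A}

theorem nm_add_one (h1 : Q.tr β = t) (h2 : Q.nm β = 1) : Q.nm (β + 1) = 2 + t := by
  have := Q.nm_add_algebraMap β 1
  rw [map_one, h1, h2] at this
  rw [this]; ring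

theorem norm_nm_add_one (h1 : Q.tr β = t) (h2 : Q.nm β = 1) (hp : (p : ℤ) = 2 + t) :
    ‖Q.nm (β + 1)‖ = ‖(p : ℚ_[p])‖ := by
  rw [Q.nm_add_one h1 h2, show (p : ℚ_[p]) = ((p : ℤ) : ℚ_[p]) by push_cast; rfl, hp]
  push_cast
  rfl

/-- The order contains `𝔓`, and `β` generates the residue field. Containing `β` too would make it
maximal, against the minimality of the level. -/
theorem not_mem_of_isLeast_two (hdiv : ∀ x : A, x ≠ 0 → IsUnit x) (ht : t = 0 ∨ t = 1)
    (hD : ¬ (p : ℤ) ∣ t ^ 2 - 4) (h1 : Q.tr β = t) (h2 : Q.nm β = 1)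
    (h : IsLeast {s : ℕ | ∃ E : IntermediateField ℚ_[p] (AlgebraicClosure ℚ_[p]),
      Module.finrank ℚ_[p] E = 2 ∧ IsBasicOrder p E s Λ} 2) : β ∉ Λ := by
  intro hβ
  obtain ⟨⟨E, hE, hb⟩, hmin⟩ := h
  obtain ⟨-, ι, hι⟩ := Q.exists_eq_basicOrder hdiv hb
  have : 2 ≤ 1 := hmin ⟨E, hE, Q.isBasicOrder_one hdiv hb fun y hy => by
    obtain ⟨u, v, hu, hv, huv⟩ := Q.exists_approx hdiv ht hD h1 h2 hy
    obtain ⟨u, rfl⟩ : ∃ u' : ℤ_[p], (u' : ℚ_[p]) = u := ⟨⟨u, hu⟩, rfl⟩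
    obtain ⟨v, rfl⟩ : ∃ v' : ℤ_[p], (v' : ℚ_[p]) = v := ⟨⟨v, hv⟩, rfl⟩
    have e : y = (y - ((u : ℚ_[p]) • 1 + (v : ℚ_[p]) • β)) + (u • (1 : A) + v • β) := by
      rw [← IsScalarTower.algebraMap_smul ℚ_[p] u, ← IsScalarTower.algebraMap_smul ℚ_[p] v]
      exact (sub_add_cancel _ _).symm
    rw [e]
    refine Λ.add_mem ?_ (Λ.add_mem (Λ.smul_mem _ ?_) (Λ.smul_mem _ hβ))
    · rw [hι]; exact Q.mem_basicOrder_two ι huv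
    · rw [hι]; exact Q.one_mem_basicOrder ι 2⟩
  omega

/-- If `β = e + py` with `e` integral in `E`, then `e + 1` has norm divisible by `p`, hence is
itself divisible by `p`. So `β + 1` is divisible by `p` and its norm by `p²`, although that norm is
`p`. -/
theorem not_mem_of_three_le (hdiv : ∀ x : A, x ≠ 0 → IsUnit x) (hp : (p : ℤ) = 2 + t)
    (h1 : Q.tr β = t) (h2 : Q.nm β = 1) (hE2 : Module.finrank ℚ_[p] E = 2)
    (hE : IsUnramifiedExt p E) (hr : 3 ≤ r) (h : IsBasicOrder p E r Λ) : β ∉ Λ := by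
  have : FiniteDimensional ℚ_[p] E := FiniteDimensional.of_finrank_pos (by omega)
  intro hβ
  obtain ⟨-, ι, rfl⟩ := Q.exists_eq_basicOrder hdiv h
  obtain ⟨e, y, he, hy, hey⟩ := Q.exists_of_mem_basicOrder_of_three_le hr hβ
  have hn := Q.norm_nm_add_one h1 h2 hp
  have hp0 : 0 < ‖(p : ℚ_[p])‖ := norm_pos_iff.2 p_ne_zero
  have hp1 : ‖(p : ℚ_[p])‖ < 1 := norm_natCast_p
  have hpy : ‖Q.nm (-((p : ℚ_[p]) • y))‖ < 1 := by
    rw [nm_neg, norm_nm_smul]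
    calc _ ≤ ‖(p : ℚ_[p])‖ ^ 2 * 1 := by gcongr
      _ < 1 := by rw [mul_one]; exact pow_lt_one₀ hp0.le hp1 two_ne_zero
  have he1 : ‖Q.nm (ι (e + 1))‖ < 1 := by
    have : ι (e + 1) = (β + 1) + -((p : ℚ_[p]) • y) := by rw [hey, map_add, map_one]; abel
    rw [this]
    exact Q.norm_nm_add_lt hdiv (by rw [hn]; exact hp1) hpy
  obtain ⟨e', he', h'⟩ := Q.exists_eq_smul_of_unramified hdiv ι hE he1
  have e2 : β + 1 = (p : ℚ_[p]) • (ι e' + y) := by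
    have : ι (e + 1) = (p : ℚ_[p]) • ι e' := by rw [h', map_smul]
    rw [smul_add, ← this, hey, map_add, map_one]; abel
  rw [e2, norm_nm_smul] at hn
  have h3 : ‖Q.nm (ι e' + y)‖ ≤ 1 := (Q.norm_nm_add_le hdiv _ _).trans
    (max_le (Q.norm_nm_le_one_of_isIntegral hdiv ι he') hy)
  have h4 : ‖(p : ℚ_[p])‖ ^ 2 * ‖Q.nm (ι e' + y)‖ ≤ ‖(p : ℚ_[p])‖ ^ 2 * 1 := by gcongr
  nlinarith

/-- The integers of `E` contain a root of the same polynomial, and any two roots are conjugate. -/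
theorem exists_conj_mem_of_unramified (hdiv : ∀ x : A, x ≠ 0 → IsUnit x)
    (hcent : ∀ x : A, (∀ y, x * y = y * x) → ∃ c, x = algebraMap ℚ_[p] A c) (ht : t = 0 ∨ t = 1)
    (hD : ¬ (p : ℤ) ∣ t ^ 2 - 4) (h1 : Q.tr β = t) (h2 : Q.nm β = 1)
    (hE2 : Module.finrank ℚ_[p] E = 2) (hE : IsUnramifiedExt p E) (h : IsBasicOrder p E r Λ) :
    ∃ x : Aˣ, (x⁻¹ : Aˣ) * β * x ∈ Λ := by
  have : FiniteDimensional ℚ_[p] E := FiniteDimensional.of_finrank_pos (by omega)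
  obtain ⟨-, ι, rfl⟩ := Q.exists_eq_basicOrder hdiv h
  have hroot := Q.root_ne_zero hdiv ht h1 h2
  obtain ⟨v, hv, hv2⟩ := Q.exists_root_of_unramified hdiv ι ht hE hE2 hD hroot
  have e : ι v * ι v = (t : ℚ_[p]) • ι v - algebraMap ℚ_[p] A 1 := by
    rw [← map_mul, ← sq, hv2, map_sub, map_mul, AlgHom.commutes, ← Algebra.smul_def, map_one,
      map_one]
  obtain ⟨h3, h4⟩ := Q.tr_nm_of_root e fun c hc => by
    rw [hc, ← map_mul, Algebra.smul_def, ← map_mul, ← map_sub, ← sub_eq_zero, ← map_sub] at e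
    have := congrArg Q.nm e
    rw [nm_zero, nm_algebraMap] at this
    have := pow_eq_zero_iff (two_ne_zero) |>.1 this
    exact hroot c (by linear_combination this)
  obtain ⟨x, ⟨x, rfl⟩, hx⟩ := Q.exists_conj hdiv hcent ht h1 h2 h3 h4
  refine ⟨x, ?_⟩
  rw [mul_assoc, hx, Units.inv_mul_cancel_left]
  exact Q.map_mem_basicOrder ι r hv

theorem mem_of_isBasicOrder_one (hdiv : ∀ x : A, x ≠ 0 → IsUnit x) (h2 : Q.nm β = 1)
    (h : IsBasicOrder p E 1 Λ) : β ∈ Λ := by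
  obtain ⟨-, ι, rfl⟩ := Q.exists_eq_basicOrder hdiv h
  exact Q.mem_basicOrder_one ι (by rw [h2, norm_one])

/-- Here `β + 1` has norm `p`, so `β ≡ -1` modulo `𝔓`. -/
theorem mem_of_isBasicOrder_two (hdiv : ∀ x : A, x ≠ 0 → IsUnit x) (hp : (p : ℤ) = 2 + t)
    (h1 : Q.tr β = t) (h2 : Q.nm β = 1) (h : IsBasicOrder p E 2 Λ) : β ∈ Λ := by
  obtain ⟨-, ι, rfl⟩ := Q.exists_eq_basicOrder hdiv h
  rw [← add_sub_cancel_right β 1]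
  refine Submodule.sub_mem _ (Q.mem_basicOrder_two ι ?_) (Q.one_mem_basicOrder ι 2)
  rw [Q.norm_nm_add_one h1 h2 hp]
  exact norm_natCast_p

end ReducedForm

end Division

/-! ### Local Eichler orders -/

section Eichler

variable {p : ℕ} [Fact p.Prime] {A : Type*} [Ring A] [Algebra ℚ_[p] A] [Algebra ℤ_[p] A]
  {r : ℕ} {Λ : Submodule ℤ_[p] A}

theorem exists_nonunit_of_matrix {F A : Type*} [Field F] [Ring A] [Algebra F A]
    (φ : A ≃ₐ[F] Matrix (Fin 2) (Fin 2) F) : ¬ ∀ x : A, x ≠ 0 → IsUnit x := by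
  intro h
  have h1 : (!![0, 1; 0, 0] : Matrix (Fin 2) (Fin 2) F) ≠ 0 := fun h => by
    simpa using congrFun (congrFun h 0) 1
  have h2 := (h (φ.symm !![0, 1; 0, 0]) (by simpa using h1)).map φ
  rw [AlgEquiv.apply_symm_apply, Matrix.isUnit_iff_isUnit_det, Matrix.det_fin_two_of] at h2
  simp at h2

/-- Modulo `p` the matrix is upper triangular, so its diagonal entry is a root. -/
theorem IsLocalEichlerOrder.exists_dvd (h : IsLocalEichlerOrder p r Λ) (hr : 1 ≤ r) {t : ℤ} {β : A}
    (hβ : β ∈ Λ) (h2 : β * β = (t : ℚ_[p]) • β - 1) : ∃ a : ℤ, (p : ℤ) ∣ a ^ 2 - t * a + 1 := by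
  obtain ⟨φ, hφ⟩ := h
  obtain ⟨m, hm, hmβ⟩ := (hφ β).1 hβ
  have e := congrArg φ h2
  rw [map_mul, map_sub, map_smul, hmβ, map_one] at e
  have e := congrFun (congrFun e 0) 0
  simp [Matrix.mul_apply, Fin.sum_univ_two] at e
  have e' : m 0 0 * m 0 0 + m 0 1 * m 1 0 = t * m 0 0 - 1 :=
    Subtype.coe_injective (by push_cast; exact e)
  obtain ⟨a, c, ha⟩ := PadicInt.exists_int_dvd_sub (m 0 0)
  obtain ⟨d, hd⟩ := (dvd_pow_self (p : ℤ_[p]) (by omega : r ≠ 0)).trans hm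
  refine ⟨a, ?_⟩
  rw [← PadicInt.p_dvd_intCast_iff]
  push_cast
  refine ⟨-(m 0 1 * d) - c * (m 0 0 + a - t), ?_⟩
  linear_combination e' - m 0 1 * hd - (m 0 0 + a - t) * ha

/-- A nonscalar `m` has a cyclic vector `v`: the quadratic form below is, up to sign, the
determinant of `v` and `mv`. The basis `(t - a)v - mv`, `v` brings `m` to the stated form, whose
lower left entry is divisible by `p` when `a` is a root modulo `p`. -/
theorem exists_conj_companion {F : Type*} [Field F] {m : Matrix (Fin 2) (Fin 2) F} {t : F}
    (h : m * m = t • m - 1) (hm : ∀ c, m ≠ algebraMap F _ c) (a : F) :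
    ∃ X : (Matrix (Fin 2) (Fin 2) F)ˣ, m * X = X * !![a, -1; a ^ 2 - t * a + 1, t - a] := by
  obtain ⟨x, y, hxy⟩ : ∃ x y : F, m 0 1 * y ^ 2 + (m 0 0 - m 1 1) * x * y - m 1 0 * x ^ 2 ≠ 0 := by
    by_contra! h
    have h1 : m 1 0 = 0 := by simpa using h 1 0
    have h2 : m 0 1 = 0 := by simpa using h 0 1
    have h3 := h 1 1
    refine hm (m 0 0) ?_
    rw [Algebra.algebraMap_eq_smul_one]
    ext i j
    fin_cases i <;> fin_cases j <;> simp [h1, h2]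
    rw [h1, h2] at h3
    linear_combination -h3
  let X : Matrix (Fin 2) (Fin 2) F := !![(t - a) * x - (m 0 0 * x + m 0 1 * y), x;
    (t - a) * y - (m 1 0 * x + m 1 1 * y), y]
  have hX : IsUnit X := by
    rw [Matrix.isUnit_iff_isUnit_det, Matrix.det_fin_two_of, isUnit_iff_ne_zero]
    intro h0; apply hxy; linear_combination -h0
  refine ⟨hX.unit, ?_⟩
  have e00 := congrFun (congrFun h 0) 0
  have e01 := congrFun (congrFun h 0) 1
  have e10 := congrFun (congrFun h 1) 0
  have e11 := congrFun (congrFun h 1) 1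
  simp [Matrix.mul_apply, Fin.sum_univ_two] at e00 e01 e10 e11
  ext i j
  fin_cases i <;> fin_cases j <;> simp [X, Matrix.mul_apply, Fin.sum_univ_two]
  · linear_combination -x * e00 - y * e01
  · ring
  · linear_combination -x * e10 - y * e11
  · ring

theorem IsLocalEichlerOrder.exists_conj_mem (h : IsLocalEichlerOrder p 1 Λ) {t a : ℤ} {β : A}
    (h2 : β * β = (t : ℚ_[p]) • β - 1) (hβ : ∀ c, β ≠ algebraMap ℚ_[p] A c)
    (ha : (p : ℤ) ∣ a ^ 2 - t * a + 1) : ∃ x : Aˣ, (x⁻¹ : Aˣ) * β * x ∈ Λ := by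
  obtain ⟨φ, hφ⟩ := h
  obtain ⟨X, hX⟩ := exists_conj_companion (m := φ β) (t := (t : ℚ_[p]))
    (by rw [← map_mul, h2, map_sub, map_smul, map_one])
    (fun c hc => hβ c (φ.injective (by rw [hc, AlgEquiv.commutes]))) (a : ℚ_[p])
  refine ⟨Units.map (φ.symm : _ →* A) X, (hφ _).2
    ⟨!![(a : ℤ_[p]), -1; (a : ℤ_[p]) ^ 2 - t * a + 1, t - a], ?_, ?_⟩⟩
  · rw [pow_one]
    have := (PadicInt.p_dvd_intCast_iff _).2 ha
    push_cast at this
    simpa using this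
  · rw [← map_inv]
    simp only [Units.coe_map, MonoidHom.coe_coe, map_mul, AlgEquiv.apply_symm_apply]
    rw [mul_assoc, hX, Units.inv_mul_cancel_left]
    ext i j
    fin_cases i <;> fin_cases j <;> simp

/-- The right ideal generated by `1` and `m` consists of the matrices with columns in the lattice
`ℤ_p² + mℤ_p²`. This lattice is free of rank 2, and a basis of it is the matrix `X`. -/
theorem exists_unit_of_column_lattice (m : Matrix (Fin 2) (Fin 2) ℚ_[p]) :
    ∃ X : (Matrix (Fin 2) (Fin 2) ℚ_[p])ˣ, ∀ y : Matrix (Fin 2) (Fin 2) ℚ_[p],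
      (∃ u v : Matrix (Fin 2) (Fin 2) ℤ_[p], y = u.map (fun z : ℤ_[p] => (z : ℚ_[p])) +
        m * v.map (fun z : ℤ_[p] => (z : ℚ_[p]))) ↔
      ∃ z : Matrix (Fin 2) (Fin 2) ℤ_[p], y = X * z.map (fun z : ℤ_[p] => (z : ℚ_[p])) := by
  let f : (Fin 2 → ℤ_[p]) × (Fin 2 → ℤ_[p]) →ₗ[ℤ_[p]] (Fin 2 → ℚ_[p]) :=
    { toFun := fun w i => (w.1 i : ℚ_[p]) + ∑ j, m i j * (w.2 j : ℚ_[p])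
      map_add' := fun w w' => by
        ext i; simp [mul_add, Finset.sum_add_distrib]; ring
      map_smul' := fun c w => by
        ext i
        simp [Algebra.smul_def, mul_add, Fin.sum_univ_two]; ring }
  let L : Submodule ℤ_[p] (Fin 2 → ℚ_[p]) := LinearMap.range f
  have hone : ∀ i, (Pi.single i 1 : Fin 2 → ℚ_[p]) ∈ L := fun i =>
    ⟨(Pi.single i 1, 0), by
      ext j
      by_cases h : j = i
      · subst h; simp [f]
      · simp [f, h]⟩
  have hlat : Submodule.IsLattice ℚ_[p] L := by
    refine ⟨?_, ?_⟩
    · exact (Module.Finite.range f).fg_top.map L.subtype |> fun h => by simpa using h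
    · rw [eq_top_iff, ← (Pi.basisFun ℚ_[p] (Fin 2)).span_eq, Submodule.span_le]
      rintro _ ⟨i, rfl⟩
      exact Submodule.subset_span (by simpa using hone i)
  have hfree := Submodule.IsLattice.free ℚ_[p] L
  have hfin : Module.Finite ℤ_[p] L := Module.Finite.range f
  have hrank : Module.finrank ℤ_[p] L = 2 := by
    have := Submodule.IsLattice.finrank_of_pi (K := ℚ_[p]) L
    simpa using this
  let b := Module.finBasisOfFinrankEq ℤ_[p] L hrank
  let X : Matrix (Fin 2) (Fin 2) ℚ_[p] := Matrix.of fun i j => (b j : Fin 2 → ℚ_[p]) i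
  have key : ∀ w : Fin 2 → ℚ_[p], w ∈ L ↔ ∃ c : Fin 2 → ℤ_[p], ∀ i, w i = ∑ j, X i j * c j := by
    intro w
    constructor
    · intro hw
      refine ⟨b.repr ⟨w, hw⟩, fun i => ?_⟩
      have := b.sum_repr ⟨w, hw⟩
      rw [Fin.sum_univ_two] at this
      have := congrFun (congrArg Subtype.val this) i
      simp only [Submodule.coe_add, Submodule.coe_smul, Pi.add_apply,
        Algebra.smul_def] at this
      rw [← this, Fin.sum_univ_two]
      exact congrArg₂ (· + ·) (mul_comm _ _) (mul_comm _ _)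
    · rintro ⟨c, hc⟩
      have : w = ((∑ j, c j • b j : L) : Fin 2 → ℚ_[p]) := by
        ext i
        rw [hc]
        simp [X, Fin.sum_univ_two, mul_comm, Algebra.smul_def]
      rw [this]
      exact Submodule.coe_mem _
  have hmat : ∀ y : Matrix (Fin 2) (Fin 2) ℚ_[p], (∀ j, (fun i => y i j) ∈ L) ↔
      ∃ z : Matrix (Fin 2) (Fin 2) ℤ_[p], y = X * z.map (fun z : ℤ_[p] => (z : ℚ_[p])) := by
    intro y
    constructor
    · intro h
      choose c hc using fun j => (key _).1 (h j)
      refine ⟨Matrix.of fun i j => c j i, ?_⟩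
      ext i j
      rw [hc, Matrix.mul_apply]; rfl
    · rintro ⟨z, rfl⟩ j
      exact (key _).2 ⟨fun i => z i j, fun i => by rw [Matrix.mul_apply]; rfl⟩
  have hX : IsUnit X := by
    obtain ⟨z, hz⟩ := (hmat 1).1 fun j => by
      convert hone j using 1
      ext i; simp [Matrix.one_apply, Pi.single_apply]
    exact IsUnit.of_mul_eq_one _ hz.symm
  refine ⟨hX.unit, fun y => ?_⟩
  rw [IsUnit.unit_spec, ← hmat]
  constructor
  · rintro ⟨u, v, rfl⟩ j
    exact ⟨(fun i => u i j, fun i => v i j), by ext i; simp [f, Matrix.mul_apply]⟩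
  · intro h
    choose w hw using h
    refine ⟨Matrix.of fun i j => (w j).1 i, Matrix.of fun i j => (w j).2 i, ?_⟩
    ext i j
    have := congrFun (hw j) i
    simp only [f, LinearMap.coe_mk, AddHom.coe_mk] at this
    rw [← this]
    simp [Matrix.mul_apply]

end Eichler

/-! ### Completions of lattices -/

section Completion

variable {p : ℕ} [Fact p.Prime] {B : Type*} [Ring B] [Algebra ℚ B] {I J K : Submodule ℤ B}

theorem tmul_mem_completionAt {x : B} (hx : x ∈ I) :
    (1 ⊗ₜ x : Completion p B) ∈ completionAt p I :=
  Submodule.subset_span ⟨x, hx, rfl⟩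

theorem mul_mem_completionAt (h : ∀ x ∈ I, ∀ y ∈ J, x * y ∈ K) {x y : Completion p B}
    (hx : x ∈ completionAt p I) (hy : y ∈ completionAt p J) : x * y ∈ completionAt p K := by
  have h1 := Submodule.mul_mem_mul hx hy
  rw [completionAt, completionAt, Submodule.span_mul_span] at h1
  refine Submodule.span_mono ?_ h1
  rintro _ ⟨_, ⟨x, hx, rfl⟩, _, ⟨y, hy, rfl⟩, rfl⟩
  exact ⟨x * y, h x hx y hy, map_mul _ _ _⟩

theorem completionAt_sup : completionAt p (I ⊔ J) = completionAt p I ⊔ completionAt p J := by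
  apply le_antisymm
  · rw [completionAt, Submodule.span_le]
    rintro _ ⟨x, hx, rfl⟩
    obtain ⟨y, hy, z, hz, rfl⟩ := Submodule.mem_sup.1 hx
    rw [map_add]
    exact Submodule.add_mem_sup (tmul_mem_completionAt hy) (tmul_mem_completionAt hz)
  · exact sup_le (Submodule.span_mono (Set.image_mono fun x hx => Submodule.mem_sup_left hx))
      (Submodule.span_mono (Set.image_mono fun x hx => Submodule.mem_sup_right hx))

theorem completionAt_map_mulLeft (α : B) : completionAt p (I.map (LinearMap.mulLeft ℤ α)) =
    (completionAt p I).map (LinearMap.mulLeft ℤ_[p] (1 ⊗ₜ α : Completion p B)) := by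
  rw [completionAt, completionAt, Submodule.map_span]
  congr 1
  ext x
  constructor
  · rintro ⟨_, ⟨y, hy, rfl⟩, rfl⟩
    exact ⟨_, ⟨y, hy, rfl⟩, by simp⟩
  · rintro ⟨_, ⟨y, hy, rfl⟩, rfl⟩
    exact ⟨_, ⟨y, hy, rfl⟩, by simp⟩

variable (O : Subalgebra ℤ B)

theorem one_mem_completionAt : (1 : Completion p B) ∈ completionAt p (Subalgebra.toSubmodule O) :=
  tmul_mem_completionAt O.one_mem

theorem mul_mem_completionAt_subalgebra {x y : Completion p B}
    (hx : x ∈ completionAt p (Subalgebra.toSubmodule O))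
    (hy : y ∈ completionAt p (Subalgebra.toSubmodule O)) :
    x * y ∈ completionAt p (Subalgebra.toSubmodule O) :=
  mul_mem_completionAt (fun _ hx _ hy => O.mul_mem hx hy) hx hy

theorem algebraMap_mem_completionAt (c : ℤ_[p]) : algebraMap ℚ_[p] (Completion p B) c ∈
    completionAt p (Subalgebra.toSubmodule O) := by
  have := Submodule.smul_mem _ c (one_mem_completionAt (p := p) O)
  rwa [← IsScalarTower.algebraMap_smul ℚ_[p] c, ← Algebra.algebraMap_eq_smul_one] at this

end Completion

/-! ### Integrality of the reduced trace and norm -/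

section Integral

variable {B : Type*} [Ring B] [Algebra ℚ B]

-- For nonscalar `x` the characteristic polynomial divides every polynomial vanishing at `x`; a
-- monic rational factor of a monic integral polynomial is integral.
open Polynomial in
theorem ReducedForm.exists_int_of_isIntegral (Q : ReducedForm ℚ B) {x : B} (hx : IsIntegral ℤ x) :
    ∃ T N : ℤ, Q.tr x = T ∧ Q.nm x = N := by
  have : Nontrivial B := ⟨0, 1, fun h => by
    have := congrArg Q.nm h; rw [Q.nm_zero, map_one] at this; exact zero_ne_one this⟩
  by_cases hs : ∃ c, x = algebraMap ℚ B c
  · obtain ⟨c, rfl⟩ := hs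
    rw [isIntegral_algebraMap_iff (algebraMap ℚ B).injective] at hx
    obtain ⟨n, rfl⟩ := IsIntegrallyClosed.isIntegral_iff.1 hx
    exact ⟨2 * n, n ^ 2, by rw [tr_algebraMap]; simp, by rw [nm_algebraMap]; simp⟩
  push Not at hs
  obtain ⟨P, hP, hPx⟩ := hx
  let q : ℚ[X] := X ^ 2 - C (Q.tr x) * X + C (Q.nm x)
  have hqd : q = X ^ 2 + (-C (Q.tr x) * X + C (Q.nm x)) := by simp only [q]; ring
  have hlt : (-C (Q.tr x) * X + C (Q.nm x)).degree < ((2 : ℕ) : WithBot ℕ) := by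
    rw [← C_neg]
    exact degree_linear_lt.trans_le (by norm_num)
  have hq : q.Monic := by
    rw [hqd]; exact monic_X_pow_add (by simpa using hlt)
  have hqx : aeval x q = 0 := by
    simp only [q, map_add, map_sub, map_mul, aeval_X, aeval_C, map_pow]
    rw [sq, Q.mul_self, Algebra.smul_def]; abel
  have hdvd : q ∣ P.map (algebraMap ℤ ℚ) := by
    rw [← modByMonic_eq_zero_iff_dvd hq]
    have hdeg : (P.map (algebraMap ℤ ℚ) %ₘ q).degree < ((2 : ℕ) : WithBot ℕ) := by
      refine (degree_modByMonic_lt _ hq).trans_eq ?_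
      rw [hqd, degree_add_eq_left_of_degree_lt] <;> rw [degree_X_pow]
      exact hlt
    have hr : aeval x (P.map (algebraMap ℤ ℚ) %ₘ q) = 0 := by
      have h := congrArg (aeval x) (modByMonic_add_div (P.map (algebraMap ℤ ℚ)) q)
      rw [map_add, map_mul, hqx, zero_mul, add_zero, aeval_map_algebraMap] at h
      rw [h]; exact hPx
    obtain ⟨u, v, huv⟩ := exists_eq_X_add_C_of_natDegree_le_one
      (p := P.map (algebraMap ℤ ℚ) %ₘ q) (natDegree_le_iff_coeff_eq_zero.2 fun n hn =>
        (degree_lt_iff_coeff_zero _ _).1 hdeg n hn)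
    rw [huv] at hr ⊢
    simp only [map_add, map_mul, aeval_X, aeval_C] at hr
    by_cases hu : u = 0
    · subst hu
      simp at hr
      rw [hr]; simp
    · exfalso
      refine hs (-(u⁻¹ * v)) ?_
      have : x = algebraMap ℚ B (u⁻¹) * (algebraMap ℚ B u * x) := by
        rw [← mul_assoc, ← map_mul, inv_mul_cancel₀ hu, map_one, one_mul]
      rw [this, eq_neg_of_add_eq_zero_left hr, mul_neg, ← map_mul, ← map_neg]
  obtain ⟨g, hg⟩ := IsIntegrallyClosed.eq_map_mul_C_of_dvd ℚ hP hdvd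
  rw [hq.leadingCoeff, C_1, mul_one] at hg
  refine ⟨-g.coeff 1, g.coeff 0, ?_, ?_⟩
  · have := congrArg (coeff · 1) hg
    simp [q, coeff_C] at this
    push_cast
    linarith
  · have := congrArg (coeff · 0) hg
    simp [q, coeff_X, coeff_C] at this
    exact this.symm

theorem isIntegral_of_mem_order {O : Subalgebra ℤ B} (hO : (Subalgebra.toSubmodule O).FG) {x : B}
    (hx : x ∈ O) : IsIntegral ℤ x := by
  have : Module.Finite ℤ O := Module.Finite.iff_fg.2 hO
  exact (IsIntegral.of_finite ℤ (⟨x, hx⟩ : O)).map O.val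

/-- Multiplication into a nonzero `y` of `I` embeds the left order in the finitely generated group
`I`. -/
theorem isIntegral_of_mem_leftOrder (hdiv : ∀ x : B, x ≠ 0 → IsUnit x) {I : Submodule ℤ B}
    (hI : Submodule.IsLattice ℚ I) {x : B} (hx : x ∈ leftOrder I) : IsIntegral ℤ x := by
  nontriviality B
  obtain ⟨y, hy, hy0⟩ : ∃ y ∈ I, y ≠ 0 := by
    by_contra! h
    have h1 : Submodule.span ℚ (I : Set B) = ⊥ := by
      rw [Submodule.span_eq_bot]; exact h
    rw [hI.span_eq_top] at h1
    exact top_ne_bot h1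
  obtain ⟨y, rfl⟩ := hdiv y hy0
  have hfin : Module.Finite ℤ I := Module.Finite.iff_fg.2 hI.fg
  let f : leftOrder I →ₗ[ℤ] I :=
    { toFun := fun α => ⟨α * y, α.2 _ hy⟩
      map_add' := fun α β => by ext; simp [add_mul]
      map_smul' := fun c α => by ext; simp [mul_assoc] }
  have : Module.Finite ℤ (leftOrder I) := Module.Finite.of_injective f fun α β h => by
    have := congrArg Subtype.val h
    exact Subtype.ext (y.isUnit.mul_left_injective this)
  exact (IsIntegral.of_finite ℤ (⟨x, hx⟩ : leftOrder I)).map (leftOrder I).val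

end Integral

/-! ### Units of left orders -/

section Units

variable {B : Type*} [Ring B] [Algebra ℚ B] {I : Submodule ℤ B}

theorem unitIndex_eq_one_iff : unitIndex I = 1 ↔
    ∀ u : (leftOrder I)ˣ, ((u : leftOrder I) : B) = 1 ∨ ((u : leftOrder I) : B) = -1 := by
  rw [unitIndex, Subgroup.index_eq_one, MonoidHom.range_eq_top]
  constructor
  · intro h u
    obtain ⟨n, rfl⟩ := h u
    rcases Int.units_eq_one_or n with rfl | rfl <;> simp
  · intro h u
    rcases h u with h | h
    · exact ⟨1, by ext; simp [h]⟩
    · exact ⟨-1, by ext; simp [h]⟩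

theorem unitIndex_eq_one_iff_forall_root (Q : ReducedForm ℚ B)
    (hpos : ∀ x : B, x ≠ 0 → 0 < Q.nm x) (hI : Submodule.IsLattice ℚ I) :
    unitIndex I = 1 ↔ ∀ t : ℤ, t = 0 ∨ t = 1 → ∀ α ∈ leftOrder I, ¬ (Q.tr α = t ∧ Q.nm α = 1) := by
  rw [unitIndex_eq_one_iff]
  constructor
  · rintro h t ht α hα ⟨h1, h2⟩
    have e := Q.root_of_tr_nm h1 h2
    have e' : α * ((t : ℚ) • 1 - α) = 1 := by
      rw [mul_sub, mul_smul_comm, mul_one, e]; abel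
    have e'' : ((t : ℚ) • 1 - α) * α = 1 := by
      rw [sub_mul, smul_mul_assoc, one_mul, e]; abel
    have hm : (t : ℚ) • 1 - α ∈ leftOrder I := by
      refine sub_mem ?_ hα
      rw [Int.cast_smul_eq_zsmul]
      exact zsmul_mem (one_mem _) t
    have := h ⟨⟨α, hα⟩, ⟨_, hm⟩, Subtype.ext e', Subtype.ext e''⟩
    rcases this with h | h
    · exact Q.ne_algebraMap ht h1 h2 1 (by rw [map_one]; exact h)
    · exact Q.ne_algebraMap ht h1 h2 (-1) (by rw [map_neg, map_one]; exact h)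
  · intro h u
    have hdiv : ∀ x : B, x ≠ 0 → IsUnit x := fun x hx => Q.isUnit_of_nm_ne_zero (hpos x hx).ne'
    obtain ⟨T, N, hT, hN⟩ := Q.exists_int_of_isIntegral
      (isIntegral_of_mem_leftOrder hdiv hI (u : leftOrder I).2)
    obtain ⟨T', N', hT', hN'⟩ := Q.exists_int_of_isIntegral
      (isIntegral_of_mem_leftOrder hdiv hI ((u⁻¹ : (leftOrder I)ˣ) : leftOrder I).2)
    set x : B := ((u : leftOrder I) : B) with hx
    have hmul : x * (((u⁻¹ : (leftOrder I)ˣ) : leftOrder I) : B) = 1 :=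
      congrArg Subtype.val u.mul_inv
    have hN1 : N = 1 := by
      have h1 : N * N' = 1 := by
        have := congrArg Q.nm hmul
        rw [map_mul, hN, hN', map_one] at this
        exact_mod_cast this
      have h2 : 0 ≤ N := by
        have : (0 : ℚ) ≤ N := by
          rw [← hN]
          by_cases h0 : x = 0
          · rw [h0, Q.nm_zero]
          · exact (hpos x h0).le
        exact_mod_cast this
      exact Int.eq_one_of_mul_eq_one_right h2 h1
    rw [hN1, Int.cast_one] at hN
    -- Positivity of this norm forces `|T| ≤ 1` unless `x` is scalar; `T = -1` is reduced to `T = 1`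
    -- by passing to `-x`.
    have hd : Q.nm ((2 : ℚ) • x - algebraMap ℚ B T) = 4 - T ^ 2 := by
      rw [Q.nm_sub, Q.nm_smul, Q.nm_algebraMap, Q.tr_algebraMap, ← Algebra.commutes,
        ← Algebra.smul_def, map_smul, map_smul, map_smul, hT, hN]
      simp only [smul_eq_mul]; ring
    by_cases h0 : (2 : ℚ) • x - algebraMap ℚ B T = 0
    · rw [h0, Q.nm_zero] at hd
      have h4 : T ^ 2 = 4 := by exact_mod_cast (sub_eq_zero.1 hd.symm).symm
      have h5 : x = algebraMap ℚ B (T / 2) := by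
        have : x = (2⁻¹ : ℚ) • ((2 : ℚ) • x) := by rw [smul_smul]; norm_num
        rw [this, sub_eq_zero.1 h0, Algebra.smul_def, ← map_mul, div_eq_inv_mul]
      have : T = 2 ∨ T = -2 := by
        have : (T - 2) * (T + 2) = 0 := by linear_combination h4
        rcases mul_eq_zero.1 this with h | h
        · left; omega
        · right; omega
      rcases this with rfl | rfl
      · left; rw [h5]; norm_num
      · right; rw [h5]; norm_num
    · exfalso
      have h4 := hpos _ h0
      rw [hd] at h4
      have h5 : T ^ 2 < 4 := by
        have : (T : ℚ) ^ 2 < 4 := by linarith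
        exact_mod_cast this
      have h6 : T = -1 ∨ T = 0 ∨ T = 1 := by
        have : -2 < T := by nlinarith
        have : T < 2 := by nlinarith
        omega
      rcases h6 with rfl | h6
      · refine h 1 (Or.inr rfl) (-x) (neg_mem (u : leftOrder I).2) ⟨?_, ?_⟩
        · rw [map_neg, hT]; norm_num
        · rw [Q.nm_neg, hN]
      · exact h T h6 x (u : leftOrder I).2 ⟨hT, hN⟩

end Units

/-! ### Splitting of primes in `ℚ[X] / (X² - tX + 1)` -/

/-- `X² - tX + 1` has a root modulo `p`. -/
def HasRootMod (t : ℤ) (p : ℕ) : Prop := ∃ a : ℤ, (p : ℤ) ∣ a ^ 2 - t * a + 1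

theorem mod_four_ne_three_iff {p : ℕ} (hp : p.Prime) : HasRootMod 0 p ↔ p % 4 ≠ 3 := by
  have := Fact.mk hp
  rw [← ZMod.exists_sq_eq_neg_one_iff, HasRootMod]
  constructor
  · rintro ⟨a, ha⟩
    rw [← ZMod.intCast_zmod_eq_zero_iff_dvd] at ha
    push_cast at ha
    exact ⟨a, by linear_combination -ha⟩
  · rintro ⟨a, ha⟩
    obtain ⟨a, rfl⟩ := ZMod.intCast_surjective a
    refine ⟨a, ?_⟩
    rw [← ZMod.intCast_zmod_eq_zero_iff_dvd]
    push_cast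
    linear_combination -ha

theorem mod_four_eq_three_iff {p : ℕ} (hp : p.Prime) : p % 4 = 3 ↔ ¬ HasRootMod 0 p := by
  rw [mod_four_ne_three_iff hp, not_not]

theorem mod_four_eq_one_iff {p : ℕ} (hp : p.Prime) : p % 4 = 1 ↔ HasRootMod 0 p ∧ p ≠ 2 := by
  rw [mod_four_ne_three_iff hp]
  rcases hp.eq_two_or_odd with rfl | h <;> omega

/-- The negative of a root is an element of order 3 in the units modulo `p`. -/
theorem mod_three_eq_one_of_hasRootMod {p : ℕ} (hp : p.Prime) (h : HasRootMod 1 p) (h3 : p ≠ 3) :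
    p % 3 = 1 := by
  have := Fact.mk hp
  obtain ⟨a, ha⟩ := h
  rw [← ZMod.intCast_zmod_eq_zero_iff_dvd] at ha
  push_cast at ha
  set b : ZMod p := -(a : ZMod p) with hb
  have hb2 : b ^ 2 + b + 1 = 0 := by rw [hb]; linear_combination ha
  have hb3 : b ^ 3 = 1 := by linear_combination (b - 1) * hb2
  have hb1 : b ≠ 1 := by
    intro h
    rw [h] at hb2
    have : ((3 : ℕ) : ZMod p) = 0 := by push_cast; linear_combination hb2
    rw [ZMod.natCast_eq_zero_iff] at this
    exact h3 ((Nat.prime_dvd_prime_iff_eq hp Nat.prime_three).1 this)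
  have hord := orderOf_eq_prime hb3 hb1
  have hb0 : b ≠ 0 := by rintro h; rw [h] at hb3; simp at hb3
  have h4 := ZMod.orderOf_dvd_card_sub_one hb0
  rw [hord] at h4
  have := hp.two_le
  omega

theorem hasRootMod_one_of_mod_three {p : ℕ} (hp : p.Prime) (h : p % 3 = 1) : HasRootMod 1 p := by
  have := Fact.mk hp
  have hcard : 3 ∣ Fintype.card (ZMod p)ˣ := by
    rw [ZMod.card_units]
    have := hp.two_le
    omega
  obtain ⟨u, hu⟩ := exists_prime_orderOf_dvd_card 3 hcard
  have h3 : u ^ 3 = 1 := by rw [← hu]; exact pow_orderOf_eq_one u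
  have h1 : (u : ZMod p) ≠ 1 := by
    intro h
    rw [Units.val_eq_one] at h
    rw [h, orderOf_one] at hu
    omega
  have h3' : (u : ZMod p) ^ 3 = 1 := by
    rw [← Units.val_pow_eq_pow_val, h3, Units.val_one]
  obtain ⟨a, ha⟩ := ZMod.intCast_surjective (-(u : ZMod p))
  refine ⟨a, ?_⟩
  rw [← ZMod.intCast_zmod_eq_zero_iff_dvd]
  push_cast
  rw [ha]
  refine mul_left_cancel₀ (sub_ne_zero.2 h1) ?_
  linear_combination h3'

theorem mod_three_eq_one_iff {p : ℕ} (hp : p.Prime) : p % 3 = 1 ↔ HasRootMod 1 p ∧ p ≠ 3 :=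
  ⟨fun h => ⟨hasRootMod_one_of_mod_three hp h, by rintro rfl; omega⟩,
    fun h => mod_three_eq_one_of_hasRootMod hp h.1 h.2⟩

theorem mod_three_eq_two_iff {p : ℕ} (hp : p.Prime) : p % 3 = 2 ↔ ¬ HasRootMod 1 p := by
  constructor
  · intro h hr
    have := mod_three_eq_one_of_hasRootMod hp hr (by rintro rfl; omega)
    omega
  · intro h
    by_contra h2
    have h0 : p % 3 ≠ 0 := fun h0 => by
      have := (Nat.prime_dvd_prime_iff_eq Nat.prime_three hp).1 (Nat.dvd_of_mod_eq_zero h0)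
      subst this
      exact h ⟨2, by norm_num⟩
    exact h (hasRootMod_one_of_mod_three hp (by omega))

variable {t : ℤ} {q : ℕ}

theorem dvd_disc_iff (ht : t = 0 ∨ t = 1) (hq : (q : ℤ) = 2 + t) {p : ℕ} (hp : p.Prime) :
    (p : ℤ) ∣ t ^ 2 - 4 ↔ p = q := by
  rcases ht with rfl | rfl
  · obtain rfl : q = 2 := by omega
    rw [show (0 : ℤ) ^ 2 - 4 = -((2 ^ 2 : ℕ) : ℤ) by norm_num, dvd_neg, Int.natCast_dvd_natCast]
    exact ⟨fun h => (Nat.prime_dvd_prime_iff_eq hp Nat.prime_two).1 (hp.dvd_of_dvd_pow h),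
      fun h => by rw [h]; norm_num⟩
  · obtain rfl : q = 3 := by omega
    rw [show (1 : ℤ) ^ 2 - 4 = -((3 : ℕ) : ℤ) by norm_num, dvd_neg, Int.natCast_dvd_natCast,
      Nat.prime_dvd_prime_iff_eq hp Nat.prime_three]

theorem prime_of_eq (ht : t = 0 ∨ t = 1) (hq : (q : ℤ) = 2 + t) : q.Prime := by
  rcases ht with rfl | rfl
  · obtain rfl : q = 2 := by omega
    exact Nat.prime_two
  · obtain rfl : q = 3 := by omega
    exact Nat.prime_three

-- The root is simple, since `(2a - t)² ≡ t² - 4` modulo `p`, and so lifts by Hensel.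
open Polynomial in
theorem HasRootMod.exists_padic_root {p : ℕ} [Fact p.Prime] (h : HasRootMod t p)
    (hD : ¬ (p : ℤ) ∣ t ^ 2 - 4) : ∃ r : ℚ_[p], r ^ 2 - t * r + 1 = 0 := by
  obtain ⟨a, ha⟩ := h
  have h1 : aeval (a : ℤ_[p]) (X ^ 2 - C (t : ℤ_[p]) * X + 1 : ℤ_[p][X])
      = ((a ^ 2 - t * a + 1 : ℤ) : ℤ_[p]) := by simp
  have h2 : aeval (a : ℤ_[p]) (derivative (X ^ 2 - C (t : ℤ_[p]) * X + 1 : ℤ_[p][X]))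
      = ((2 * a - t : ℤ) : ℤ_[p]) := by simp [one_add_one_eq_two]
  have h3 : ‖((2 * a - t : ℤ) : ℤ_[p])‖ = 1 := by
    refine le_antisymm (PadicInt.norm_le_one _) (not_lt.1 fun h => hD ?_)
    rw [PadicInt.norm_intCast_lt_one_iff] at h
    have := dvd_sub (h.mul_right (2 * a - t)) (ha.mul_right 4)
    rwa [show (2 * a - t) * (2 * a - t) - (a ^ 2 - t * a + 1) * 4 = t ^ 2 - 4 by ring] at this
  obtain ⟨z, hz, -⟩ := hensels_lemma (F := (X ^ 2 - C (t : ℤ_[p]) * X + 1 : ℤ_[p][X]))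
    (a := (a : ℤ_[p])) (by
      rw [h1, h2, h3, one_pow, PadicInt.norm_intCast_lt_one_iff]; exact ha)
  refine ⟨z, ?_⟩
  have : z ^ 2 - t * z + 1 = 0 := by simpa using hz
  exact_mod_cast congrArg ((↑) : ℤ_[p] → ℚ_[p]) this

theorem hasRootMod_of_isSquareMod {p : ℕ} (hp : p.Prime) (h2 : p ≠ 2)
    (h : IsSquareMod (p : ℤ) (t ^ 2 - 4)) : HasRootMod t p := by
  have hodd : Odd (p : ℤ) := by exact_mod_cast hp.odd_of_ne_two h2
  obtain ⟨x, hx⟩ := h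
  -- Adding the odd number `p` if necessary fixes the parity, so that `(t + y)/2` is an integer.
  obtain ⟨y, hy, a, ha⟩ : ∃ y : ℤ, (p : ℤ) ∣ y ^ 2 - (t ^ 2 - 4) ∧ Even (t + y) := by
    by_cases he : Even (t + x)
    · exact ⟨x, hx, he⟩
    · refine ⟨x + p, ?_, ?_⟩
      · rw [show (x + p : ℤ) ^ 2 - (t ^ 2 - 4) = (x ^ 2 - (t ^ 2 - 4)) + p * (2 * x + p) by ring]
        exact dvd_add hx (dvd_mul_right _ _)
      · rw [← add_assoc]
        exact (Int.not_even_iff_odd.1 he).add_odd hodd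
  refine ⟨a, ?_⟩
  have hy' : y = 2 * a - t := by linarith
  rw [hy', show (2 * a - t) ^ 2 - (t ^ 2 - 4) = 4 * (a ^ 2 - t * a + 1) by ring] at hy
  refine (IsCoprime.dvd_of_dvd_mul_left ?_ hy)
  have : IsCoprime (p : ℤ) (2 : ℤ) := by
    have := (Nat.coprime_primes hp Nat.prime_two).2 h2
    exact_mod_cast Nat.isCoprime_iff_coprime.2 this
  rw [show (4 : ℤ) = 2 * 2 by norm_num]
  exact this.mul_right this

theorem eq_sq_of_unique_prime_dvd {N : ℕ} (hN : 0 < N) (hq : q.Prime)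
    (h2 : ∀ p : ℕ, p.Prime → p ∣ N → padicValNat p N = 2) (h1 : N ≠ 1)
    (h : ∀ p : ℕ, p.Prime → p ∣ N → p = q) : N = q ^ 2 := by
  have := Fact.mk hq
  have e := Nat.eq_prime_pow_of_unique_prime_dvd hN.ne' fun {d} hd hdN => h d hd hdN
  obtain ⟨p, hp, hpN⟩ := Nat.exists_prime_and_dvd h1
  obtain rfl := h p hp hpN
  have h3 := h2 p hp hpN
  rw [e, padicValNat.prime_pow] at h3
  rw [h3] at e
  exact e

theorem padicValNat_mul_mul {p N₁ N₂ M : ℕ} [Fact p.Prime] (h1 : 0 < N₁) (h2 : 0 < N₂)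
    (h3 : 0 < M) : padicValNat p (N₁ * N₂ * M)
      = padicValNat p N₁ + padicValNat p N₂ + padicValNat p M := by
  rw [padicValNat.mul (by positivity) h3.ne', padicValNat.mul h1.ne' h2.ne']

namespace IsSpecialOfLevelType

variable {B : Type*} [Ring B] [Algebra ℚ B] {O : Subalgebra ℤ B} {N₁ N₂ M : ℕ}
  (h : IsSpecialOfLevelType O N₁ N₂ M) {p : ℕ} [Fact p.Prime]

include h

theorem padicValNat_eq_of_dvd₁ (hp : p ∣ N₁) :
    padicValNat p (N₁ * N₂ * M) = padicValNat p N₁ := by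
  rw [padicValNat_mul_mul h.pos₁ h.pos₂ h.pos₃,
    padicValNat.eq_zero_of_not_dvd (n := N₂) fun hd =>
      Nat.not_coprime_of_dvd_of_dvd (Fact.out : p.Prime).one_lt hp hd h.coprime₁₂,
    padicValNat.eq_zero_of_not_dvd (n := M) fun hd =>
      Nat.not_coprime_of_dvd_of_dvd (Fact.out : p.Prime).one_lt hp hd h.coprime₁₃]
  rfl

theorem padicValNat_eq_of_dvd₂ (hp : p ∣ N₂) :
    padicValNat p (N₁ * N₂ * M) = padicValNat p N₂ := by
  rw [padicValNat_mul_mul h.pos₁ h.pos₂ h.pos₃,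
    padicValNat.eq_zero_of_not_dvd (n := N₁) fun hd =>
      Nat.not_coprime_of_dvd_of_dvd (Fact.out : p.Prime).one_lt hd hp h.coprime₁₂,
    padicValNat.eq_zero_of_not_dvd (n := M) fun hd =>
      Nat.not_coprime_of_dvd_of_dvd (Fact.out : p.Prime).one_lt hp hd h.coprime₂₃]
  simp

theorem padicValNat_eq_of_dvd₃ (hp : p ∣ M) :
    padicValNat p (N₁ * N₂ * M) = padicValNat p M := by
  rw [padicValNat_mul_mul h.pos₁ h.pos₂ h.pos₃,
    padicValNat.eq_zero_of_not_dvd (n := N₁) fun hd =>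
      Nat.not_coprime_of_dvd_of_dvd (Fact.out : p.Prime).one_lt hd hp h.coprime₁₃,
    padicValNat.eq_zero_of_not_dvd (n := N₂) fun hd =>
      Nat.not_coprime_of_dvd_of_dvd (Fact.out : p.Prime).one_lt hd hp h.coprime₂₃]
  simp

theorem isLocalEichlerOrder (hp : ¬ p ∣ N₁ * N₂) : IsLocalEichlerOrder p
    (padicValNat p (N₁ * N₂ * M)) (completionAt p (Subalgebra.toSubmodule O)) := by
  rcases h.special p with h1 | ⟨h1, -⟩
  · exact h1
  · exact absurd ((h.ramified_iff p).2 h1) hp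

theorem isLeast (hp : p ∣ N₁ * N₂) :
    IsLeast {s : ℕ | ∃ E : IntermediateField ℚ_[p] (AlgebraicClosure ℚ_[p]),
      Module.finrank ℚ_[p] E = 2 ∧
      IsBasicOrder p E s (completionAt p (Subalgebra.toSubmodule O))}
      (padicValNat p (N₁ * N₂ * M)) := by
  rcases h.special p with ⟨φ, -⟩ | ⟨-, h1⟩
  · exact absurd ((h.ramified_iff p).1 hp) (exists_nonunit_of_matrix φ)
  · exact h1

theorem not_dvd_of_dvd₃ (hp : p ∣ M) : ¬ p ∣ N₁ * N₂ := fun hd =>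
  Nat.not_coprime_of_dvd_of_dvd (Fact.out : p.Prime).one_lt hd hp
    (Nat.Coprime.mul_left h.coprime₁₃ h.coprime₂₃)

end IsSpecialOfLevelType

/-! ### Local obstructions to a root in a left order -/

section Backward

variable {B : Type*} [Ring B] [Algebra ℚ B] {O : Subalgebra ℤ B} {N₁ N₂ M : ℕ} {a b : ℚ}
  (ha : a ≠ 0) (hb : b ≠ 0) (e : B ≃ₐ[ℚ] ℍ[ℚ, a, b])

include ha hb e

/-- With `I_p = x O_p`, the conjugate `x⁻¹αx` lies in `O_p` and has the same trace and norm. -/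
theorem exists_local_root {I : Submodule ℤ B} (hI : IsInvertibleRightIdeal O I) {α : B}
    (hα : α ∈ leftOrder I) (h1 : ((quaternionForm ha hb).comp e).tr α = t)
    (h2 : ((quaternionForm ha hb).comp e).nm α = 1) (p : ℕ) [Fact p.Prime] :
    ∃ β ∈ completionAt p (Subalgebra.toSubmodule O), (baseForm ℚ_[p] ha hb e).tr β = t ∧
      (baseForm ℚ_[p] ha hb e).nm β = 1 := by
  obtain ⟨x, hx⟩ := hI.locally_principal p
  have hxI : (x : Completion p B) ∈ completionAt p I := by
    rw [hx]; exact ⟨1, one_mem_completionAt O, by simp⟩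
  have h3 : (1 ⊗ₜ α : Completion p B) * x ∈ completionAt p I :=
    mul_mem_completionAt (I := Subalgebra.toSubmodule (leftOrder I)) (fun y hy z hz => hy z hz)
      (tmul_mem_completionAt hα) hxI
  rw [hx] at h3
  obtain ⟨β, hβ, h4⟩ := h3
  rw [LinearMap.mulLeft_apply] at h4
  have h5 : β = (x⁻¹ : (Completion p B)ˣ) * ((1 ⊗ₜ α : Completion p B) * x) := by
    rw [← h4, Units.inv_mul_cancel_left]
  refine ⟨β, hβ, ?_, ?_⟩
  · rw [h5, ReducedForm.tr_mul_comm, mul_assoc, Units.mul_inv, mul_one, baseForm_tr, h1]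
    simp
  · have := congrArg (baseForm ℚ_[p] ha hb e).nm h4
    rw [map_mul, map_mul, baseForm_nm, h2, map_one, one_mul] at this
    exact mul_left_cancel₀ (ReducedForm.nm_ne_zero_of_isUnit _ x.isUnit) (by rw [this, mul_one])

theorem IsSpecialOfLevelType.not_root (h : IsSpecialOfLevelType O N₁ N₂ M)
    (hN₂ : ∀ p : ℕ, p.Prime → p ∣ N₂ → padicValNat p N₂ = 2)
    (ht : t = 0 ∨ t = 1) (hq : (q : ℤ) = 2 + t)
    (hc : (∃ p : ℕ, p.Prime ∧ (HasRootMod t p ∧ p ≠ q) ∧ p ∣ N₁) ∨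
      (∃ p : ℕ, p.Prime ∧ ¬ HasRootMod t p ∧ p ∣ M) ∨ (N₂ ≠ 1 ∧ N₂ ≠ q ^ 2) ∨ q ^ 3 ∣ N₁)
    {I : Submodule ℤ B} (hI : IsInvertibleRightIdeal O I) {α : B} (hα : α ∈ leftOrder I) :
    ¬ (((quaternionForm ha hb).comp e).tr α = t ∧
      ((quaternionForm ha hb).comp e).nm α = 1) := by
  rintro ⟨h1, h2⟩
  have hloc := fun (p : ℕ) [Fact p.Prime] => exists_local_root ha hb e hI hα h1 h2 p
  rcases hc with ⟨p, hp, ⟨hr, hpq⟩, hpN⟩ | ⟨p, hp, hr, hpM⟩ | ⟨hN1, hNq⟩ | hqN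
  · have := Fact.mk hp
    obtain ⟨β, -, h3, h4⟩ := hloc p
    obtain ⟨r, hr⟩ := hr.exists_padic_root (by rwa [dvd_disc_iff ht hq hp])
    exact ReducedForm.root_ne_zero _ ((h.ramified_iff p).1 (hpN.mul_right _)) ht h3 h4 r hr
  · have := Fact.mk hp
    obtain ⟨β, hβ, h3, h4⟩ := hloc p
    refine hr ((h.isLocalEichlerOrder (h.not_dvd_of_dvd₃ hpM)).exists_dvd ?_ hβ
      (ReducedForm.root_of_tr_nm _ h3 h4))
    rw [h.padicValNat_eq_of_dvd₃ hpM]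
    exact one_le_padicValNat_of_dvd h.pos₃.ne' hpM
  · obtain ⟨p, hp, hpN, hpq⟩ : ∃ p : ℕ, p.Prime ∧ p ∣ N₂ ∧ p ≠ q := by
      by_contra! hall
      exact hNq (eq_sq_of_unique_prime_dvd h.pos₂ (prime_of_eq ht hq) hN₂ hN1 hall)
    have := Fact.mk hp
    obtain ⟨β, hβ, h3, h4⟩ := hloc p
    have hl := h.isLeast (p := p) (hpN.mul_left _)
    rw [h.padicValNat_eq_of_dvd₂ hpN, hN₂ p hp hpN] at hl
    exact ReducedForm.not_mem_of_isLeast_two _ ((h.ramified_iff p).1 (hpN.mul_left _)) ht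
      (by rwa [dvd_disc_iff ht hq hp]) h3 h4 hl hβ
  · have := Fact.mk (prime_of_eq ht hq)
    obtain ⟨β, hβ, h3, h4⟩ := hloc q
    have hdvd : q ∣ N₁ := (dvd_pow_self q (by norm_num)).trans hqN
    have hdiv := (h.ramified_iff q).1 (hdvd.mul_right _)
    have hv := h.padicValNat_eq_of_dvd₁ hdvd
    have hv3 : 3 ≤ padicValNat q N₁ := (padicValNat_dvd_iff_le h.pos₁.ne').1 hqN
    obtain ⟨E, hE2, hE, hE3⟩ := h.unramified_type q hdiv
      (by rw [hv]; exact h.odd₁ q (prime_of_eq ht hq) hdvd)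
    rw [hv] at hE3
    exact ReducedForm.not_mem_of_three_le _ hdiv hq h3 h4 hE2 hE hv3 hE3 hβ

end Backward

/-! ### Weak approximation -/

section Approximation

variable {B : Type*} [Ring B] [Algebra ℚ B] (O : Subalgebra ℤ B)

theorem tmul_zsmul_eq {p : ℕ} [Fact p.Prime] (n : ℤ) (x : B) :
    (1 ⊗ₜ (n • x) : Completion p B) = (n : ℤ_[p]) • (1 ⊗ₜ x : Completion p B) := by
  rw [Int.cast_smul_eq_zsmul]
  exact map_zsmul (Algebra.TensorProduct.includeRight : B →ₐ[ℚ] ℚ_[p] ⊗[ℚ] B) n x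

theorem exists_mem_sub_eq_pow_smul {p : ℕ} [Fact p.Prime] (k : ℕ) {z : Completion p B}
    (hz : z ∈ completionAt p (Subalgebra.toSubmodule O)) :
    ∃ w ∈ O, ∃ y ∈ completionAt p (Subalgebra.toSubmodule O),
      z - 1 ⊗ₜ w = (p : ℤ_[p]) ^ k • y := by
  induction hz using Submodule.span_induction with
  | mem x h =>
    obtain ⟨w, hw, rfl⟩ := h
    exact ⟨w, hw, 0, zero_mem _, by simp⟩
  | zero => exact ⟨0, zero_mem _, 0, zero_mem _, by simp⟩
  | add x y _ _ hx hy =>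
    obtain ⟨w, hw, u, hu, h1⟩ := hx
    obtain ⟨w', hw', u', hu', h2⟩ := hy
    refine ⟨w + w', add_mem hw hw', u + u', add_mem hu hu', ?_⟩
    rw [smul_add, ← h1, ← h2, TensorProduct.tmul_add]
    abel
  | smul c x hx' hx =>
    obtain ⟨w, hw, u, hu, h1⟩ := hx
    obtain ⟨d, hd⟩ := Ideal.mem_span_singleton.1 (PadicInt.appr_spec k c)
    rw [sub_eq_iff_eq_add] at hd
    refine ⟨(c.appr k : ℤ) • w, zsmul_mem hw _, (c.appr k : ℤ_[p]) • u + d • x,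
      add_mem (Submodule.smul_mem _ _ hu) (Submodule.smul_mem _ _ hx'), ?_⟩
    rw [tmul_zsmul_eq, smul_add, smul_comm, ← h1, smul_smul, smul_sub, Int.cast_natCast]
    nth_rewrite 1 [hd]
    rw [add_smul]
    abel

/-- Weak approximation in an order. -/
theorem exists_mem_forall_of_approx (S : Finset ℕ) (hS : ∀ p ∈ S, p.Prime)
    (U : ∀ (p : ℕ) [Fact p.Prime], B → Prop)
    (hU : ∀ (p : ℕ) [Fact p.Prime], p ∈ S →
      ∃ z ∈ completionAt p (Subalgebra.toSubmodule O), ∃ k : ℕ, ∀ w ∈ O,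
        (∃ y ∈ completionAt p (Subalgebra.toSubmodule O), z - 1 ⊗ₜ w = (p : ℤ_[p]) ^ k • y) →
          U p w) :
    ∃ w ∈ O, ∀ (p : ℕ) [Fact p.Prime], p ∈ S → U p w := by
  -- The induction is strengthened to a whole coset `w₀ + mO`, with `m` divisible only by primes of
  -- `S`. Then `m` is invertible at the next prime, where the coset can still be adjusted.
  suffices h : ∃ w₀ ∈ O, ∃ m : ℕ, (∀ p : ℕ, p.Prime → p ∣ m → p ∈ S) ∧
      ∀ w ∈ O, ∀ (p : ℕ) [Fact p.Prime], p ∈ S → U p (w₀ + (m : ℤ) • w) by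
    obtain ⟨w, hw, m, -, h⟩ := h
    exact ⟨w, hw, fun p _ hp => by simpa using h 0 (zero_mem _) p hp⟩
  induction S using Finset.induction_on with
  | empty =>
    refine ⟨0, zero_mem _, 1, fun p hp h => ?_, fun _ _ p _ hp => absurd hp (by simp)⟩
    exact absurd (Nat.dvd_one.1 h) hp.one_lt.ne'
  | insert p S hpS ih =>
    obtain ⟨w₀, hw₀, m, hm, hw⟩ := ih (fun p hp => hS p (Finset.mem_insert_of_mem hp))
      fun p _ hp => hU p (Finset.mem_insert_of_mem hp)
    have hp := hS p (Finset.mem_insert_self _ _)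
    have := Fact.mk hp
    obtain ⟨z, hz, k, hzk⟩ := hU p (Finset.mem_insert_self _ _)
    have hunit : IsUnit (m : ℤ_[p]) := by
      rw [PadicInt.isUnit_iff]
      refine le_antisymm (PadicInt.norm_le_one _) (not_lt.1 fun h => hpS (hm p hp ?_))
      have := (PadicInt.norm_intCast_lt_one_iff (p := p) (z := (m : ℤ))).1 (by simpa using h)
      exact_mod_cast this
    obtain ⟨c, hc⟩ := hunit.exists_right_inv
    obtain ⟨w₁, hw₁, y, hy, hwy⟩ := exists_mem_sub_eq_pow_smul O k (Submodule.smul_mem _ c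
      (sub_mem hz (tmul_mem_completionAt (p := p) (I := Subalgebra.toSubmodule O) hw₀)))
    refine ⟨w₀ + (m : ℤ) • w₁, add_mem hw₀ (zsmul_mem hw₁ _), m * p ^ k, fun l hl h => ?_,
      fun w hwO l _ hl => ?_⟩
    · rcases hl.dvd_mul.1 h with h | h
      · exact Finset.mem_insert_of_mem (hm l hl h)
      · rw [(Nat.prime_dvd_prime_iff_eq hl hp).1 (hl.dvd_of_dvd_pow h)]
        exact Finset.mem_insert_self _ _
    · have e : w₀ + (m : ℤ) • w₁ + ((m * p ^ k : ℕ) : ℤ) • w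
          = w₀ + (m : ℤ) • (w₁ + ((p : ℤ) ^ k) • w) := by
        rw [smul_add, smul_smul]; push_cast; rw [add_assoc]
      rcases Finset.mem_insert.1 hl with rfl | hl
      · refine hzk _ (add_mem (add_mem hw₀ (zsmul_mem hw₁ _)) (zsmul_mem hwO _))
          ⟨(m : ℤ_[l]) • y - (m : ℤ_[l]) • (1 ⊗ₜ w), sub_mem (Submodule.smul_mem _ _ hy)
            (Submodule.smul_mem _ _ (tmul_mem_completionAt hwO)), ?_⟩
        have h1 : z - 1 ⊗ₜ w₀ = (m : ℤ_[l]) • (c • (z - 1 ⊗ₜ w₀)) := by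
          rw [smul_smul, hc, one_smul]
        rw [e, TensorProduct.tmul_add, tmul_zsmul_eq, TensorProduct.tmul_add, tmul_zsmul_eq,
          smul_sub, smul_comm _ (m : ℤ_[l]) y, ← hwy, ← sub_sub]
        conv_lhs => rw [h1]
        simp only [smul_sub, smul_add, Int.cast_pow, Int.cast_natCast]
        rw [smul_comm ((l : ℤ_[l]) ^ k) (m : ℤ_[l])]
        abel
      · rw [e]
        exact hw _ (add_mem hw₁ (zsmul_mem hwO _)) l hl

theorem exists_int_smul_mem {O : Subalgebra ℤ B} (hO : Submodule.IsLattice ℚ (Subalgebra.toSubmodule O))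
    (x : B) : ∃ n : ℤ, n ≠ 0 ∧ n • x ∈ O := by
  have hx : x ∈ Submodule.span ℚ ((Subalgebra.toSubmodule O : Submodule ℤ B) : Set B) := by
    rw [hO.span_eq_top]; trivial
  induction hx using Submodule.span_induction with
  | mem x h => exact ⟨1, one_ne_zero, by simpa using h⟩
  | zero => exact ⟨1, one_ne_zero, by simp⟩
  | add x y _ _ hx hy =>
    obtain ⟨m, hm, h1⟩ := hx
    obtain ⟨n, hn, h2⟩ := hy
    refine ⟨m * n, mul_ne_zero hm hn, ?_⟩
    rw [smul_add]
    refine add_mem ?_ ?_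
    · rw [mul_comm, mul_smul]; exact zsmul_mem h1 _
    · rw [mul_smul]; exact zsmul_mem h2 _
  | smul c x _ hx =>
    obtain ⟨m, hm, h1⟩ := hx
    refine ⟨c.den * m, mul_ne_zero (by simp) hm, ?_⟩
    have : ((c.den * m : ℤ)) • c • x = c.num • (m • x) := by
      rw [← Int.cast_smul_eq_zsmul ℚ, ← Int.cast_smul_eq_zsmul ℚ m, ← Int.cast_smul_eq_zsmul ℚ c.num,
        smul_smul, smul_smul]
      congr 1
      push_cast
      have := Rat.den_mul_eq_num c
      linear_combination (m : ℚ) * this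
    rw [this]
    exact zsmul_mem h1 _

theorem exists_pow_smul_mem {O : Subalgebra ℤ B} {p : ℕ} [Fact p.Prime]
    (hO : Submodule.IsLattice ℚ (Subalgebra.toSubmodule O)) (x : Completion p B) :
    ∃ k : ℕ, ∀ l, k ≤ l → (p : ℤ_[p]) ^ l • x ∈ completionAt p (Subalgebra.toSubmodule O) := by
  suffices h : ∃ k : ℕ, (p : ℤ_[p]) ^ k • x ∈ completionAt p (Subalgebra.toSubmodule O) by
    obtain ⟨k, hk⟩ := h
    refine ⟨k, fun l hl => ?_⟩
    obtain ⟨d, rfl⟩ := Nat.exists_eq_add_of_le hl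
    rw [add_comm, pow_add, mul_smul]
    exact Submodule.smul_mem _ _ hk
  induction x using TensorProduct.induction_on with
  | zero => exact ⟨0, by simp⟩
  | add x y hx hy =>
    obtain ⟨k, hk⟩ := hx
    obtain ⟨l, hl⟩ := hy
    refine ⟨k + l, ?_⟩
    rw [smul_add]
    refine add_mem ?_ ?_
    · rw [add_comm, pow_add, mul_smul]; exact Submodule.smul_mem _ _ hk
    · rw [pow_add, mul_smul]; exact Submodule.smul_mem _ _ hl
  | tmul c x =>
    obtain ⟨n, hn, hx⟩ := exists_int_smul_mem hO x
    have hn' : (n : ℚ_[p]) ≠ 0 := by exact_mod_cast hn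
    obtain ⟨k, hk⟩ : ∃ k : ℕ, ‖(p : ℚ_[p]) ^ k * (c / n)‖ ≤ 1 := by
      by_cases hc : c / n = 0
      · exact ⟨0, by simp [hc]⟩
      obtain ⟨k, hk⟩ := exists_pow_lt_of_lt_one (norm_pos_iff.2 hc |> inv_pos.2)
        (ReducedForm.norm_natCast_p (p := p))
      refine ⟨k, ?_⟩
      rw [norm_mul, norm_pow]
      have := norm_pos_iff.2 hc
      calc _ ≤ ‖c / n‖⁻¹ * ‖c / n‖ := by gcongr
        _ = 1 := inv_mul_cancel₀ this.ne'
    refine ⟨k, ?_⟩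
    obtain ⟨d, hd⟩ : ∃ d : ℤ_[p], (d : ℚ_[p]) = (p : ℚ_[p]) ^ k * (c / n) := ⟨⟨_, hk⟩, rfl⟩
    have : (p : ℤ_[p]) ^ k • (c ⊗ₜ x : Completion p B)
        = d • (1 ⊗ₜ (n • x) : Completion p B) := by
      rw [tmul_zsmul_eq, ← IsScalarTower.algebraMap_smul ℚ_[p],
        ← IsScalarTower.algebraMap_smul ℚ_[p] d ((n : ℤ_[p]) • (1 ⊗ₜ x : Completion p B)),
        ← IsScalarTower.algebraMap_smul ℚ_[p] (n : ℤ_[p]), smul_smul, TensorProduct.smul_tmul',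
        TensorProduct.smul_tmul']
      congr 1
      simp only [map_pow, map_natCast, map_intCast, smul_eq_mul, mul_one]
      rw [show algebraMap ℤ_[p] ℚ_[p] d = _ from hd]
      field_simp
    rw [this]
    exact Submodule.smul_mem _ _ (tmul_mem_completionAt hx)

end Approximation

/-! ### Units of the form `1 + py` in a completed order -/

section Inverse

variable {B : Type*} [Ring B] [Algebra ℚ B] {O : Subalgebra ℤ B} {a b : ℚ}
  (ha : a ≠ 0) (hb : b ≠ 0) (e : B ≃ₐ[ℚ] ℍ[ℚ, a, b]) {p : ℕ} [Fact p.Prime]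

include ha hb e

theorem norm_tr_le_one_of_mem_completionAt (hO : (Subalgebra.toSubmodule O).FG)
    {x : Completion p B} (hx : x ∈ completionAt p (Subalgebra.toSubmodule O)) :
    ‖(baseForm ℚ_[p] ha hb e).tr x‖ ≤ 1 := by
  induction hx using Submodule.span_induction with
  | mem x h =>
    obtain ⟨w, hw, rfl⟩ := h
    obtain ⟨T, -, hT, -⟩ := ((quaternionForm ha hb).comp e).exists_int_of_isIntegral
      (isIntegral_of_mem_order hO hw)
    have := baseForm_tr ℚ_[p] ha hb e w
    rw [hT, map_intCast] at this
    rw [Algebra.TensorProduct.includeRight_apply, this]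
    exact Padic.norm_int_le_one _
  | zero => simp
  | add x y _ _ hx hy =>
    rw [map_add]
    exact (IsUltrametricDist.norm_add_le_max _ _).trans (max_le hx hy)
  | smul c x _ hx =>
    rw [← IsScalarTower.algebraMap_smul ℚ_[p] c x, map_smul, smul_eq_mul, norm_mul]
    exact mul_le_one₀ c.2 (norm_nonneg _) hx

theorem norm_nm_le_one_of_mem_completionAt (hO : (Subalgebra.toSubmodule O).FG)
    {x : Completion p B} (hx : x ∈ completionAt p (Subalgebra.toSubmodule O)) :
    ‖(baseForm ℚ_[p] ha hb e).nm x‖ ≤ 1 := by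
  induction hx using Submodule.span_induction with
  | mem x h =>
    obtain ⟨w, hw, rfl⟩ := h
    obtain ⟨-, N, -, hN⟩ := ((quaternionForm ha hb).comp e).exists_int_of_isIntegral
      (isIntegral_of_mem_order hO hw)
    have := baseForm_nm ℚ_[p] ha hb e w
    rw [hN, map_intCast] at this
    rw [Algebra.TensorProduct.includeRight_apply, this]
    exact Padic.norm_int_le_one _
  | zero => simp [ReducedForm.nm_zero]
  | add x y hx' hy' hx hy =>
    have h1 := norm_tr_le_one_of_mem_completionAt ha hb e hO hx'
    have h2 := norm_tr_le_one_of_mem_completionAt ha hb e hO hy'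
    have h3 := norm_tr_le_one_of_mem_completionAt ha hb e hO
      (mul_mem_completionAt_subalgebra O hx' hy')
    rw [ReducedForm.nm_add, sub_eq_add_neg]
    refine (IsUltrametricDist.norm_add_le_max _ _).trans (max_le
      ((IsUltrametricDist.norm_add_le_max _ _).trans (max_le hx hy))
      ((IsUltrametricDist.norm_add_le_max _ _).trans (max_le ?_ (by rwa [norm_neg]))))
    rw [norm_mul]
    exact mul_le_one₀ h1 (norm_nonneg _) h2
  | smul c x _ hx =>
    exact (ReducedForm.norm_nm_smul_le _ c x).trans hx

/-- The norm of `1 + py` is 1 modulo `p`, so the inverse, conjugate over norm, stays in the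
completed order. -/
theorem exists_inv_one_add_smul (hO : (Subalgebra.toSubmodule O).FG)
    {y : Completion p B} (hy : y ∈ completionAt p (Subalgebra.toSubmodule O)) :
    ∃ g : (Completion p B)ˣ, (g : Completion p B) = 1 + (p : ℤ_[p]) • y ∧
      (g : Completion p B) ∈ completionAt p (Subalgebra.toSubmodule O) ∧
      ((g⁻¹ : (Completion p B)ˣ) : Completion p B) ∈ completionAt p (Subalgebra.toSubmodule O) := by
  set Q := baseForm ℚ_[p] ha hb e with hQ
  set g : Completion p B := 1 + (p : ℤ_[p]) • y with hg
  have hgO : g ∈ completionAt p (Subalgebra.toSubmodule O) :=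
    add_mem (one_mem_completionAt O) (Submodule.smul_mem _ _ hy)
  have htr := norm_tr_le_one_of_mem_completionAt ha hb e hO hgO
  have hcO : Q.conj g ∈ completionAt p (Subalgebra.toSubmodule O) :=
    sub_mem (algebraMap_mem_completionAt O ⟨_, htr⟩) hgO
  have hn : ‖Q.nm g - 1‖ < 1 := by
    have h1 : Q.nm g - 1 = p * (Q.tr y + p * Q.nm y) := by
      rw [hg, ← IsScalarTower.algebraMap_smul ℚ_[p], add_comm, ← map_one (algebraMap ℚ_[p] _),
        ReducedForm.nm_add_algebraMap, ReducedForm.nm_smul, map_smul]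
      simp only [map_natCast, smul_eq_mul]
      ring
    have h2 : ‖Q.tr y + p * Q.nm y‖ ≤ 1 := by
      refine (IsUltrametricDist.norm_add_le_max _ _).trans (max_le
        (norm_tr_le_one_of_mem_completionAt ha hb e hO hy) ?_)
      rw [norm_mul]
      exact mul_le_one₀ ReducedForm.norm_natCast_p.le (norm_nonneg _)
        (norm_nm_le_one_of_mem_completionAt ha hb e hO hy)
    rw [h1, norm_mul]
    exact (mul_le_of_le_one_right (norm_nonneg _) h2).trans_lt ReducedForm.norm_natCast_p
  have hn1 : ‖Q.nm g‖ = 1 := by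
    have := IsUltrametricDist.norm_add_eq_max_of_norm_ne_norm (x := Q.nm g - 1) (y := 1)
      (by rw [norm_one]; exact hn.ne)
    rw [sub_add_cancel, norm_one, max_eq_right hn.le] at this
    exact this
  have hn0 : Q.nm g ≠ 0 := by rw [← norm_ne_zero_iff, hn1]; exact one_ne_zero
  refine ⟨⟨g, (Q.nm g)⁻¹ • Q.conj g, ?_, ?_⟩, rfl, hgO, ?_⟩
  · rw [mul_smul_comm, Q.mul_conj, Algebra.algebraMap_eq_smul_one, smul_smul,
      inv_mul_cancel₀ hn0, one_smul]
  · rw [smul_mul_assoc, Q.conj_mul, Algebra.algebraMap_eq_smul_one, smul_smul,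
      inv_mul_cancel₀ hn0, one_smul]
  · change (Q.nm g)⁻¹ • Q.conj g ∈ _
    have h1 : ‖(Q.nm g)⁻¹‖ ≤ 1 := by rw [norm_inv, hn1, inv_one]
    obtain ⟨d, hd⟩ : ∃ d : ℤ_[p], (d : ℚ_[p]) = (Q.nm g)⁻¹ := ⟨⟨_, h1⟩, rfl⟩
    have := Submodule.smul_mem _ d hcO
    rwa [← IsScalarTower.algebraMap_smul ℚ_[p], show algebraMap ℤ_[p] ℚ_[p] d = _ from hd] at this

end Inverse

/-! ### Construction of invertible ideals with extra units -/

section Forward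

variable {B : Type*} [Ring B] [Algebra ℚ B] {O : Subalgebra ℤ B} {a b : ℚ}
  (ha : a ≠ 0) (hb : b ≠ 0) (e : B ≃ₐ[ℚ] ℍ[ℚ, a, b])

include ha hb e

/-- An element that is locally conjugate into an order at finitely many primes is globally
conjugate to an element that lies in the order at these primes. -/
theorem exists_conj_forall_mem (hdiv : ∀ x : B, x ≠ 0 → IsUnit x)
    (hO : Submodule.IsLattice ℚ (Subalgebra.toSubmodule O)) (S : Finset ℕ)
    (hS : ∀ p ∈ S, p.Prime) (α : B)
    (h : ∀ (p : ℕ) [Fact p.Prime], p ∈ S → ∃ x : (Completion p B)ˣ,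
      ((x⁻¹ : (Completion p B)ˣ) : Completion p B) * (1 ⊗ₜ α : Completion p B) * x ∈
        completionAt p (Subalgebra.toSubmodule O)) :
    ∃ x : Bˣ, ∀ (p : ℕ) [Fact p.Prime], p ∈ S →
      (1 ⊗ₜ ((x⁻¹ : Bˣ) * α * x) : Completion p B) ∈ completionAt p (Subalgebra.toSubmodule O) := by
  rcases S.eq_empty_or_nonempty with rfl | ⟨l, hl⟩
  · exact ⟨1, fun p _ hp => absurd hp (by simp)⟩
  obtain ⟨w, -, hw⟩ := exists_mem_forall_of_approx O S hS
    (fun p _ w => w ≠ 0 ∧ ∀ x : Bˣ, (x : B) = w → (1 ⊗ₜ ((x⁻¹ : Bˣ) * α * x) : Completion p B) ∈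
      completionAt p (Subalgebra.toSubmodule O)) fun p _ hp => by
    obtain ⟨x, hx⟩ := h p hp
    obtain ⟨k₁, hk₁⟩ := exists_pow_smul_mem hO (x : Completion p B)
    obtain ⟨k₂, hk₂⟩ := exists_pow_smul_mem hO ((x⁻¹ : (Completion p B)ˣ) : Completion p B)
    set k := max k₁ k₂
    -- Approximate `p^k x` to precision `p^(2k+1)`. One factor `p^k` is the scale, the second makes
    -- `p^k x⁻¹` integral, and the last `p` yields `w = p^k x g` with `g ≡ 1` a unit of `O_p`. The
    -- scalar `p^k` cancels in the conjugation.
    refine ⟨(p : ℤ_[p]) ^ k • (x : Completion p B), hk₁ k (le_max_left _ _), k + (k + 1), ?_⟩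
    rintro w - ⟨y, hy, hwy⟩
    obtain ⟨g, hg, hgO, hgO'⟩ := exists_inv_one_add_smul ha hb e hO.fg
      (neg_mem (mul_mem_completionAt_subalgebra O (hk₂ k (le_max_right _ _)) hy))
    have hwg : (1 ⊗ₜ w : Completion p B) = (p : ℤ_[p]) ^ k • (x * g : Completion p B) := by
      rw [hg, mul_add, mul_one, smul_mul_assoc, smul_neg, mul_neg, mul_smul_comm, mul_smul_comm,
        Units.mul_inv_cancel_left, smul_add, smul_neg, smul_smul, smul_smul,
        show (p : ℤ_[p]) ^ k * p * (p : ℤ_[p]) ^ k = (p : ℤ_[p]) ^ (k + (k + 1)) by ring, ← hwy]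
      abel
    have hpk : ((p : ℚ_[p]) ^ k) ≠ 0 := pow_ne_zero _ ReducedForm.p_ne_zero
    have hwg' : (1 ⊗ₜ w : Completion p B) = (p : ℚ_[p]) ^ k • (x * g : Completion p B) := by
      rw [hwg, ← IsScalarTower.algebraMap_smul ℚ_[p]]; simp
    have hnt : Nontrivial (Completion p B) := ⟨0, 1, fun h => by
      have := congrArg (baseForm ℚ_[p] ha hb e).nm h
      rw [ReducedForm.nm_zero, map_one] at this; exact zero_ne_one this⟩
    refine ⟨?_, ?_⟩
    · rintro rfl
      rw [TensorProduct.tmul_zero, eq_comm, smul_eq_zero] at hwg'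
      exact (x * g).ne_zero (by simpa using hwg'.resolve_left hpk)
    · rintro u rfl
      set v : Completion p B := 1 ⊗ₜ ((u⁻¹ : Bˣ) * α * u) with hv
      have h1 : (1 ⊗ₜ (u : B) : Completion p B) * v = (1 ⊗ₜ α) * (1 ⊗ₜ (u : B)) := by
        rw [hv, Algebra.TensorProduct.tmul_mul_tmul, Algebra.TensorProduct.tmul_mul_tmul,
          mul_assoc, Units.mul_inv_cancel_left]
      rw [hwg', smul_mul_assoc, mul_smul_comm] at h1
      have h2 := smul_right_injective _ hpk h1
      have h3 : v = (g⁻¹ : (Completion p B)ˣ) * ((x⁻¹ : (Completion p B)ˣ) * (1 ⊗ₜ α : Completion p B) * x) * g := by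
        have : v = (g⁻¹ : (Completion p B)ˣ) * ((x⁻¹ : (Completion p B)ˣ) * (x * g * v)) := by
          rw [mul_assoc (x : Completion p B), Units.inv_mul_cancel_left, Units.inv_mul_cancel_left]
        rw [this, h2]
        simp only [mul_assoc]
      rw [h3]
      exact mul_mem_completionAt_subalgebra O (mul_mem_completionAt_subalgebra O hgO' hx) hgO
  have := Fact.mk (hS l hl)
  obtain ⟨x, rfl⟩ := hdiv w (hw l hl).1
  exact ⟨x, fun p _ hp => (hw p hp).2 x rfl⟩

omit ha hb e in
theorem IsLocalEichlerOrder.exists_principal {p : ℕ} [Fact p.Prime] {A : Type*} [Ring A]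
    [Algebra ℚ_[p] A] [Algebra ℤ_[p] A] {Λ : Submodule ℤ_[p] A} (h : IsLocalEichlerOrder p 0 Λ)
    [IsScalarTower ℤ_[p] A A] [SMulCommClass ℤ_[p] A A]
    (α : A) : ∃ x : Aˣ, Λ ⊔ Λ.map (LinearMap.mulLeft ℤ_[p] α) =
      Λ.map (LinearMap.mulLeft ℤ_[p] (x : A)) := by
  obtain ⟨φ, hφ⟩ := h
  simp only [pow_zero, isUnit_one.dvd, true_and] at hφ
  obtain ⟨X, hX⟩ := exists_unit_of_column_lattice (φ α)
  refine ⟨Units.map (φ.symm : _ →* A) X, ?_⟩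
  ext y
  rw [Submodule.mem_sup]
  constructor
  · rintro ⟨u, hu, _, ⟨v, hv, rfl⟩, rfl⟩
    obtain ⟨u', hu'⟩ := (hφ u).1 hu
    obtain ⟨v', hv'⟩ := (hφ v).1 hv
    obtain ⟨z, hz⟩ := (hX (φ (u + α * v))).1 ⟨u', v', by rw [map_add, map_mul, hu', hv']⟩
    refine ⟨φ.symm (z.map (fun z : ℤ_[p] => (z : ℚ_[p]))), (hφ _).2 ⟨z, by simp⟩, φ.injective ?_⟩
    simp [hz]
  · rintro ⟨z, hz, rfl⟩
    obtain ⟨z', hz'⟩ := (hφ z).1 hz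
    obtain ⟨u, v, huv⟩ := (hX (X * φ z)).2 ⟨z', by rw [hz']⟩
    refine ⟨φ.symm (u.map (fun z : ℤ_[p] => (z : ℚ_[p]))), (hφ _).2 ⟨u, by simp⟩, _,
      ⟨φ.symm (v.map (fun z : ℤ_[p] => (z : ℚ_[p]))), (hφ _).2 ⟨v, by simp⟩, rfl⟩,
      φ.injective ?_⟩
    simp [huv]

-- The ideal is `O + αO`. It is stable under `α` because `α² = tα - 1`, and locally it is either
-- `O_p` itself or an ideal of a matrix ring over `ℤ_p`.
omit ha hb e in
theorem exists_isInvertibleRightIdeal (hO : Submodule.IsLattice ℚ (Subalgebra.toSubmodule O))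
    {α : B} {t : ℤ} (hα : α * α = (t : ℚ) • α - 1)
    (h : ∀ (p : ℕ) [Fact p.Prime],
      (1 ⊗ₜ α : Completion p B) ∈ completionAt p (Subalgebra.toSubmodule O) ∨
      IsLocalEichlerOrder p 0 (completionAt p (Subalgebra.toSubmodule O))) :
    ∃ I, IsInvertibleRightIdeal O I ∧ α ∈ leftOrder I := by
  refine ⟨Subalgebra.toSubmodule O ⊔ (Subalgebra.toSubmodule O).map (LinearMap.mulLeft ℤ α),
    ⟨⟨?_, ?_⟩, ?_, ?_⟩, ?_⟩
  · exact hO.fg.sup (hO.fg.map _)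
  · rw [eq_top_iff, ← hO.span_eq_top]
    exact Submodule.span_mono fun x hx => Submodule.mem_sup_left hx
  · rintro x hx y hy
    obtain ⟨u, hu, _, ⟨v, hv, rfl⟩, rfl⟩ := Submodule.mem_sup.1 hx
    rw [add_mul, LinearMap.mulLeft_apply, mul_assoc]
    exact Submodule.add_mem_sup (O.mul_mem hu hy) ⟨v * y, O.mul_mem hv hy, rfl⟩
  · intro p _
    rw [completionAt_sup, completionAt_map_mulLeft]
    rcases h p with h | h
    · refine ⟨1, ?_⟩
      rw [sup_eq_left.2]
      · rw [Units.val_one, LinearMap.mulLeft_one, Submodule.map_id]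
      · rintro _ ⟨y, hy, rfl⟩
        exact mul_mem_completionAt_subalgebra O h hy
    · exact h.exists_principal _
  · intro x hx
    obtain ⟨u, hu, _, ⟨v, hv, rfl⟩, rfl⟩ := Submodule.mem_sup.1 hx
    rw [mul_add, LinearMap.mulLeft_apply, ← mul_assoc, hα, sub_mul, one_mul, smul_mul_assoc,
      Int.cast_smul_eq_zsmul, show α * u + (t • (α * v) - v) = -v + α * (u + t • v) by
        rw [mul_add, mul_smul_comm]; abel]
    exact Submodule.add_mem_sup (neg_mem hv) ⟨_, add_mem hu (zsmul_mem hv t), rfl⟩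

variable {N₁ N₂ M : ℕ} {t : ℤ} {q : ℕ}

/-- No conjugation is needed at `q` when `q` divides `N₁N₂`, where the level exponent is 1 or 2. At
other primes of `N₁` the root is conjugated into the integers of the unramified field, and at primes
of `M` to a matrix built from a root modulo `p`. -/
theorem IsSpecialOfLevelType.exists_local_conj (h : IsSpecialOfLevelType O N₁ N₂ M)
    (hN₂ : ∀ p : ℕ, p.Prime → p ∣ N₂ → padicValNat p N₂ = 2) (hM : Squarefree M)
    (ht : t = 0 ∨ t = 1) (hq : (q : ℤ) = 2 + t)
    (c2 : ∀ p : ℕ, p.Prime → p ∣ M → HasRootMod t p)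
    (c3 : N₂ = 1 ∨ N₂ = q ^ 2) (c4 : ¬ q ^ 3 ∣ N₁) {α : B}
    (h1 : ((quaternionForm ha hb).comp e).tr α = t)
    (h2 : ((quaternionForm ha hb).comp e).nm α = 1) (p : ℕ) [Fact p.Prime]
    (hp : p ∣ N₁ * N₂ * M) : ∃ x : (Completion p B)ˣ,
      ((x⁻¹ : (Completion p B)ˣ) : Completion p B) * (1 ⊗ₜ α : Completion p B) * x ∈
        completionAt p (Subalgebra.toSubmodule O) := by
  have hpp : p.Prime := Fact.out
  have h3 : (baseForm ℚ_[p] ha hb e).tr (1 ⊗ₜ α) = t := by rw [baseForm_tr, h1, map_intCast]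
  have h4 : (baseForm ℚ_[p] ha hb e).nm (1 ⊗ₜ α) = 1 := by rw [baseForm_nm, h2, map_one]
  rcases hpp.dvd_mul.1 hp with hp | hpM
  · have hdiv := (h.ramified_iff p).1 hp
    rcases hpp.dvd_mul.1 hp with hp1 | hp2
    · have hv := h.padicValNat_eq_of_dvd₁ hp1
      have hodd := h.odd₁ p hpp hp1
      obtain ⟨E, hE2, hE, hE3⟩ := h.unramified_type p hdiv (by rwa [hv])
      by_cases hpq : p = q
      · subst hpq
        have : padicValNat p N₁ = 1 := by
          have : ¬ 3 ≤ padicValNat p N₁ := fun hle =>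
            c4 ((padicValNat_dvd_iff_le h.pos₁.ne').2 hle)
          obtain ⟨k, hk⟩ := hodd
          omega
        rw [hv, this] at hE3
        refine ⟨1, ?_⟩
        simpa using ReducedForm.mem_of_isBasicOrder_one _ hdiv h4 hE3
      · exact ReducedForm.exists_conj_mem_of_unramified _ hdiv
          (fun x hx => baseChange_exists_eq_algebraMap_of_central ℚ_[p] ha hb e hx) ht
          (by rwa [dvd_disc_iff ht hq hpp]) h3 h4 hE2 hE hE3
    · have hpq : p = q := by
        rcases c3 with c3 | c3
        · rw [c3, Nat.dvd_one] at hp2; exact absurd hp2 hpp.one_lt.ne'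
        · rw [c3] at hp2
          exact (Nat.prime_dvd_prime_iff_eq hpp (prime_of_eq ht hq)).1 (hpp.dvd_of_dvd_pow hp2)
      subst hpq
      obtain ⟨⟨E, hE2, hE⟩, -⟩ := h.isLeast hp
      rw [h.padicValNat_eq_of_dvd₂ hp2, hN₂ p hpp hp2] at hE
      refine ⟨1, ?_⟩
      simpa using ReducedForm.mem_of_isBasicOrder_two _ hdiv hq h3 h4 hE
  · have hE := h.isLocalEichlerOrder (h.not_dvd_of_dvd₃ hpM)
    have hv : padicValNat p M = 1 := by
      refine le_antisymm ?_ (one_le_padicValNat_of_dvd h.pos₃.ne' hpM)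
      by_contra! hlt
      have := (padicValNat_dvd_iff_le h.pos₃.ne').2 (Nat.succ_le_of_lt hlt)
      rw [sq] at this
      exact hpp.one_lt.ne' (Nat.isUnit_iff.1 (hM p this))
    rw [h.padicValNat_eq_of_dvd₃ hpM, hv] at hE
    obtain ⟨r, hr⟩ := c2 p hpp hpM
    exact hE.exists_conj_mem (ReducedForm.root_of_tr_nm _ h3 h4)
      (fun c => ReducedForm.ne_algebraMap _ ht h3 h4 c) hr

theorem IsSpecialOfLevelType.exists_ideal_root (h : IsSpecialOfLevelType O N₁ N₂ M)
    (hpos : ∀ x : B, x ≠ 0 → 0 < ((quaternionForm ha hb).comp e).nm x)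
    (hN₂ : ∀ p : ℕ, p.Prime → p ∣ N₂ → padicValNat p N₂ = 2) (hM : Squarefree M)
    (ht : t = 0 ∨ t = 1) (hq : (q : ℤ) = 2 + t)
    (c1 : ∀ p : ℕ, p.Prime → p ∣ N₁ → HasRootMod t p → p = q)
    (c2 : ∀ p : ℕ, p.Prime → p ∣ M → HasRootMod t p)
    (c3 : N₂ = 1 ∨ N₂ = q ^ 2) (c4 : ¬ q ^ 3 ∣ N₁) :
    ∃ I, IsInvertibleRightIdeal O I ∧ ∃ α ∈ leftOrder I,
      ((quaternionForm ha hb).comp e).tr α = t ∧ ((quaternionForm ha hb).comp e).nm α = 1 := by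
  have : Fact (t = 0 ∨ t = 1) := ⟨ht⟩
  set Q := (quaternionForm ha hb).comp e with hQ
  have hdiv : ∀ x : B, x ≠ 0 → IsUnit x := fun x hx => Q.isUnit_of_nm_ne_zero (hpos x hx).ne'
  have hN : N₁ * N₂ * M ≠ 0 := by
    have := h.pos₁; have := h.pos₂; have := h.pos₃; positivity
  -- A prime split in the quadratic field differs from `q`, so `c1` and `c3` keep it from dividing
  -- `N₁N₂`, and `B` is split there.
  obtain ⟨α, h1, h2⟩ := exists_root (t := t) ha hb e (fun x hx => (hpos x hx).ne')
    fun p _ hp2 hpD hsq => by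
      have hpp : p.Prime := Fact.out
      have hr := hasRootMod_of_isSquareMod hpp hp2 hsq
      rw [dvd_disc_iff ht hq hpp] at hpD
      obtain ⟨φ, -⟩ := h.isLocalEichlerOrder (p := p) fun hd => hpD (by
        rcases hpp.dvd_mul.1 hd with hd | hd
        · exact c1 p hpp hd hr
        · rcases c3 with c3 | c3
          · rw [c3, Nat.dvd_one] at hd; exact absurd hd hpp.one_lt.ne'
          · rw [c3] at hd
            exact (Nat.prime_dvd_prime_iff_eq hpp (prime_of_eq ht hq)).1 (hpp.dvd_of_dvd_pow hd))
      exact ⟨φ⟩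
  obtain ⟨x, hx⟩ := exists_conj_forall_mem ha hb e hdiv h.isOrder (N₁ * N₂ * M).primeFactors
    (fun p hp => Nat.prime_of_mem_primeFactors hp) α fun p _ hp =>
      h.exists_local_conj ha hb e hN₂ hM ht hq c2 c3 c4 h1 h2 p (Nat.dvd_of_mem_primeFactors hp)
  have h3 : Q.tr ((x⁻¹ : Bˣ) * α * x) = t := by
    rw [Q.tr_mul_comm, Units.mul_inv_cancel_left, h1]
  have h4 : Q.nm ((x⁻¹ : Bˣ) * α * x) = 1 := by
    rw [map_mul, map_mul, h2, mul_one, ← map_mul, Units.inv_mul, map_one]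
  obtain ⟨I, hI, hαI⟩ := exists_isInvertibleRightIdeal h.isOrder (Q.root_of_tr_nm h3 h4)
    fun p _ => by
      by_cases hp : p ∣ N₁ * N₂ * M
      · exact Or.inl (hx p (Nat.mem_primeFactors.2 ⟨Fact.out, hp, hN⟩))
      · right
        have := h.isLocalEichlerOrder (p := p) fun hd => hp (hd.mul_right _)
        rwa [padicValNat.eq_zero_of_not_dvd hp] at this
  exact ⟨I, hI, _, hαI, h3, h4⟩

theorem IsSpecialOfLevelType.forall_not_root_iff (h : IsSpecialOfLevelType O N₁ N₂ M)
    (hpos : ∀ x : B, x ≠ 0 → 0 < ((quaternionForm ha hb).comp e).nm x)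
    (hN₂ : ∀ p : ℕ, p.Prime → p ∣ N₂ → padicValNat p N₂ = 2) (hM : Squarefree M)
    (ht : t = 0 ∨ t = 1) (hq : (q : ℤ) = 2 + t) :
    (∀ I, IsInvertibleRightIdeal O I → ∀ α ∈ leftOrder I,
      ¬ (((quaternionForm ha hb).comp e).tr α = t ∧
        ((quaternionForm ha hb).comp e).nm α = 1)) ↔
    ((∃ p : ℕ, p.Prime ∧ (HasRootMod t p ∧ p ≠ q) ∧ p ∣ N₁) ∨
      (∃ p : ℕ, p.Prime ∧ ¬ HasRootMod t p ∧ p ∣ M) ∨ (N₂ ≠ 1 ∧ N₂ ≠ q ^ 2) ∨ q ^ 3 ∣ N₁) := by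
  constructor
  · intro hI
    by_contra! hc
    obtain ⟨c1, c2, c3, c4⟩ := hc
    obtain ⟨I, hI', α, hα, hroot⟩ := h.exists_ideal_root ha hb e hpos hN₂ hM ht hq
      (fun p hp hpN hr => by_contra fun hpq => c1 p hp ⟨hr, hpq⟩ hpN)
      (fun p hp hpM => by_contra fun hr => c2 p hp hr hpM) (or_iff_not_imp_left.2 c3) c4
    exact hI I hI' α hα hroot
  · intro hc I hI α hα
    exact h.not_root ha hb e hN₂ ht hq hc hI hα

end Forward

end SpecialOrder

end

theorem mainTheorem11 {B : Type*} [Ring B] [Algebra ℚ B]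
    (hB : SpecialOrder.IsQuaternionAlgebra B) (hdef : SpecialOrder.IsDefinite B)
    (O : Subalgebra ℤ B) (N₁ N₂ M : ℕ)
    (hO : SpecialOrder.IsSpecialOfLevelType O N₁ N₂ M)
    (hN₂ : ∀ p : ℕ, p.Prime → p ∣ N₂ → padicValNat p N₂ = 2)
    (hM : Squarefree M) :
    SpecialOrder.IsBalanced O ↔
      (((∃ p : ℕ, p.Prime ∧ p % 4 = 1 ∧ p ∣ N₁) ∨
        (∃ p : ℕ, p.Prime ∧ p % 4 = 3 ∧ p ∣ M) ∨
        (N₂ ≠ 1 ∧ N₂ ≠ 4) ∨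
        8 ∣ N₁) ∧
       ((∃ p : ℕ, p.Prime ∧ p % 3 = 1 ∧ p ∣ N₁) ∨
        (∃ p : ℕ, p.Prime ∧ p % 3 = 2 ∧ p ∣ M) ∨
        (N₂ ≠ 1 ∧ N₂ ≠ 9) ∨
        27 ∣ N₁)) := by
  obtain ⟨a, b, ha, hb, ⟨e⟩⟩ := hB
  have hpos := fun (x : B) (hx : x ≠ 0) => hdef.nm_pos ha hb e hx
  have h₀ := hO.forall_not_root_iff ha hb e hpos hN₂ hM (t := 0) (q := 2) (Or.inl rfl) (by norm_num)
  have h₁ := hO.forall_not_root_iff ha hb e hpos hN₂ hM (t := 1) (q := 3) (Or.inr rfl) (by norm_num)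
  have e1 : ∀ p N : ℕ, (p.Prime ∧ p % 4 = 1 ∧ p ∣ N) ↔
      (p.Prime ∧ (SpecialOrder.HasRootMod 0 p ∧ p ≠ 2) ∧ p ∣ N) := fun p N =>
    and_congr_right fun hp => and_congr_left fun _ => SpecialOrder.mod_four_eq_one_iff hp
  have e2 : ∀ p N : ℕ, (p.Prime ∧ p % 4 = 3 ∧ p ∣ N) ↔
      (p.Prime ∧ ¬ SpecialOrder.HasRootMod 0 p ∧ p ∣ N) := fun p N =>
    and_congr_right fun hp => and_congr_left fun _ => SpecialOrder.mod_four_eq_three_iff hp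
  have e3 : ∀ p N : ℕ, (p.Prime ∧ p % 3 = 1 ∧ p ∣ N) ↔
      (p.Prime ∧ (SpecialOrder.HasRootMod 1 p ∧ p ≠ 3) ∧ p ∣ N) := fun p N =>
    and_congr_right fun hp => and_congr_left fun _ => SpecialOrder.mod_three_eq_one_iff hp
  have e4 : ∀ p N : ℕ, (p.Prime ∧ p % 3 = 2 ∧ p ∣ N) ↔
      (p.Prime ∧ ¬ SpecialOrder.HasRootMod 1 p ∧ p ∣ N) := fun p N =>
    and_congr_right fun hp => and_congr_left fun _ => SpecialOrder.mod_three_eq_two_iff hp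
  norm_num only at h₀ h₁
  simp only [e1, e2, e3, e4]
  rw [← h₀, ← h₁]
  constructor
  · intro h
    exact ⟨fun I hI α hα => (SpecialOrder.unitIndex_eq_one_iff_forall_root _ hpos hI.isLattice).1
        (h I hI) 0 (Or.inl rfl) α hα,
      fun I hI α hα => (SpecialOrder.unitIndex_eq_one_iff_forall_root _ hpos hI.isLattice).1
        (h I hI) 1 (Or.inr rfl) α hα⟩
  · rintro ⟨h0, h1⟩ I hI
    refine (SpecialOrder.unitIndex_eq_one_iff_forall_root _ hpos hI.isLattice).2 ?_
    rintro t (rfl | rfl) α hα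
    · exact h0 I hI α hα
    · exact h1 I hI α hα
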